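/- Setting. Let $\mathbf Z$ be a finite-dimensional real Hilbert space, and let $\mathbf H,\mathbf X$ be separable real Hilbert spaces with an injective Hilbert–Schmidt embedding $\iota:\mathbf H\hookrightarrow\mathbf X$ with dense range. Let $\beta>0$ and let $\gamma_\beta$ be the centred Gaussian measure on $\mathbf X$ with covariance operator $\beta^{-1}\iota\iota^*$. Let $\mathbf W\subset\mathbf H$ be a finite-dimensional subspace, $\mathbb P$ the orthogonal projection of $\mathbf H$ onto $\mathbf W$, $\mathbb Q=I-\mathbb P$, $\widehat{\mathbb P}:\mathbf X\to\mathbf W$ a measurable linear extension of $\mathbb P$ (measurable with respect to the $\gamma_\beta$-completion, equal to $\mathbb P$ on $\mathbf H$, and linear on a linear subspace of full $\gamma_\beta$-measure containing $\mathbf H$), and $\widehat{\mathbb Q}=\mathrm{id}-\widehat{\mathbb P}$. Let $C:\mathbf Z\to\mathbf H$ be linear with range in $\mathbf W$, and let $\mathcal H_A\in C^2(\mathbf Z)$ have a globally Lipschitz derivative and satisfy $e^{-\beta(\mathcal H_A(z)-\frac12\|Cz\|_{\mathbf H}^2)}\in L^1(\mathbf Z)$. Put $$\mathcal H_{\mathrm{total}}(z,\eta)=\mathcal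 H_A(z)+\tfrac12\|\eta\|_{\mathbf H}^2+(Cz|\eta)_{\mathbf H},\qquad H_{zw}(z,w)=\mathcal H_A(z)+(Cz|w)_{\mathbf H}+\tfrac12\|w\|_{\mathbf H}^2 .$$ Let $\Xi_0\subset\Xi_1\subset\cdots$ be subspaces of $\mathbf W^\perp$ with $\dim\Xi_n=n$ and $\overline{\bigcup_n\Xi_n}=\mathbf W^\perp$, and let $\Xi^{\mathbf X}$ be the closure of $\bigcup_n\Xi_n$ in $\mathbf X$. For a function $g$ on a finite-dimensional space $E$, $\boldsymbol\delta[g]$ denotes the locally finite measure (unique if it exists) with $\int\varphi\,d\boldsymbol\delta[g]=\lim_{h\downarrow0}\frac1h\int\varphi(x)\mathbf 1\{0\le g(x)<h\}\,dx$ for all $\varphi\in C_c(E)$; and for continuous $f$ on $E$, $\boldsymbol\delta[f(x)-a](dx)\,da$ denotes the measure on $E\times\mathbb R$ with $\int G(a)F(x)\,\boldsymbol\delta[f(x)-a](dx)\,da=\int G(f(x))F(x)\,dx$ for all $F\in C_c(E)$, $G\in C(\mathbb R)$. Fix $\mathcal E_0\in\mathbb R$. On $\mathbf Z\times(\mathbf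 W+\Xi_n)$ let $\mu_{\beta,n}$ be the normalisation to a probability measure of $\boldsymbol\delta[\mathcal H_{\mathrm{total}}-\frac n{2\beta}-\mathcal E_0]$, and let $\mu_{\beta,n,e}$ be its push-forward under $$T_n(z,\eta)=\bigl(z,\ \mathbb P\eta,\ \mathbb Q\eta,\ \tfrac12\|\mathbb Q\eta\|_{\mathbf H}^2-\tfrac n{2\beta}\bigr)\in\mathbf Z\times\mathbf W\times\Xi^{\mathbf X}\times\mathbb R .$$ Claim. For all sufficiently large $n$ the measure $\boldsymbol\delta[\mathcal H_{\mathrm{total}}-\frac n{2\beta}-\mathcal E_0]$ exists and has finite positive mass, so that $\mu_{\beta,n}$ is a well-defined probability measure. As $n\to\infty$, $\mu_{\beta,n,e}$ converges narrowly on $\mathbf Z\times\mathbf W\times\Xi^{\mathbf X}\times\mathbb R$ to the probability measure $$\mu_{\beta,e}(dz\,dw\,d\xi\,de)=\frac1{\mathsf Z_{\beta,\mathcal E_0}}\,e^{\beta e}\,\boldsymbol\delta[H_{zw}(z,w)-\mathcal E_0+e](dz\,dw)\,de\;(\widehat{\mathbb Q}_\#\gamma_\beta)(d\xi),$$ where $\mathsf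 Z_{\beta,\mathcal E_0}\in(0,\infty)$ is the normalising constant. If $\mathbf W\ne\{0\}$, then moreover $\boldsymbol\delta[H_{zw}-\mathcal E_0+e]$ exists for almost every $e\in\mathbb R$, and the factor $e^{\beta e}\boldsymbol\delta[H_{zw}-\mathcal E_0+e](dz\,dw)\,de$ is the integral over $e\in\mathbb R$ of these measures, weighted by $e^{\beta e}$. -/

import Mathlib

open MeasureTheory ProbabilityTheory Filter Topology BoundedContinuousFunction
open scoped InnerProductSpace

noncomputable section

section Delta

variable {E : Type*} [TopologicalSpace E] [MeasureSpace E]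

/-- `μ` is the microcanonical measure `δ[g]` of a function `g` on a space with a Lebesgue measure:
a locally finite measure with
`∫ φ dμ = lim_{h ↓ 0} (1/h) ∫ φ(x) 1{0 ≤ g(x) < h} dx` for all `φ ∈ C_c`. -/
def IsPDelta (g : E → ℝ) (μ : Measure E) : Prop :=
  IsFiniteMeasureOnCompacts μ ∧
    ∀ φ : E → ℝ, Continuous φ → HasCompactSupport φ →
      Tendsto (fun h : ℝ => h⁻¹ * ∫ x in {x | 0 ≤ g x ∧ g x < h}, φ x) (𝓝[>] 0)
        (𝓝 (∫ x, φ x ∂μ))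

open Classical in
/-- The microcanonical measure `δ[g]` whenever it makes sense (and `0` otherwise). -/
def pdelta (g : E → ℝ) : Measure E :=
  if h : ∃ μ, IsPDelta g μ then h.choose else 0

/-- The measure `δ[f(x) - a](dx) da` on `E × ℝ`: the image of Lebesgue measure under
`x ↦ (x, f x)`. -/
def pdeltaJoint (f : E → ℝ) : Measure (E × ℝ) :=
  (volume : Measure E).map (fun x => (x, f x))

/-- The identity that characterises `δ[f(x) - a](dx) da`:
`∫ G(a) F(x) δ[f(x) - a](dx) da = ∫ G(f(x)) F(x) dx`. -/
theorem integral_pdeltaJoint [OpensMeasurableSpace E] [SecondCountableTopology E]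
    {f : E → ℝ} (hf : Continuous f) {F : E → ℝ} (hF : Continuous F) {G : ℝ → ℝ}
    (hG : Continuous G) :
    ∫ p, G p.2 * F p.1 ∂(pdeltaJoint f) = ∫ x, G (f x) * F x := by
  rw [pdeltaJoint, integral_map]
  · exact (measurable_id.prodMk hf.measurable).aemeasurable
  · exact (((hG.comp continuous_snd).mul (hF.comp continuous_fst)).measurable).aestronglyMeasurable

end Delta

/-- The microcanonical measure of `g` is unique. -/
theorem IsPDelta.unique {E : Type*} [TopologicalSpace E] [T2Space E] [LocallyCompactSpace E]
    [SecondCountableTopology E] [MeasureSpace E] [BorelSpace E] {g : E → ℝ} {μ ν : Measure E}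
    (hμ : IsPDelta g μ) (hν : IsPDelta g ν) : μ = ν := by
  have := hμ.1
  have := hν.1
  have : μ.Regular := inferInstance
  have : ν.Regular := inferInstance
  exact Measure.ext_of_integral_eq_on_compactlySupported fun φ =>
    tendsto_nhds_unique (hμ.2 φ φ.continuous φ.hasCompactSupport)
      (hν.2 φ φ.continuous φ.hasCompactSupport)

/-- `pdelta g` is the microcanonical measure of `g` as soon as the latter exists. -/
theorem IsPDelta.eq_pdelta {E : Type*} [TopologicalSpace E] [T2Space E] [LocallyCompactSpace E]
    [SecondCountableTopology E] [MeasureSpace E] [BorelSpace E] {g : E → ℝ} {μ : Measure E}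
    (hμ : IsPDelta g μ) : pdelta g = μ := by
  have h : ∃ μ, IsPDelta g μ := ⟨μ, hμ⟩
  rw [pdelta, dif_pos h]
  exact h.choose_spec.unique hμ

/-- The measure `μ` divided by its total mass. -/
def normalized {E : Type*} [MeasurableSpace E] (μ : Measure E) : Measure E :=
  (μ Set.univ)⁻¹ • μ

section Gaussian

variable {H X : Type*} [NormedAddCommGroup H] [InnerProductSpace ℝ H]
  [NormedAddCommGroup X] [InnerProductSpace ℝ X]

/-- Hilbert-Schmidt operators: the squared norms are summable along an orthonormal basis. -/
def IsHilbertSchmidt (T : H →L[ℝ] X) : Prop :=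
  ∃ (s : Set H) (b : HilbertBasis s ℝ H), Summable fun i => ‖T (b i)‖ ^ 2

variable [CompleteSpace H] [CompleteSpace X] [MeasurableSpace X]

/-- `γ` is the centred Gaussian measure on `X` with covariance operator `β⁻¹ ι ι*`. -/
def IsCanonicalGaussian (β : ℝ) (ι : H →L[ℝ] X) (γ : Measure X) : Prop :=
  ∀ x : X, γ.map (fun y => ⟪x, y⟫_ℝ) =
    gaussianReal 0 (β⁻¹ * ⟪(ι ∘L ContinuousLinearMap.adjoint ι) x, x⟫_ℝ).toNNReal

open Classical in
/-- The canonical Gaussian measure of the heat bath. -/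
def canonicalGaussian (β : ℝ) (ι : H →L[ℝ] X) : Measure X :=
  if h : ∃ γ, IsCanonicalGaussian β ι γ then h.choose else 0

end Gaussian

/-- Existence of the Gaussian measure, as the law of a random series. -/
theorem gaussian_aux {H X κ : Type*} [NormedAddCommGroup H] [InnerProductSpace ℝ H] [CompleteSpace H]
    [NormedAddCommGroup X] [InnerProductSpace ℝ X] [CompleteSpace X]
    [SecondCountableTopology X] [MeasurableSpace X] [BorelSpace X] [Countable κ]
    (v : NNReal) (ι : H →L[ℝ] X) (b : HilbertBasis κ ℝ H) (hb : Summable fun i => ‖ι (b i)‖ ^ 2) :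
    ∃ γ : Measure X, IsProbabilityMeasure γ ∧ ∀ x, charFun γ x =
      Complex.exp (-(v * ‖ContinuousLinearMap.adjoint ι x‖ ^ 2 / 2 : ℝ)) := by
  classical
  let P : Measure (κ → ℝ) := Measure.infinitePi fun _ => gaussianReal 0 v
  have hev : ∀ i, P.map (fun ω => ω i) = gaussianReal 0 v := fun i =>
    Measure.infinitePi_map_eval (fun _ => gaussianReal 0 v) i
  have hmem : ∀ i, MemLp (fun ω : κ → ℝ => ω i) 2 P := fun i => by
    have h : MemLp id 2 (gaussianReal 0 v) := memLp_id_gaussianReal' 2 (by simp)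
    rw [← hev i] at h
    exact h.comp_of_map (measurable_pi_apply i).aemeasurable
  have hmemX : ∀ i, MemLp (fun ω : κ → ℝ => ω i • ι (b i)) 2 P := fun i => by
    have := (ContinuousLinearMap.toSpanSingleton ℝ (ι (b i))).comp_memLp' (hmem i)
    exact this
  let a : κ → Lp X 2 P := fun i => (hmemX i).toLp _
  have hint : ∀ i, ∫ ω, ω i ∂P = 0 := fun i => by
    have := integral_map (μ := P) (φ := fun ω => ω i) (measurable_pi_apply i).aemeasurable
      (f := fun x : ℝ => x) (by fun_prop)
    rw [hev i] at this
    rw [← this, integral_id_gaussianReal]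
  have hind : iIndepFun (fun i (ω : κ → ℝ) => ω i) P :=
    iIndepFun_infinitePi (P := fun _ => gaussianReal 0 v) (X := fun _ => id) (fun _ => measurable_id)
  have hortho : Pairwise fun i j => ⟪a i, a j⟫_ℝ = 0 := fun i j hij => by
    show ⟪a i, a j⟫_ℝ = 0
    rw [L2.inner_def]
    have h1 : (fun ω => ⟪(a i) ω, (a j) ω⟫_ℝ) =ᵐ[P]
        fun ω => (ω i * ω j) * ⟪ι (b i), ι (b j)⟫_ℝ := by
      filter_upwards [(hmemX i).coeFn_toLp, (hmemX j).coeFn_toLp] with ω h1 h2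
      simp only [a, h1, h2, inner_smul_left, inner_smul_right]
      simp; ring
    rw [integral_congr_ae h1, integral_mul_const,
      (hind.indepFun hij).integral_fun_mul_eq_mul_integral
        (measurable_pi_apply i).aestronglyMeasurable (measurable_pi_apply j).aestronglyMeasurable,
      hint i]
    simp
  obtain ⟨c, hc⟩ : ∃ c : ℝ, ∀ i, ‖a i‖ ^ 2 = c * ‖ι (b i)‖ ^ 2 := by
    refine ⟨∫ x, x * x ∂(gaussianReal 0 v), fun i => ?_⟩
    rw [← real_inner_self_eq_norm_sq, L2.inner_def]
    have h1 : (fun ω => ⟪(a i) ω, (a i) ω⟫_ℝ) =ᵐ[P]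
        fun ω => (ω i * ω i) * ‖ι (b i)‖ ^ 2 := by
      filter_upwards [(hmemX i).coeFn_toLp] with ω h1
      simp only [a, h1, inner_smul_left, inner_smul_right, real_inner_self_eq_norm_sq]
      simp; ring
    rw [integral_congr_ae h1, integral_mul_const, ← hev i,
      integral_map (measurable_pi_apply i).aemeasurable (by fun_prop)]
  have hsum : Summable a := by
    let G : κ → Submodule ℝ (Lp X 2 P) := fun i => Submodule.span ℝ {a i}
    have hG : OrthogonalFamily ℝ (fun i => G i) fun i => (G i).subtypeₗᵢ := by
      intro i j hij x y
      obtain ⟨r, hr⟩ := Submodule.mem_span_singleton.1 x.2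
      obtain ⟨s, hs⟩ := Submodule.mem_span_singleton.1 y.2
      show ⟪(x : Lp X 2 P), (y : Lp X 2 P)⟫_ℝ = 0
      rw [← hr, ← hs, inner_smul_left, inner_smul_right, hortho hij]
      simp
    have := (hG.summable_iff_norm_sq_summable
      (fun i => ⟨a i, Submodule.mem_span_singleton_self (a i)⟩)).2 (by
        simp only [Submodule.coe_norm, hc]
        exact hb.mul_left c)
    exact this
  obtain ⟨T, hT⟩ := hsum
  have hTm : TendstoInMeasure P (fun t : Finset κ => ((∑ i ∈ t, a i : Lp X 2 P) : (κ → ℝ) → X))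
      atTop T := tendstoInMeasure_of_tendsto_Lp hT
  obtain ⟨ns, hns, hae⟩ := hTm.exists_seq_tendsto_ae'
  have hTmeas : AEMeasurable (T : (κ → ℝ) → X) P := (Lp.aestronglyMeasurable T).aemeasurable
  refine ⟨P.map T, Measure.isProbabilityMeasure_map hTmeas, fun x => ?_⟩
  rw [charFun_apply, integral_map hTmeas (by fun_prop)]
  have hS : ∀ t : Finset κ, ((∑ i ∈ t, a i : Lp X 2 P) : (κ → ℝ) → X) =ᵐ[P]
      fun ω => ∑ i ∈ t, ω i • ι (b i) := fun t => by
    refine (Lp.coeFn_fun_finsetSum t a).trans ?_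
    have : ∀ᵐ ω ∂P, ∀ i, (a i : (κ → ℝ) → X) ω = ω i • ι (b i) :=
      ae_all_iff.2 fun i => (hmemX i).coeFn_toLp
    filter_upwards [this] with ω h
    exact Finset.sum_congr rfl fun i _ => h i
  have hlim1 : Tendsto (fun n => ∫ ω, Complex.exp (⟪∑ i ∈ ns n, ω i • ι (b i), x⟫_ℝ * Complex.I) ∂P)
      atTop (𝓝 (∫ ω, Complex.exp (⟪T ω, x⟫_ℝ * Complex.I) ∂P)) := by
    refine tendsto_integral_of_dominated_convergence (fun _ => (1 : ℝ)) ?_ (integrable_const _) ?_ ?_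
    · intro n
      refine Measurable.aestronglyMeasurable ?_
      fun_prop
    · intro n
      exact Eventually.of_forall fun ω => (Complex.norm_exp_ofReal_mul_I _).le
    · filter_upwards [hae, ae_all_iff.2 fun n => hS (ns n)] with ω h1 h2
      have h3 : Tendsto (fun n => ∑ i ∈ ns n, ω i • ι (b i)) atTop (𝓝 (T ω)) := by
        simpa only [h2] using h1
      have hcont : Continuous fun y : X => Complex.exp (⟪y, x⟫_ℝ * Complex.I) := by fun_prop
      exact (hcont.tendsto _).comp h3
  have hval : ∀ t : Finset κ, ∫ ω, Complex.exp (⟪∑ i ∈ t, ω i • ι (b i), x⟫_ℝ * Complex.I) ∂P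
      = Complex.exp (-(v * (∑ i ∈ t, ⟪ContinuousLinearMap.adjoint ι x, b i⟫_ℝ *
        ⟪b i, ContinuousLinearMap.adjoint ι x⟫_ℝ) / 2 : ℝ)) := fun t => by
    have hm : ∀ i, Measurable fun ω : κ → ℝ => ω i • ι (b i) := fun i => by fun_prop
    have hind2 : iIndepFun (fun i (ω : κ → ℝ) => ω i • ι (b i)) P :=
      hind.comp (fun i r => r • ι (b i)) (fun i => by fun_prop)
    have h1 := (hind2.restrict t).charFun_map_fun_finsetSum_eq_prod
      (fun i _ => (hm i).aemeasurable)
    have h2 := congrFun h1 x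
    have hsm : Measurable fun ω : κ → ℝ => ∑ i ∈ t, ω i • ι (b i) :=
      Finset.measurable_fun_sum t fun i _ => hm i
    rw [charFun_apply, integral_map hsm.aemeasurable (by fun_prop)] at h2
    rw [h2, Finset.prod_apply]
    have h3 : ∀ i, charFun (P.map fun ω => ω i • ι (b i)) x =
        Complex.exp (-(v * (⟪ContinuousLinearMap.adjoint ι x, b i⟫_ℝ *
        ⟪b i, ContinuousLinearMap.adjoint ι x⟫_ℝ) / 2 : ℝ)) := fun i => by
      have h4 := charFun_gaussianReal (μ := 0) (v := v) ⟪ι (b i), x⟫_ℝ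
      rw [← hev i, charFun_apply, integral_map (measurable_pi_apply i).aemeasurable
        (by fun_prop)] at h4
      rw [charFun_apply, integral_map (hm i).aemeasurable (by fun_prop)]
      have h5 : ⟪ContinuousLinearMap.adjoint ι x, b i⟫_ℝ = ⟪ι (b i), x⟫_ℝ := by
        rw [ContinuousLinearMap.adjoint_inner_left, real_inner_comm]
      have h6 : ⟪b i, ContinuousLinearMap.adjoint ι x⟫_ℝ = ⟪ι (b i), x⟫_ℝ := by
        rw [ContinuousLinearMap.adjoint_inner_right]
      rw [h5, h6]
      convert h4 using 1
      · refine integral_congr_ae (Eventually.of_forall fun ω => ?_)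
        simp [inner_smul_left, mul_comm]
      · push_cast
        ring_nf
    rw [Finset.prod_congr rfl fun i _ => h3 i, ← Complex.exp_sum]
    congr 1
    push_cast
    rw [Finset.mul_sum, Finset.sum_div, Finset.sum_neg_distrib]
  simp only [hval] at hlim1
  refine tendsto_nhds_unique hlim1 ?_
  have hp := (b.hasSum_inner_mul_inner (ContinuousLinearMap.adjoint ι x)
    (ContinuousLinearMap.adjoint ι x)).comp hns
  rw [real_inner_self_eq_norm_sq] at hp
  have hcont : Continuous fun r : ℝ => Complex.exp (-(v * r / 2 : ℝ)) := by fun_prop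
  exact (hcont.tendsto _).comp hp

/-- The canonical Gaussian measure exists. -/
theorem exists_isCanonicalGaussian {H X : Type*} [NormedAddCommGroup H] [InnerProductSpace ℝ H]
    [CompleteSpace H] [SecondCountableTopology H]
    [NormedAddCommGroup X] [InnerProductSpace ℝ X] [CompleteSpace X]
    [SecondCountableTopology X] [MeasurableSpace X] [BorelSpace X]
    {β : ℝ} (hβ : 0 < β) {ι : H →L[ℝ] X} (hι : IsHilbertSchmidt ι) :
    ∃ γ, IsCanonicalGaussian β ι γ := by
  obtain ⟨s, b, hb⟩ := hι
  have : Countable s := by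
    refine Pairwise.countable_of_isOpen_disjoint (s := fun i : s => Metric.ball (b i) (1 / 2))
      (fun i j hij => Metric.ball_disjoint_ball ?_) (fun i => Metric.isOpen_ball)
      (fun i => ⟨b i, Metric.mem_ball_self (by norm_num)⟩)
    have h1 : ‖b i - b j‖ ^ 2 = 2 := by
      rw [norm_sub_sq_real, b.orthonormal.1 i, b.orthonormal.1 j, b.orthonormal.2 hij]
      norm_num
    rw [dist_eq_norm]
    nlinarith [norm_nonneg (b i - b j)]
  obtain ⟨γ, hγ, h⟩ := gaussian_aux (β⁻¹).toNNReal ι b hb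
  refine ⟨γ, fun x => ?_⟩
  have hm : Measurable fun y : X => ⟪x, y⟫_ℝ := by fun_prop
  have : IsProbabilityMeasure (γ.map fun y => ⟪x, y⟫_ℝ) :=
    Measure.isProbabilityMeasure_map hm.aemeasurable
  refine Measure.ext_of_charFun ?_
  funext t
  have h1 := h (t • x)
  rw [charFun_gaussianReal, charFun_apply, integral_map hm.aemeasurable (by fun_prop)]
  rw [charFun_apply] at h1
  have h2 : ⟪(ι ∘L ContinuousLinearMap.adjoint ι) x, x⟫_ℝ =
      ‖ContinuousLinearMap.adjoint ι x‖ ^ 2 := by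
    rw [← real_inner_self_eq_norm_sq, ContinuousLinearMap.comp_apply,
      ContinuousLinearMap.adjoint_inner_right]
  rw [h2, Real.coe_toNNReal _ (by positivity)]
  rw [Real.coe_toNNReal _ (by positivity), map_smul, norm_smul] at h1
  convert h1 using 1
  · refine integral_congr_ae (Eventually.of_forall fun y => ?_)
    simp [inner_smul_right, real_inner_comm]
  · rw [mul_pow, Real.norm_eq_abs, sq_abs]
    push_cast
    ring_nf

/-- The canonical Gaussian measure is unique. -/
theorem IsCanonicalGaussian.unique {H X : Type*} [NormedAddCommGroup H] [InnerProductSpace ℝ H]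
    [CompleteSpace H] [NormedAddCommGroup X] [InnerProductSpace ℝ X] [CompleteSpace X]
    [SecondCountableTopology X] [MeasurableSpace X] [BorelSpace X]
    {β : ℝ} {ι : H →L[ℝ] X} {μ ν : Measure X}
    (hμ : IsCanonicalGaussian β ι μ) (hν : IsCanonicalGaussian β ι ν) : μ = ν := by
  have key : ∀ γ : Measure X, IsCanonicalGaussian β ι γ → IsProbabilityMeasure γ ∧
      ∀ x, charFun γ x = charFun (gaussianReal 0
        (β⁻¹ * ⟪(ι ∘L ContinuousLinearMap.adjoint ι) x, x⟫_ℝ).toNNReal) 1 := by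
    intro γ hγ
    have hm : ∀ x : X, Measurable fun y : X => ⟪x, y⟫_ℝ := fun x => by fun_prop
    refine ⟨⟨?_⟩, fun x => ?_⟩
    · have h := congrArg (fun m : Measure ℝ => m Set.univ) (hγ 0)
      simpa [Measure.map_apply (hm 0) MeasurableSet.univ] using h
    · rw [← hγ x, charFun_apply, charFun_apply, integral_map (hm x).aemeasurable (by fun_prop)]
      refine integral_congr_ae (Eventually.of_forall fun y => ?_)
      simp [real_inner_comm]
  have := (key μ hμ).1
  have := (key ν hν).1
  refine Measure.ext_of_charFun (funext fun x => ?_)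
  rw [(key μ hμ).2, (key ν hν).2]

/-- `canonicalGaussian` is the canonical Gaussian measure. -/
theorem isCanonicalGaussian_canonicalGaussian {H X : Type*} [NormedAddCommGroup H]
    [InnerProductSpace ℝ H] [CompleteSpace H] [SecondCountableTopology H]
    [NormedAddCommGroup X] [InnerProductSpace ℝ X] [CompleteSpace X]
    [SecondCountableTopology X] [MeasurableSpace X] [BorelSpace X]
    {β : ℝ} (hβ : 0 < β) {ι : H →L[ℝ] X} (hι : IsHilbertSchmidt ι) :
    IsCanonicalGaussian β ι (canonicalGaussian β ι) := by
  have h := exists_isCanonicalGaussian hβ hι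
  rw [canonicalGaussian, dif_pos h]
  exact h.choose_spec

/-- `f : X → Y` is a `γ`-measurable linear extension of `T : H → Y` along the embedding
`ι : H → X`: it extends `T`, is measurable with respect to the `γ`-completion of the Borel sets,
and is linear on a linear subspace of full measure that contains `H`. -/
def IsMeasurableLinearExtension {H X Y : Type*} [AddCommGroup X] [Module ℝ X]
    [MeasurableSpace X] [AddCommGroup Y] [Module ℝ Y] [MeasurableSpace Y]
    (γ : Measure X) (ι : H → X) (T : H → Y) (f : X → Y) : Prop :=
  AEMeasurable f γ ∧ (∀ h, f (ι h) = T h) ∧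
    ∃ L : Submodule ℝ X, (∀ h, ι h ∈ L) ∧ (∀ᵐ x ∂γ, x ∈ L) ∧
      ∃ g : L →ₗ[ℝ] Y, ∀ x : L, f x = g x

/-- The orthogonal projection onto a finite-dimensional subspace has a measurable linear
extension. -/
theorem exists_isMeasurableLinearExtension {H X : Type*} [NormedAddCommGroup H]
    [InnerProductSpace ℝ H] [CompleteSpace H] [MeasurableSpace H] [BorelSpace H]
    [NormedAddCommGroup X] [InnerProductSpace ℝ X] [CompleteSpace X]
    [SecondCountableTopology X] [MeasurableSpace X] [BorelSpace X]
    {β : ℝ} (hβ : 0 < β) {ι : H →L[ℝ] X} (hι : Function.Injective ι) {γ : Measure X}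
    (hγ : IsCanonicalGaussian β ι γ) (W : Submodule ℝ H) [FiniteDimensional ℝ W] :
    ∃ f, IsMeasurableLinearExtension γ ι (fun η => W.orthogonalProjectionOnto η) f := by
  classical
  let A := ContinuousLinearMap.adjoint ι
  let w := stdOrthonormalBasis ℝ W
  have hdense : Dense (A.range : Set H) := by
    refine Submodule.dense_iff_topologicalClosure_eq_top.2 ?_
    rw [Submodule.topologicalClosure_eq_top_iff, ContinuousLinearMap.orthogonal_range]
    simp only [A, ContinuousLinearMap.adjoint_adjoint]
    exact LinearMap.ker_eq_bot.2 hι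
  have hx : ∀ i, ∀ k : ℕ, ∃ x : X, ‖A x - (w i : H)‖ ≤ (1 / 4 : ℝ) ^ k := fun i k => by
    obtain ⟨y, ⟨x, rfl⟩, hy⟩ := hdense.exists_dist_lt (w i : H) (ε := (1 / 4 : ℝ) ^ k) (by positivity)
    exact ⟨x, by rw [← dist_eq_norm, dist_comm]; exact hy.le⟩
  choose x hx using hx
  let L : Submodule ℝ X :=
    { carrier := {y | ∀ i, ∃ l : ℝ, Tendsto (fun k => ⟪x i k, y⟫_ℝ) atTop (𝓝 l)}
      add_mem' := fun {a b} ha hb i => by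
        obtain ⟨l, hl⟩ := ha i
        obtain ⟨m, hm⟩ := hb i
        exact ⟨l + m, by simpa only [inner_add_right] using hl.add hm⟩
      zero_mem' := fun i => ⟨0, by simp⟩
      smul_mem' := fun c a ha i => by
        obtain ⟨l, hl⟩ := ha i
        exact ⟨c * l, by simpa only [inner_smul_right] using hl.const_mul c⟩ }
  choose l hl using fun (y : L) => y.2
  let g : L →ₗ[ℝ] W :=
    { toFun := fun y => ∑ i, l y i • w i
      map_add' := fun a b => by
        rw [← Finset.sum_add_distrib]
        refine Finset.sum_congr rfl fun i _ => ?_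
        rw [← add_smul]
        congr 1
        refine tendsto_nhds_unique (hl (a + b) i) ?_
        simpa only [Submodule.coe_add, inner_add_right] using (hl a i).add (hl b i)
      map_smul' := fun c a => by
        rw [RingHom.id_apply, Finset.smul_sum]
        refine Finset.sum_congr rfl fun i _ => ?_
        rw [← smul_assoc]
        congr 1
        refine tendsto_nhds_unique (hl (c • a) i) ?_
        simpa only [Submodule.coe_smul, inner_smul_right, smul_eq_mul] using (hl a i).const_mul c }
  let f : X → W := fun y => if h : y ∈ L then g ⟨y, h⟩ else 0
  have hfg : ∀ y : L, f y = g y := fun y => by simp [f]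
  have hLim : ∀ h : H, ∀ i, Tendsto (fun k => ⟪x i k, ι h⟫_ℝ) atTop (𝓝 ⟪(w i : H), h⟫_ℝ) := by
    intro h i
    have h1 : Tendsto (fun k => A (x i k)) atTop (𝓝 (w i : H)) := by
      rw [tendsto_iff_norm_sub_tendsto_zero]
      exact squeeze_zero (fun _ => norm_nonneg _) (hx i)
        (tendsto_pow_atTop_nhds_zero_of_lt_one (by norm_num) (by norm_num))
    have h2 : Tendsto (fun k => ⟪A (x i k), h⟫_ℝ) atTop (𝓝 ⟪(w i : H), h⟫_ℝ) :=
      h1.inner tendsto_const_nhds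
    simpa only [A, ContinuousLinearMap.adjoint_inner_left] using h2
  have hιL : ∀ h, ι h ∈ L := fun h i => ⟨_, hLim h i⟩
  have hae : ∀ᵐ y ∂γ, y ∈ L := by
    have key : ∀ i, ∀ᵐ y ∂γ, ∃ l : ℝ, Tendsto (fun k => ⟪x i k, y⟫_ℝ) atTop (𝓝 l) := by
      intro i
      let d : ℕ → X → ℝ := fun k y => ⟪x i (k + 1) - x i k, y⟫_ℝ
      have hd : ∀ k, Measurable (d k) := fun k => by fun_prop
      have hint : ∀ k, ∫⁻ y, ENNReal.ofReal (4 ^ k * d k y ^ 2) ∂γ ≤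
          ENNReal.ofReal (4 * β⁻¹ * (1 / 4) ^ k) := by
        intro k
        have h1 := hγ (x i (k + 1) - x i k)
        have hmeas : Measurable fun r : ℝ => ENNReal.ofReal (4 ^ k * r ^ 2) := by fun_prop
        have h2 : ∫⁻ y, ENNReal.ofReal (4 ^ k * d k y ^ 2) ∂γ =
            ∫⁻ r, ENNReal.ofReal (4 ^ k * r ^ 2) ∂(γ.map (d k)) :=
          (lintegral_map hmeas (hd k)).symm
        rw [h2, show γ.map (d k) = _ from h1]
        set v : NNReal := (β⁻¹ * ⟪(ι ∘L A) (x i (k + 1) - x i k), x i (k + 1) - x i k⟫_ℝ).toNNReal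
          with hv
        have h3 : Integrable (fun r : ℝ => r ^ 2) (gaussianReal 0 v) :=
          (memLp_id_gaussianReal' 2 (by simp)).integrable_sq
        have h4 : ∫ r, r ^ 2 ∂(gaussianReal 0 v) = v := by
          have := variance_fun_id_gaussianReal (μ := 0) (v := v)
          rw [variance_eq_integral (by fun_prop)] at this
          simpa using this
        rw [← ofReal_integral_eq_lintegral_ofReal (h3.const_mul _)
          (Eventually.of_forall fun r => by positivity), integral_const_mul, h4]
        refine ENNReal.ofReal_le_ofReal ?_
        have h5 : ⟪(ι ∘L A) (x i (k + 1) - x i k), x i (k + 1) - x i k⟫_ℝ =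
            ‖A (x i (k + 1) - x i k)‖ ^ 2 := by
          rw [← real_inner_self_eq_norm_sq, ContinuousLinearMap.comp_apply,
            ContinuousLinearMap.adjoint_inner_right]
        have h6 : ‖A (x i (k + 1) - x i k)‖ ≤ 2 * (1 / 4 : ℝ) ^ k := by
          rw [map_sub]
          have e1 := hx i (k + 1)
          have e2 := hx i k
          have e3 : (1 / 4 : ℝ) ^ (k + 1) ≤ (1 / 4 : ℝ) ^ k :=
            pow_le_pow_of_le_one (by norm_num) (by norm_num) (Nat.le_succ k)
          calc ‖A (x i (k + 1)) - A (x i k)‖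
              = ‖(A (x i (k + 1)) - (w i : H)) - (A (x i k) - (w i : H))‖ := by congr 1; abel
            _ ≤ _ := norm_sub_le _ _
            _ ≤ _ := by linarith
        rw [hv, h5, Real.coe_toNNReal _ (by positivity)]
        have h7 : ‖A (x i (k + 1) - x i k)‖ ^ 2 ≤ (2 * (1 / 4 : ℝ) ^ k) ^ 2 :=
          pow_le_pow_left₀ (norm_nonneg _) h6 2
        have h8 : (4 : ℝ) ^ k * (1 / 4) ^ k = 1 := by rw [← mul_pow]; norm_num
        calc (4 : ℝ) ^ k * (β⁻¹ * ‖A (x i (k + 1) - x i k)‖ ^ 2)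
            ≤ 4 ^ k * (β⁻¹ * (2 * (1 / 4 : ℝ) ^ k) ^ 2) := by gcongr
          _ = 4 * β⁻¹ * (1 / 4) ^ k * (4 ^ k * (1 / 4) ^ k) := by ring
          _ = _ := by rw [h8, mul_one]
      have hsum : ∫⁻ y, ∑' k, ENNReal.ofReal (4 ^ k * d k y ^ 2) ∂γ ≠ ⊤ := by
        rw [lintegral_tsum fun k => by fun_prop]
        refine ne_top_of_le_ne_top ?_ (ENNReal.tsum_le_tsum hint)
        have hs : Summable fun k : ℕ => 4 * β⁻¹ * (1 / 4 : ℝ) ^ k :=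
          (summable_geometric_of_lt_one (by norm_num) (by norm_num)).mul_left _
        exact hs.tsum_ofReal_ne_top
      have hmeas : Measurable fun y => ∑' k, ENNReal.ofReal (4 ^ k * d k y ^ 2) :=
        Measurable.tsum fun k => by fun_prop
      filter_upwards [ae_lt_top hmeas hsum] with y hy
      obtain ⟨c, hc⟩ : ∃ c : ℝ, ∀ k, 4 ^ k * d k y ^ 2 ≤ c ^ 2 := by
        refine ⟨Real.sqrt (∑' k, ENNReal.ofReal (4 ^ k * d k y ^ 2)).toReal, fun k => ?_⟩
        rw [Real.sq_sqrt ENNReal.toReal_nonneg]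
        exact (ENNReal.ofReal_le_iff_le_toReal hy.ne).1 (ENNReal.le_tsum k)
      refine cauchySeq_tendsto_of_complete
        (cauchySeq_of_le_geometric (1 / 2) |c| (by norm_num) fun k => ?_)
      have h1 : |2 ^ k * d k y| ≤ |c| := by
        refine sq_le_sq.1 ?_
        calc (2 ^ k * d k y) ^ 2 = (2 ^ 2) ^ k * d k y ^ 2 := by
              rw [mul_pow, ← pow_mul, ← pow_mul, mul_comm k 2]
          _ ≤ _ := by norm_num; exact hc k
      rw [dist_comm, Real.dist_eq, ← inner_sub_left]
      rw [abs_mul, abs_of_pos (by positivity : (0 : ℝ) < 2 ^ k)] at h1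
      calc |d k y| = (2 ^ k * |d k y|) * (1 / 2) ^ k := by
            rw [mul_comm (2 ^ k : ℝ), mul_assoc, ← mul_pow]; norm_num
        _ ≤ _ := by gcongr
    exact ae_all_iff.2 key
  refine ⟨f, ?_, ?_, L, hιL, hae, g, hfg⟩
  · refine aemeasurable_of_tendsto_metrizable_ae atTop
      (f := fun k y => ∑ i, ⟪x i k, y⟫_ℝ • w i)
      (fun k => (Finset.measurable_fun_sum _ fun i _ => by fun_prop).aemeasurable) ?_
    filter_upwards [hae] with y hy
    rw [hfg ⟨y, hy⟩]
    exact tendsto_finsetSum _ fun i _ => (hl ⟨y, hy⟩ i).smul_const _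
  · intro h
    rw [hfg ⟨ι h, hιL h⟩]
    show ∑ i, l ⟨ι h, hιL h⟩ i • w i = W.orthogonalProjectionOnto h
    rw [← w.sum_repr (W.orthogonalProjectionOnto h)]
    refine Finset.sum_congr rfl fun i _ => ?_
    congr 1
    rw [w.repr_apply_apply]
    refine tendsto_nhds_unique (hl ⟨ι h, hιL h⟩ i) ?_
    have : ⟪w i, W.orthogonalProjectionOnto h⟫_ℝ = ⟪(w i : H), h⟫_ℝ :=
      Submodule.inner_orthogonalProjectionOnto_eq_of_mem_left (w i) h
    rw [this]
    exact hLim h i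

section System

variable {Z H X : Type*} [NormedAddCommGroup Z] [InnerProductSpace ℝ Z]
  [NormedAddCommGroup H] [InnerProductSpace ℝ H]
  [NormedAddCommGroup X] [InnerProductSpace ℝ X]

/-- The total Hamiltonian `H_A(z) + ½‖η‖² + (C z | η)`. -/
def Htotal (HA : Z → ℝ) (C : Z →L[ℝ] H) (z : Z) (η : H) : ℝ :=
  HA z + ‖η‖ ^ 2 / 2 + ⟪C z, η⟫_ℝ

/-- The visible part `H_zw(z,w) = H_A(z) + (C z | w) + ½‖w‖²` of the Hamiltonian. -/
def Hzw (HA : Z → ℝ) (C : Z →L[ℝ] H) (W : Submodule ℝ H) (q : Z × W) : ℝ :=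
  HA q.1 + ⟪C q.1, (q.2 : H)⟫_ℝ + ‖q.2‖ ^ 2 / 2

/-- The closure in `X` of the union of the `Ξ n`. -/
def XiX (ι : H →L[ℝ] X) (Ξ : ℕ → Submodule ℝ H) : Set X :=
  closure (⋃ n, ι '' (Ξ n : Set H))

theorem sub_orthogonalProjection_mem {W V : Submodule ℝ H} [W.HasOrthogonalProjection]
    (hV : V ≤ Wᗮ) (η : ↥(W ⊔ V)) :
    (η : H) - (W.orthogonalProjectionOnto (η : H) : H) ∈ V := by
  obtain ⟨w, hw, v, hv, h⟩ := Submodule.mem_sup.1 η.2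
  have : (W.orthogonalProjectionOnto (η : H) : H) = w := by
    rw [← h, map_add, Submodule.orthogonalProjectionOnto_apply_of_mem_orthogonal (hV hv),
      add_zero]
    exact congrArg Subtype.val (W.orthogonalProjectionOnto_mem_subspace_eq_self ⟨w, hw⟩)
  rw [this, ← h]
  simpa using hv

/-- The decomposition map `(z, η) ↦ (z, Pη, Qη, ½‖Qη‖² - n/(2β))` on `Z × (W + Ξ n)`. -/
def decomposition (β : ℝ) (ι : H →L[ℝ] X) (W : Submodule ℝ H) [W.HasOrthogonalProjection]
    (Ξ : ℕ → Submodule ℝ H) (hΞ : ∀ n, Ξ n ≤ Wᗮ) (n : ℕ) (p : Z × ↥(W ⊔ Ξ n)) :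
    Z × W × XiX ι Ξ × ℝ :=
  (p.1, W.orthogonalProjectionOnto (p.2 : H),
    ⟨ι ((p.2 : H) - (W.orthogonalProjectionOnto (p.2 : H) : H)),
      subset_closure (Set.mem_iUnion.2
        ⟨n, Set.mem_image_of_mem ι (sub_orthogonalProjection_mem (hΞ n) p.2)⟩)⟩,
    ‖(p.2 : H) - (W.orthogonalProjectionOnto (p.2 : H) : H)‖ ^ 2 / 2 - n / (2 * β))

section Measures

variable [FiniteDimensional ℝ Z] [MeasurableSpace Z] [BorelSpace Z]
  [MeasurableSpace H] [BorelSpace H] [MeasurableSpace X] [BorelSpace X]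
  (HA : Z → ℝ) (C : Z →L[ℝ] H) (β E₀ : ℝ) (ι : H →L[ℝ] X)
  (W : Submodule ℝ H) [FiniteDimensional ℝ W]
  (Ξ : ℕ → Submodule ℝ H) [∀ n, FiniteDimensional ℝ (Ξ n)]

/-- The unnormalised microcanonical measure `δ[H_total - n/(2β) - E₀]` on `Z × (W + Ξ n)`. -/
def energyShell (n : ℕ) : Measure (Z × ↥(W ⊔ Ξ n)) :=
  pdelta fun p => Htotal HA C p.1 (p.2 : H) - n / (2 * β) - E₀

/-- The microcanonical probability measure `μ_{β,n}` on `Z × (W + Ξ n)`. -/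
def microcanonical (n : ℕ) : Measure (Z × ↥(W ⊔ Ξ n)) :=
  normalized (energyShell HA C β E₀ W Ξ n)

/-- The image `μ_{β,n,e}` of `μ_{β,n}` under the decomposition map. -/
def microcanonicalE (hΞ : ∀ n, Ξ n ≤ Wᗮ) (n : ℕ) : Measure (Z × W × XiX ι Ξ × ℝ) :=
  (microcanonical HA C β E₀ W Ξ n).map (decomposition β ι W Ξ hΞ n)

/-- The measure `exp(β e) δ[H_zw(z,w) - E₀ + e](dz dw) de` on `(Z × W) × ℝ`. -/
def limitZWE : Measure ((Z × W) × ℝ) :=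
  ((pdeltaJoint (Hzw HA C W)).map (fun p => (p.1, E₀ - p.2))).withDensity
    fun p => ENNReal.ofReal (Real.exp (β * p.2))

/-- The measure `μ_{β,e}`: the normalised product
`(1/Z) exp(β e) δ[H_zw(z,w) - E₀ + e](dz dw) de ν(dξ)`, for a measure `ν` on `X` that is
concentrated on the closed subset `XiX ι Ξ`. The constant `Z` is the total mass of the factor
in `(z, w, e)`. -/
def limitMeasure (ν : Measure X) : Measure (Z × W × XiX ι Ξ × ℝ) :=
  (limitZWE HA C β E₀ W Set.univ)⁻¹ •
    ((limitZWE HA C β E₀ W).prod (ν.comap (Subtype.val : XiX ι Ξ → X))).map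
      fun p => (p.1.1.1, p.1.1.2, p.2, p.1.2)

end Measures

end System

end

/-! Since `C` has range in `W` and `Ξ n ⊥ W`, on `Z × (W + Ξ n)` the total Hamiltonian splits as
`H_zw(z, w) + ½‖ξ‖²`. In polar coordinates on `Ξ n` with radial variable `t = ½‖ξ‖²`, Lebesgue
measure becomes, up to a constant, `dz dw · dθ · t₊^(n/2 - 1) dt`, and with `κ = n/(2β) + E₀` one
has `H_total - κ = t - (κ - H_zw)`. Hence `δ[H_total - κ]` exists: it puts `t = κ - H_zw` and leaves
the weight `(κ - H_zw)₊^(n/2 - 1)` (`isPDelta_of_coarea`, `volume_eq_map_polarPoint`,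
`isPDelta_Htotal`). Up to a factor that normalisation removes, this weight is `(1 - 2β(H_zw -
E₀)/n)₊^(n/2 - 1)`, which tends to `exp(-β(H_zw - E₀))` and is at most `e` times this limit
(`tendsto_shellDensity`, `shellDensity_le`). Completing the square in `w` shows that the bound is
integrable. The last coordinate is `t - n/(2β) = E₀ - H_zw`, which is the constraint in the limit
measure.

For the bath, the uniform direction is realised as `u_n / ‖u_n‖`, where `u_n = ∑_{i<n} ω_i e_i` is a
partial sum of white noise of variance `1/β` along an orthonormal sequence adapted to the `Ξ n`. All
`n` thus live on one probability space, and narrow convergence reduces to pointwise convergence and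
domination. The bath coordinate is `(√(2t) / ‖u_n‖) • ι u_n`. By the strong law of large numbers the
scalar tends to `1`; since `ι` is Hilbert-Schmidt, `ι u_n` converges in measure to some `G`, so
almost surely along subsequences, which is enough (`tendsto_integral_normalized_map`).

It remains to see that `G` has law `Qhat_# γ`. Its characteristic function is `exp(-‖Q ι*
x‖²/(2β))`, and `γ` is the law of `y + ι w` with `y` distributed as `G` and `w` an independent
Gaussian in `W`. The extension `Phat` vanishes almost surely on `y`: it is invariant under shifts
along the Cameron-Martin directions of `y`, hence independent of `y` and of itself, and it is odd
(`ae_eq_zero_of_linear_of_charFun`). So `x - ι (Phat x) = y` (`map_sub_linearExtension_eq`).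

The disintegration in `e` comes from conditional measures of Lebesgue measure given `H_zw`, whose
law is absolutely continuous when `W ≠ 0`, combined with Lebesgue differentiation for countably many
test functions (`exists_kernel_isPDelta`). -/

noncomputable section

/-! ### Microcanonical measures from a parametrisation by level -/

/-- A coarea criterion: if Lebesgue measure is parametrised by `Θ (y, t)` with density `a t`, and
`g (Θ (y, t)) = t - s y`, then `δ[g]` is obtained by setting `t = s y`. -/
theorem isPDelta_of_coarea {E Y : Type*} [TopologicalSpace E] [MeasureSpace E] [BorelSpace E]
    [MeasurableSpace Y] {m : Measure Y} [SFinite m] {Θ : Y × ℝ → E} (hΘ : Measurable Θ)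
    {a : ℝ → ℝ} (ha : Continuous a) (ha0 : ∀ t, 0 ≤ a t) {s : Y → ℝ} (hs : Measurable s)
    {c : ENNReal}
    (hvol : (volume : Measure E) =
      c • ((m.prod volume).withDensity fun p => ENNReal.ofReal (a p.2)).map Θ)
    {g : E → ℝ} (hg : Measurable g)
    (hgΘ : ∀ᵐ y ∂m, ∀ t, a t ≠ 0 → g (Θ (y, t)) = t - s y)
    (hΘc : ∀ y, Continuous fun t => Θ (y, t))
    (hb : ∀ φ : E → ℝ, Continuous φ → HasCompactSupport φ →
      ∃ b : Y → ℝ, Integrable b m ∧ ∀ᵐ y ∂m, ∀ t, ‖a t * φ (Θ (y, t))‖ ≤ b y)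
    (hfin : IsFiniteMeasureOnCompacts
      (c • (m.withDensity fun y => ENNReal.ofReal (a (s y))).map fun y => Θ (y, s y))) :
    IsPDelta g (c • (m.withDensity fun y => ENNReal.ofReal (a (s y))).map fun y => Θ (y, s y)) := by
  refine ⟨hfin, fun φ hφ hφc => ?_⟩
  obtain ⟨b, hbi, hbb⟩ := hb φ hφ hφc
  have hφm : Measurable φ := hφ.measurable
  have hΘs : Measurable fun y => Θ (y, s y) := hΘ.comp (measurable_id.prodMk hs)
  have hlim : ∫ x, φ x ∂(c • (m.withDensity fun y => ENNReal.ofReal (a (s y))).map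
      fun y => Θ (y, s y)) = c.toReal * ∫ y, a (s y) * φ (Θ (y, s y)) ∂m := by
    rw [integral_smul_measure, integral_map hΘs.aemeasurable hφm.aestronglyMeasurable,
      integral_withDensity_eq_integral_toReal_smul (by fun_prop) (by simp), smul_eq_mul]
    simp only [ENNReal.toReal_ofReal (ha0 _), smul_eq_mul]
  have hset : ∀ h : ℝ, MeasurableSet {x | 0 ≤ g x ∧ g x < h} := fun h =>
    (measurableSet_le measurable_const hg).inter (measurableSet_lt hg measurable_const)
  have hk : Measurable fun p : Y × ℝ => a p.2 * φ (Θ p) :=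
    (ha.measurable.comp measurable_snd).mul (hφm.comp hΘ)
  have hA : ∀ h : ℝ, MeasurableSet {p : Y × ℝ | p.2 ∈ Set.Ico (s p.1) (s p.1 + h)} := fun h =>
    (measurableSet_le (hs.comp measurable_fst) measurable_snd).inter
      (measurableSet_lt measurable_snd ((hs.comp measurable_fst).add_const h))
  -- The identity for `g ∘ Θ` is required only where `a ≠ 0`, because the parametrising measure
  -- gives no mass to the rest.
  have hae : ∀ᵐ p ∂(m.prod (volume : Measure ℝ)), a p.2 ≠ 0 → g (Θ p) = p.2 - s p.1 := by
    have hms : MeasurableSet {p : Y × ℝ | a p.2 ≠ 0 → g (Θ p) = p.2 - s p.1} := by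
      have h1 : MeasurableSet {p : Y × ℝ | a p.2 = 0} :=
        (ha.measurable.comp measurable_snd) (measurableSet_singleton 0)
      have h2 : MeasurableSet {p : Y × ℝ | g (Θ p) = p.2 - s p.1} :=
        measurableSet_eq_fun (hg.comp hΘ) (measurable_snd.sub (hs.comp measurable_fst))
      convert h1.union h2 using 1
      ext p
      simp only [Set.mem_ofPred_eq, Set.mem_union]
      tauto
    rw [Measure.ae_prod_iff_ae_ae hms]
    filter_upwards [hgΘ] with y hy
    exact Eventually.of_forall hy
  -- In the parameters the shell `0 ≤ g < h` is the strip `s y ≤ t < s y + h`, so by Fubini its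
  -- average becomes an average over intervals of length `h`.
  have key : ∀ h : ℝ, 0 < h → h⁻¹ * ∫ x in {x | 0 ≤ g x ∧ g x < h}, φ x =
      c.toReal * ∫ y, (h⁻¹ * ∫ t in Set.Ico (s y) (s y + h), a t * φ (Θ (y, t))) ∂m := by
    intro h hh
    have h1 : ∫ x in {x | 0 ≤ g x ∧ g x < h}, φ x = c.toReal *
        ∫ p, Set.indicator {p : Y × ℝ | p.2 ∈ Set.Ico (s p.1) (s p.1 + h)}
          (fun p => a p.2 * φ (Θ p)) p ∂(m.prod volume) := by
      rw [← integral_indicator (hset h), hvol, integral_smul_measure,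
        integral_map hΘ.aemeasurable (hφm.indicator (hset h)).aestronglyMeasurable,
        integral_withDensity_eq_integral_toReal_smul (by fun_prop) (by simp), smul_eq_mul]
      congr 1
      refine integral_congr_ae ?_
      filter_upwards [hae] with p hp
      simp only [ENNReal.toReal_ofReal (ha0 _), smul_eq_mul, Set.indicator_apply, Set.mem_ofPred_eq,
        Set.mem_Ico]
      by_cases h0 : a p.2 = 0
      · simp [h0]
      · have e : (0 ≤ g (Θ p) ∧ g (Θ p) < h) ↔ (s p.1 ≤ p.2 ∧ p.2 < s p.1 + h) := by
          rw [hp h0]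
          constructor <;> rintro ⟨h1, h2⟩ <;> constructor <;> linarith
        simp only [e, mul_ite, mul_zero]
    have hsec : ∀ y, (fun t => Set.indicator {p : Y × ℝ | p.2 ∈ Set.Ico (s p.1) (s p.1 + h)}
        (fun p => a p.2 * φ (Θ p)) (y, t)) =
        Set.indicator (Set.Ico (s y) (s y + h)) fun t => a t * φ (Θ (y, t)) := fun y => rfl
    have hcont : ∀ y, Continuous fun t => a t * φ (Θ (y, t)) := fun y =>
      ha.mul (hφ.comp (hΘc y))
    have hint : Integrable (Set.indicator {p : Y × ℝ | p.2 ∈ Set.Ico (s p.1) (s p.1 + h)}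
          (fun p => a p.2 * φ (Θ p))) (m.prod volume) := by
      have hm := hk.indicator (hA h)
      rw [integrable_prod_iff hm.aestronglyMeasurable]
      constructor
      · refine Eventually.of_forall fun y => ?_
        rw [hsec, integrable_indicator_iff measurableSet_Ico]
        exact ((hcont y).integrableOn_Icc).mono_set Set.Ico_subset_Icc_self
      · refine (hbi.const_mul h).mono'
          hm.norm.stronglyMeasurable.integral_prod_right.aestronglyMeasurable ?_
        filter_upwards [hbb] with y hy
        have : ∀ t, ‖Set.indicator {p : Y × ℝ | p.2 ∈ Set.Ico (s p.1) (s p.1 + h)}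
          (fun p => a p.2 * φ (Θ p)) (y, t)‖ =
          Set.indicator (Set.Ico (s y) (s y + h)) (fun t => ‖a t * φ (Θ (y, t))‖) t := fun t => by
            rw [← norm_indicator_eq_indicator_norm]; rfl
        simp only [this]
        rw [integral_indicator measurableSet_Ico, mul_comm]
        have h2 := norm_setIntegral_le_of_norm_le_const (μ := volume)
          (s := Set.Ico (s y) (s y + h)) (f := fun t => ‖a t * φ (Θ (y, t))‖) (C := b y)
          (by simp) (fun t _ => by simpa using hy t)
        simpa [hh.le] using h2
    rw [h1, integral_prod _ hint, integral_const_mul]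
    have : ∀ y, ∫ t, Set.indicator {p : Y × ℝ | p.2 ∈ Set.Ico (s p.1) (s p.1 + h)}
          (fun p => a p.2 * φ (Θ p)) (y, t) =
        ∫ t in Set.Ico (s y) (s y + h), a t * φ (Θ (y, t)) := fun y => by
      rw [← integral_indicator measurableSet_Ico]; rfl
    simp only [this]
    ring
  rw [hlim]
  refine Tendsto.congr' (f₁ := fun h => c.toReal *
      ∫ y, (h⁻¹ * ∫ t in Set.Ico (s y) (s y + h), a t * φ (Θ (y, t))) ∂m) ?_ ?_
  · filter_upwards [self_mem_nhdsWithin] with h hh using (key h hh).symm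
  refine Tendsto.const_mul _ ?_
  refine tendsto_integral_filter_of_dominated_convergence b ?_ ?_ hbi ?_
  · refine Eventually.of_forall fun h => ?_
    have : (fun y => h⁻¹ * ∫ t in Set.Ico (s y) (s y + h), a t * φ (Θ (y, t))) = fun y =>
        h⁻¹ * ∫ t, Set.indicator {p : Y × ℝ | p.2 ∈ Set.Ico (s p.1) (s p.1 + h)}
          (fun p => a p.2 * φ (Θ p)) (y, t) := by
      funext y
      rw [← integral_indicator measurableSet_Ico]; rfl
    rw [this]
    exact ((hk.indicator (hA h)).stronglyMeasurable.integral_prod_right'.const_mul _).aestronglyMeasurable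
  · filter_upwards [self_mem_nhdsWithin] with h hh
    have hh : 0 < h := hh
    filter_upwards [hbb] with y hy
    have h2 := norm_setIntegral_le_of_norm_le_const (μ := volume)
          (s := Set.Ico (s y) (s y + h)) (f := fun t => a t * φ (Θ (y, t))) (C := b y)
          (by simp) (fun t _ => hy t)
    rw [norm_mul, norm_inv, Real.norm_of_nonneg hh.le, inv_mul_le_iff₀ hh, mul_comm]
    simpa [hh.le] using h2
  · refine Eventually.of_forall fun y => ?_
    have hcont : Continuous fun t => a t * φ (Θ (y, t)) := ha.mul (hφ.comp (hΘc y))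
    -- The interval average is the right difference quotient at `s y` of a primitive of a continuous
    -- function.
    have hd := (hcont.integral_hasStrictDerivAt (s y) (s y)).hasDerivAt.tendsto_slope_zero_right
    refine hd.congr' ?_
    filter_upwards [self_mem_nhdsWithin] with h hh
    have hh : 0 < h := hh
    rw [intervalIntegral.integral_same, sub_zero, intervalIntegral.integral_of_le (by linarith),
      integral_Ico_eq_integral_Ioc, smul_eq_mul]

/-! ### Polar coordinates -/

section Polar

variable {U : Type*} [NormedAddCommGroup U] [InnerProductSpace ℝ U] [FiniteDimensional ℝ U]
  [MeasurableSpace U] [BorelSpace U] [Nontrivial U]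

/-- Integration in polar coordinates. -/
theorem lintegral_polar {f : U → ENNReal} (hf : Measurable f) :
    ∫⁻ u, f u = ∫⁻ θ : Metric.sphere (0 : U) 1, (∫⁻ r in Set.Ioi (0 : ℝ),
      ENNReal.ofReal (r ^ (Module.finrank ℝ U - 1)) * f (r • (θ : U)))
        ∂(volume : Measure U).toSphere := by
  have h0 : ∫⁻ u, f u = ∫⁻ u : ({(0)}ᶜ : Set U), f u ∂((volume : Measure U).comap (↑)) := by
    rw [lintegral_subtype_comap (measurableSet_singleton _).compl f,
      restrict_compl_singleton]
  have h1 := (Measure.measurePreserving_homeomorphUnitSphereProd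
    (volume : Measure U)).symm (e := (homeomorphUnitSphereProd U).toMeasurableEquiv)
  have hg : Measurable fun p : Metric.sphere (0 : U) 1 × Set.Ioi (0 : ℝ) =>
      f ((p.2 : ℝ) • (p.1 : U)) := by
    refine hf.comp (Measurable.smul ?_ ?_)
    · exact measurable_subtype_coe.comp measurable_snd
    · exact measurable_subtype_coe.comp measurable_fst
  rw [h0, ← h1.map_eq, lintegral_map (by fun_prop) (MeasurableEquiv.measurable _)]
  have h2 : ∀ p : Metric.sphere (0 : U) 1 × Set.Ioi (0 : ℝ),
      (((homeomorphUnitSphereProd U).toMeasurableEquiv.symm p : ({(0)}ᶜ : Set U)) : U) =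
        (p.2 : ℝ) • (p.1 : U) := fun p => homeomorphUnitSphereProd_symm_apply_coe U p
  simp only [h2]
  rw [lintegral_prod _ hg.aemeasurable]
  refine lintegral_congr fun θ => ?_
  rw [Measure.volumeIoiPow, lintegral_withDensity_eq_lintegral_mul _ (by fun_prop)
    (by fun_prop : Measurable fun r : Set.Ioi (0 : ℝ) => f ((r : ℝ) • (θ : U)))]
  simp only [Pi.mul_apply]
  rw [← lintegral_subtype_comap measurableSet_Ioi fun r =>
    ENNReal.ofReal (r ^ (Module.finrank ℝ U - 1)) * f (r • (θ : U))]

/-- The change of variables `t = r ^ 2 / 2`. -/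
theorem lintegral_Ioi_sq_div_two {n : ℕ} (hn : 0 < n) (G : ℝ → ENNReal) :
    ∫⁻ t in Set.Ioi (0 : ℝ), ENNReal.ofReal (t ^ ((n : ℝ) / 2 - 1)) * G (√(2 * t)) =
      ENNReal.ofReal (2⁻¹ ^ ((n : ℝ) / 2 - 1)) *
        ∫⁻ r in Set.Ioi (0 : ℝ), ENNReal.ofReal (r ^ (n - 1)) * G r := by
  have himg : (fun r : ℝ => r ^ 2 / 2) '' Set.Ioi 0 = Set.Ioi 0 := by
    ext t
    simp only [Set.mem_image, Set.mem_Ioi]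
    constructor
    · rintro ⟨r, hr, rfl⟩
      positivity
    · intro ht
      refine ⟨√(2 * t), by positivity, ?_⟩
      rw [Real.sq_sqrt (by positivity)]
      ring
  have h := lintegral_image_eq_lintegral_abs_deriv_mul (s := Set.Ioi (0 : ℝ))
    (f := fun r => r ^ 2 / 2) (f' := fun r => r) measurableSet_Ioi (fun r _ => by
      have := ((hasDerivAt_pow 2 r).div_const 2).hasDerivWithinAt (s := Set.Ioi 0)
      simpa using this) (fun a ha b hb hab => by
      have ha : 0 < a := ha
      have hb : 0 < b := hb
      have : a ^ 2 = b ^ 2 := by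
        have hab : a ^ 2 / 2 = b ^ 2 / 2 := hab
        linarith
      exact (pow_left_inj₀ ha.le hb.le two_ne_zero).1 this)
    (fun t => ENNReal.ofReal (t ^ ((n : ℝ) / 2 - 1)) * G (√(2 * t)))
  rw [himg] at h
  rw [h, ← lintegral_const_mul' _ _ ENNReal.ofReal_ne_top]
  refine setLIntegral_congr_fun measurableSet_Ioi fun r hr => ?_
  have hr : 0 < r := hr
  have e1 : √(2 * (r ^ 2 / 2)) = r := by
    rw [mul_div_cancel₀ _ two_ne_zero, Real.sqrt_sq hr.le]
  rw [e1, ← mul_assoc, ← mul_assoc, ← ENNReal.ofReal_mul (abs_nonneg _),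
    ← ENNReal.ofReal_mul (by positivity), abs_of_pos hr]
  congr 2
  rw [div_eq_mul_inv, Real.mul_rpow (by positivity) (by positivity), ← Real.rpow_natCast r 2,
    ← Real.rpow_mul hr.le, ← Real.rpow_natCast r (n - 1), Nat.cast_sub hn]
  -- The Jacobian `r` of `r² / 2` supplies the missing power: `r · (r²)^(n/2 - 1) = r^(n - 1)`.
  have : r ^ ((n : ℝ) - (1 : ℕ)) = r * r ^ (((2 : ℕ) : ℝ) * ((n : ℝ) / 2 - 1)) := by
    nth_rewrite 2 [← Real.rpow_one r]
    rw [← Real.rpow_add hr]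
    congr 1
    push_cast
    ring
  rw [this]
  ring

/-- The squared norm is nonsingular with respect to Lebesgue measure. -/
theorem volume_norm_sq_div_two_mem {N : Set ℝ} (hNm : MeasurableSet N) (hN : volume N = 0) :
    volume {u : U | ‖u‖ ^ 2 / 2 ∈ N} = 0 := by
  have hm : MeasurableSet {u : U | ‖u‖ ^ 2 / 2 ∈ N} :=
    (by fun_prop : Measurable fun u : U => ‖u‖ ^ 2 / 2) hNm
  rw [← lintegral_indicator_one hm, lintegral_polar (measurable_one.indicator hm)]
  refine (lintegral_congr fun θ => ?_).trans lintegral_zero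
  have hn : 0 < Module.finrank ℝ U := Module.finrank_pos
  -- On each ray the condition reads `t ∈ N` in the variable `t = r² / 2`, and `N` is null.
  have h := lintegral_Ioi_sq_div_two hn (fun r => N.indicator 1 (r ^ 2 / 2))
  have h1 : ∀ r : ℝ, Set.indicator {u : U | ‖u‖ ^ 2 / 2 ∈ N} (1 : U → ENNReal) (r • (θ : U)) =
      N.indicator 1 (r ^ 2 / 2) := fun r => by
    classical
    simp [Set.indicator_apply, norm_smul]
  simp_rw [h1]
  have h2 : ∫⁻ t in Set.Ioi (0 : ℝ), ENNReal.ofReal (t ^ ((Module.finrank ℝ U : ℝ) / 2 - 1)) *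
      N.indicator 1 (√(2 * t) ^ 2 / 2) = 0 := by
    have : ∀ᵐ t : ℝ, t ∉ N := measure_eq_zero_iff_ae_notMem.1 hN
    rw [setLIntegral_congr_fun_ae measurableSet_Ioi (g := fun _ => 0)]
    · simp
    filter_upwards [this] with t ht ht0
    have ht0 : 0 < t := ht0
    have : √(2 * t) ^ 2 / 2 = t := by
      rw [Real.sq_sqrt (by positivity)]
      ring
    rw [this, Set.indicator_of_notMem ht, mul_zero]
  rw [h2] at h
  exact (mul_eq_zero.1 h.symm).resolve_left (by simp; positivity)

/-- Polar coordinates `u = √(2t) θ` with the direction `θ` sampled from a radial law `ν`. -/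
theorem volume_eq_map_radial {ρ : ℝ → ENNReal} (hρ : Measurable ρ) {ν : Measure U}
    (hν : ν = (volume : Measure U).withDensity fun u => ρ ‖u‖) [IsProbabilityMeasure ν]
    (hn : 2 < Module.finrank ℝ U) :
    ∃ c : ENNReal, c ≠ 0 ∧ c ≠ ⊤ ∧ (volume : Measure U) =
      c • ((ν.prod (volume : Measure ℝ)).withDensity fun p =>
        ENNReal.ofReal (max p.2 0 ^ ((Module.finrank ℝ U : ℝ) / 2 - 1))).map
          fun p => √(2 * p.2) • (‖p.1‖⁻¹ • p.1) := by
  set n := Module.finrank ℝ U with hndef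
  set σ := (volume : Measure U).toSphere with hσ
  set A : ENNReal := ∫⁻ r in Set.Ioi (0 : ℝ), ENNReal.ofReal (r ^ (n - 1)) * ρ r with hA
  -- A nonzero exponent makes `0 ^ (n/2 - 1) = 0`, so that the weight annihilates the half-line `t ≤
  -- 0`.
  have hexp : (n : ℝ) / 2 - 1 ≠ 0 := by
    have : (2 : ℝ) < n := by exact_mod_cast hn
    intro h
    linarith
  -- For a radial law, direction and radius separate: the direction is distributed as `A` times the
  -- surface measure.
  have hdir : ∀ ψ : U → ENNReal, Measurable ψ →
      ∫⁻ u, ψ (‖u‖⁻¹ • u) ∂ν = A * ∫⁻ θ, ψ (θ : U) ∂σ := by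
    intro ψ hψ
    have hψ1 : Measurable fun u : U => ψ (‖u‖⁻¹ • u) := by fun_prop
    have hρ1 : Measurable fun u : U => ρ ‖u‖ := by fun_prop
    rw [hν, lintegral_withDensity_eq_lintegral_mul _ hρ1 hψ1, lintegral_polar (hρ1.mul hψ1),
      ← lintegral_const_mul _ (by fun_prop)]
    refine lintegral_congr fun θ => ?_
    rw [hA, ← lintegral_mul_const _ (by fun_prop)]
    refine setLIntegral_congr_fun measurableSet_Ioi fun r hr => ?_
    have hr : 0 < r := hr
    have e1 : ‖r • (θ : U)‖ = r := by simp [norm_smul, abs_of_pos hr]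
    simp only [Pi.mul_apply, e1]
    rw [smul_smul, inv_mul_cancel₀ hr.ne', one_smul, mul_assoc]
  -- Total mass one of `ν` forces `A` to be neither `0` nor `∞`, which makes the constant `(A κ)⁻¹`
  -- below legitimate.
  have hone : A * σ Set.univ = 1 := by
    have := hdir (fun _ => 1) measurable_const
    simpa using this.symm
  have hA0 : A ≠ 0 := fun h => by simp [h] at hone
  have hAt : A ≠ ⊤ := fun h => by
    have hs : σ Set.univ ≠ 0 := by
      rw [Measure.measure_univ_ne_zero]
      exact Measure.toSphere_ne_zero _
    rw [h, ENNReal.top_mul hs] at hone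
    exact ENNReal.top_ne_one hone
  set κ : ENNReal := ENNReal.ofReal (2⁻¹ ^ ((n : ℝ) / 2 - 1)) with hκ
  have hκ0 : κ ≠ 0 := by
    rw [hκ, ne_eq, ENNReal.ofReal_eq_zero, not_le]
    positivity
  have hκt : κ ≠ ⊤ := ENNReal.ofReal_ne_top
  refine ⟨(A * κ)⁻¹, ENNReal.inv_ne_zero.2 (ENNReal.mul_ne_top hAt hκt),
    ENNReal.inv_ne_top.2 (mul_ne_zero hA0 hκ0), ?_⟩
  refine Measure.ext_of_lintegral _ fun f hf => ?_
  have hw : Measurable fun p : U × ℝ => ENNReal.ofReal (max p.2 0 ^ ((n : ℝ) / 2 - 1)) := by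
    fun_prop
  have hm : Measurable fun p : U × ℝ => √(2 * p.2) • (‖p.1‖⁻¹ • p.1) := by fun_prop
  have hfm : Measurable fun p : U × ℝ => f (√(2 * p.2) • (‖p.1‖⁻¹ • p.1)) := hf.comp hm
  rw [lintegral_smul_measure, lintegral_map hf hm, lintegral_withDensity_eq_lintegral_mul _ hw
    hfm, lintegral_prod _ (hw.mul hfm).aemeasurable]
  simp only [Pi.mul_apply]
  have hψ : Measurable fun v : U => ∫⁻ t : ℝ, ENNReal.ofReal (max t 0 ^ ((n : ℝ) / 2 - 1)) *
      f (√(2 * t) • v) := by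
    refine Measurable.lintegral_prod_right' (f := fun p : U × ℝ =>
      ENNReal.ofReal (max p.2 0 ^ ((n : ℝ) / 2 - 1)) * f (√(2 * p.2) • p.1)) ?_
    fun_prop
  rw [hdir _ hψ, lintegral_polar hf]
  have hin : ∀ θ : Metric.sphere (0 : U) 1,
      ∫⁻ t : ℝ, ENNReal.ofReal (max t 0 ^ ((n : ℝ) / 2 - 1)) * f (√(2 * t) • (θ : U)) =
        κ * ∫⁻ r in Set.Ioi (0 : ℝ), ENNReal.ofReal (r ^ (n - 1)) * f (r • (θ : U)) := by
    intro θ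
    rw [hκ, ← lintegral_Ioi_sq_div_two (by omega) fun r => f (r • (θ : U)),
      ← lintegral_indicator measurableSet_Ioi]
    refine lintegral_congr fun t => ?_
    by_cases ht : 0 < t
    · rw [Set.indicator_of_mem (Set.mem_Ioi.2 ht), max_eq_left ht.le]
    · rw [Set.indicator_of_notMem (by simpa using ht), max_eq_right (not_lt.1 ht),
        Real.zero_rpow hexp, ENNReal.ofReal_zero, zero_mul]
  simp only [hin]
  rw [lintegral_const_mul' _ _ hκt, ← mul_assoc A, smul_eq_mul, ← mul_assoc,
    ENNReal.inv_mul_cancel (mul_ne_zero hA0 hκ0) (ENNReal.mul_ne_top hAt hκt), one_mul]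

end Polar

/-! ### Existence of microcanonical measures at almost every level -/

/-- A countable family of compactly supported functions that approximates every other one, relative
to a fixed member of the family. -/
theorem exists_seq_hasCompactSupport_approx (E : Type*) [TopologicalSpace E] [T2Space E]
    [LocallyCompactSpace E] [SecondCountableTopology E] :
    ∃ (χ : ℕ → E → ℝ) (ψ : ℕ → ℕ → E → ℝ),
      (∀ j, Continuous (χ j) ∧ HasCompactSupport (χ j)) ∧
      (∀ j i, Continuous (ψ j i) ∧ HasCompactSupport (ψ j i)) ∧
      ∀ φ : E → ℝ, Continuous φ → HasCompactSupport φ →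
        ∃ j, ∀ ε : ℝ, 0 < ε → ∃ i, ∀ x, |φ x - ψ j i x| ≤ ε * χ j x := by
  let K := CompactExhaustion.choice E
  have hχ : ∀ j, ∃ f : C(E, ℝ), Set.EqOn f 1 (K j) ∧ Set.EqOn f 0 ∅ ∧ HasCompactSupport f ∧
      ∀ x, f x ∈ Set.Icc (0 : ℝ) 1 := fun j =>
    exists_continuous_one_zero_of_isCompact (K.isCompact j) isClosed_empty (Set.disjoint_empty _)
  choose χ hχ1 _ hχc hχ01 using hχ
  let d : ℕ → C(E, ℝ) := TopologicalSpace.denseSeq C(E, ℝ)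
  -- The `ψ j i` are cutoffs of a sequence dense in the compact-open topology. The index `j` depends
  -- only on the support of `φ` and is fixed before `ε`, so the error is controlled by a single
  -- function `χ j`.
  refine ⟨fun j => χ j, fun j i x => χ j x * d i x, fun j => ⟨(χ j).continuous, hχc j⟩,
    fun j i => ⟨(χ j).continuous.mul (d i).continuous, (hχc j).mul_right⟩, fun φ hφ hφc => ?_⟩
  obtain ⟨j, hj⟩ := K.exists_superset_of_isCompact hφc
  refine ⟨j, fun ε hε => ?_⟩
  have hopen : IsOpen {ψ : C(E, ℝ) | Set.MapsTo (ψ - ⟨φ, hφ⟩ : C(E, ℝ)) (tsupport (χ j))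
      (Metric.ball 0 ε)} :=
    (ContinuousMap.isOpen_setOfPred_mapsTo (hχc j) Metric.isOpen_ball).preimage
      (continuous_id.sub continuous_const)
  obtain ⟨i, hψ⟩ := (TopologicalSpace.denseRange_denseSeq C(E, ℝ)).exists_mem_open hopen
    ⟨⟨φ, hφ⟩, fun x _ => by simpa using hε⟩
  refine ⟨i, fun x => ?_⟩
  have hφx : φ x = χ j x * φ x := by
    by_cases hx : x ∈ tsupport φ
    · rw [hχ1 j (hj hx)]; simp
    · rw [image_eq_zero_of_notMem_tsupport hx, mul_zero]
  have h0 : 0 ≤ χ j x := (hχ01 j x).1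
  by_cases hx : x ∈ tsupport (χ j)
  · have h1 : |d i x - φ x| < ε := by simpa using hψ hx
    rw [hφx, ← mul_sub, abs_mul, abs_of_nonneg h0, mul_comm, abs_sub_comm]
    exact mul_le_mul_of_nonneg_right h1.le h0
  · have h1 : χ j x = 0 := image_eq_zero_of_notMem_tsupport hx
    have h2 : φ x = 0 := by rw [hφx, h1, zero_mul]
    simp [h1, h2]

/-- Disintegration of Lebesgue measure along a function whose law is absolutely continuous: the
microcanonical measures exist at almost every level. -/
theorem exists_kernel_isPDelta {E : Type*} [TopologicalSpace E] [T2Space E]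
    [LocallyCompactSpace E] [SecondCountableTopology E] [MeasureSpace E] [BorelSpace E]
    [StandardBorelSpace E] [Nonempty E] [IsFiniteMeasureOnCompacts (volume : Measure E)]
    [SFinite (volume : Measure E)]
    {f : E → ℝ} (hf : Continuous f) {β : ℝ}
    (hfin : ∫⁻ q, ENNReal.ofReal (Real.exp (-(β * f q))) ≠ ⊤)
    (hac : ∀ N : Set ℝ, MeasurableSet N → volume N = 0 → volume (f ⁻¹' N) = 0) :
    ∃ N : Kernel ℝ E, IsSFiniteKernel N ∧
      (volume : Measure E).map (fun q => (f q, q)) = (volume : Measure ℝ) ⊗ₘ N ∧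
      ∀ᵐ s, IsPDelta (fun q => f q - s) (N s) := by
  have hfm : Measurable f := hf.measurable
  have hgr : Measurable fun q => (f q, q) := hfm.prodMk measurable_id
  set ρ : E → ENNReal := fun q => ENNReal.ofReal (Real.exp (-(β * f q))) with hρ
  have hρm : Measurable ρ := by fun_prop
  -- Lebesgue measure may be infinite; the weight `exp(-β f)` makes it finite so that conditional
  -- measures exist. As the weight depends on `f` alone, the factor `exp(β s)` in `w` removes it
  -- level by level.
  set M : Measure (ℝ × E) := ((volume : Measure E).withDensity ρ).map (fun q => (f q, q)) with hM
  have hMfin : IsFiniteMeasure M := by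
    constructor
    rw [hM, Measure.map_apply hgr MeasurableSet.univ, Set.preimage_univ,
      withDensity_apply _ MeasurableSet.univ, Measure.restrict_univ]
    exact hfin.lt_top
  have hfst : M.fst ≪ volume := by
    refine Measure.AbsolutelyContinuous.mk fun N hNm hN => ?_
    rw [Measure.fst_apply hNm, hM, Measure.map_apply hgr (measurable_fst hNm)]
    exact withDensity_absolutelyContinuous _ _ (hac N hNm hN)
  let p : ℝ → NNReal := fun s => (M.fst.rnDeriv volume s).toNNReal
  have hpm : Measurable p := (Measure.measurable_rnDeriv _ _).ennreal_toNNReal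
  have hp : M.fst = (volume : Measure ℝ).withDensity fun s => (p s : ENNReal) := by
    refine (Measure.withDensity_rnDeriv_eq _ _ hfst).symm.trans (withDensity_congr_ae ?_)
    filter_upwards [Measure.rnDeriv_lt_top M.fst (volume : Measure ℝ)] with s hs
    exact (ENNReal.coe_toNNReal hs.ne).symm
  let w : ℝ → NNReal := fun s => (Real.exp (β * s)).toNNReal * p s
  have hwm : Measurable w := by fun_prop
  let N : Kernel ℝ E := M.condKernel.withDensity fun s _ => (w s : ENNReal)
  have hwm2 : Measurable (Function.uncurry fun (s : ℝ) (_ : E) => (w s : ENNReal)) :=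
    (hwm.comp measurable_fst).coe_nnreal_ennreal
  have hNs : IsSFiniteKernel N :=
    Kernel.IsSFiniteKernel.withDensity M.condKernel fun _ _ => ENNReal.coe_ne_top
  have hN : ∀ s, N s = (w s : ENNReal) • M.condKernel s := fun s => by
    rw [Kernel.withDensity_apply _ hwm2]
    exact withDensity_const _
  have hNfin : ∀ s, IsFiniteMeasure (N s) := fun s => by
    rw [hN]
    exact Measure.smul_finite _ ENNReal.coe_ne_top
  have hJ : (volume : Measure E).map (fun q => (f q, q)) = (volume : Measure ℝ) ⊗ₘ N := by
    refine Measure.ext_of_lintegral _ fun G hG => ?_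
    rw [lintegral_map hG hgr, Measure.lintegral_compProd hG]
    have h1 : ∫⁻ q, G (f q, q) =
        ∫⁻ x, ENNReal.ofReal (Real.exp (β * x.1)) * G x ∂M := by
      have hm : Measurable fun x : ℝ × E => ENNReal.ofReal (Real.exp (β * x.1)) * G x := by fun_prop
      rw [hM, lintegral_map hm hgr, lintegral_withDensity_eq_lintegral_mul _ hρm
        (by fun_prop : Measurable fun q => ENNReal.ofReal (Real.exp (β * f q)) * G (f q, q))]
      refine lintegral_congr fun q => ?_
      simp only [Pi.mul_apply, hρ]
      rw [← mul_assoc, ← ENNReal.ofReal_mul (Real.exp_pos _).le, ← Real.exp_add,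
        neg_add_cancel, Real.exp_zero, ENNReal.ofReal_one, one_mul]
    rw [h1, ← Measure.lintegral_condKernel (by fun_prop), hp,
      lintegral_withDensity_eq_lintegral_mul _ (by fun_prop) ?_]
    · refine lintegral_congr fun s => ?_
      rw [hN, lintegral_smul_measure]
      simp only [Pi.mul_apply, w]
      rw [lintegral_const_mul _ (by fun_prop), smul_eq_mul, ENNReal.coe_mul,
        ← mul_assoc, mul_comm (p s : ENNReal)]
      rfl
    · exact Measurable.lintegral_kernel_prod_right'
        (f := fun x : ℝ × E => ENNReal.ofReal (Real.exp (β * x.1)) * G x) (by fun_prop)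
  refine ⟨N, hNs, hJ, ?_⟩
  have hφint : ∀ φ : E → ℝ, Continuous φ → HasCompactSupport φ → Integrable φ := fun φ h1 h2 =>
    h1.integrable_of_hasCompactSupport h2
  -- For one test function the shell average is a difference quotient of the primitive of `s ↦ ∫ φ
  -- dN_s`, and Lebesgue's differentiation theorem applies. The exceptional null set depends on `φ`,
  -- hence the passage to a countable family.
  have hone : ∀ φ : E → ℝ, Continuous φ → HasCompactSupport φ → ∀ᵐ s,
      Tendsto (fun h : ℝ => h⁻¹ * ∫ x in {x | 0 ≤ f x - s ∧ f x - s < h}, φ x) (𝓝[>] 0)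
        (𝓝 (∫ x, φ x ∂N s)) := by
    intro φ hφ hφc
    have hφ2 : AEStronglyMeasurable (fun x : ℝ × E => φ x.2)
        ((volume : Measure E).map fun q => (f q, q)) :=
      (hφ.measurable.comp measurable_snd).aestronglyMeasurable
    have hi : Integrable (fun x : ℝ × E => φ x.2) ((volume : Measure ℝ) ⊗ₘ N) := by
      rw [← hJ, integrable_map_measure hφ2 hgr.aemeasurable]
      exact hφint φ hφ hφc
    have hk : Integrable fun s => ∫ x, φ x ∂N s := by
      rw [Measure.compProd] at hi
      simpa using Integrable.integral_compProd hi
    have hset : ∀ S : Set ℝ, MeasurableSet S →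
        ∫ x in f ⁻¹' S, φ x = ∫ s in S, ∫ x, φ x ∂N s := by
      intro S hS
      have e1 : ∫ x in f ⁻¹' S, φ x =
          ∫ x in S ×ˢ Set.univ, φ x.2 ∂((volume : Measure ℝ) ⊗ₘ N) := by
        rw [← hJ, setIntegral_map (hS.prod MeasurableSet.univ) hφ2 hgr.aemeasurable]
        congr 2
        ext q
        simp
      rw [e1, Measure.setIntegral_compProd hS MeasurableSet.univ hi.integrableOn]
      simp
    filter_upwards [LocallyIntegrable.ae_hasDerivAt_integral hk.locallyIntegrable] with s hs
    refine (hs s).tendsto_slope_zero_right.congr' ?_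
    filter_upwards [self_mem_nhdsWithin] with h hh
    have hh : 0 < h := hh
    have e2 : {x | 0 ≤ f x - s ∧ f x - s < h} = f ⁻¹' Set.Ico s (s + h) := by
      ext x
      simp only [Set.mem_ofPred_eq, Set.mem_preimage, Set.mem_Ico]
      constructor <;> rintro ⟨h1, h2⟩ <;> constructor <;> linarith
    rw [e2, hset _ measurableSet_Ico, intervalIntegral.integral_same, sub_zero,
      intervalIntegral.integral_of_le (by linarith), integral_Ico_eq_integral_Ioc, smul_eq_mul]
  obtain ⟨χ, ψ, hχ, hψ, happ⟩ := exists_seq_hasCompactSupport_approx E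
  have h1 : ∀ᵐ s, ∀ j, _ := ae_all_iff.2 fun j => hone (χ j) (hχ j).1 (hχ j).2
  have h2 : ∀ᵐ s, ∀ j i, _ := ae_all_iff.2 fun j => ae_all_iff.2 fun i =>
    hone (ψ j i) (hψ j i).1 (hψ j i).2
  filter_upwards [h1, h2] with s h1 h2
  have := hNfin s
  refine ⟨inferInstance, fun φ hφ hφc => ?_⟩
  obtain ⟨j, hj⟩ := happ φ hφ hφc
  -- The estimate is stated for a general `m` because it serves both for Lebesgue measure on the
  -- shell and for the limit `N s`.
  have happrox : ∀ (m : Measure E), IsFiniteMeasureOnCompacts m → ∀ ε i,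
      (∀ x, |φ x - ψ j i x| ≤ ε * χ j x) →
      |(∫ x, φ x ∂m) - ∫ x, ψ j i x ∂m| ≤ ε * ∫ x, χ j x ∂m := by
    intro m hm ε i hi
    have iφ : Integrable φ m := hφ.integrable_of_hasCompactSupport hφc
    have iψ : Integrable (ψ j i) m := (hψ j i).1.integrable_of_hasCompactSupport (hψ j i).2
    have iχ : Integrable (χ j) m := (hχ j).1.integrable_of_hasCompactSupport (hχ j).2
    rw [← integral_sub iφ iψ, ← integral_const_mul]
    rw [← Real.norm_eq_abs]
    exact norm_integral_le_of_norm_le (iχ.const_mul ε)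
      (Eventually.of_forall fun x => by rw [Real.norm_eq_abs]; exact hi x)
  rw [Metric.tendsto_nhds]
  intro δ hδ
  set Lχ := ∫ x, χ j x ∂N s with hLχ
  have hLχ0 : 0 ≤ Lχ := by
    refine integral_nonneg fun x => ?_
    obtain ⟨i, hi⟩ := hj 1 one_pos
    have := (abs_nonneg _).trans (hi x)
    simpa using this
  -- The approximation costs at most `ε (Lχ + 1)` in the shell average and `ε Lχ` in the limit; this
  -- `ε` makes the sum `δ / 2`.
  obtain ⟨i, hi⟩ := hj (δ / (2 * (2 * Lχ + 1))) (by positivity)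
  have a1 := Metric.tendsto_nhds.1 (h1 j) 1 one_pos
  have a2 := Metric.tendsto_nhds.1 (h2 j i) (δ / 2) (by positivity)
  filter_upwards [a1, a2, self_mem_nhdsWithin] with h b1 b2 hh
  have hh : 0 < h := hh
  rw [Real.dist_eq] at b1 b2 ⊢
  set A := {x | 0 ≤ f x - s ∧ f x - s < h}
  have c1 := happrox ((volume : Measure E).restrict A) inferInstance _ i hi
  have c2 := happrox (N s) inferInstance _ i hi
  set ε := δ / (2 * (2 * Lχ + 1)) with hε
  have hε0 : 0 < ε := by positivity
  have hε1 : ε * (2 * Lχ + 1) = δ / 2 := by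
    rw [hε]
    field_simp
  have c3 : |h⁻¹ * (∫ x in A, φ x) - h⁻¹ * ∫ x in A, ψ j i x| ≤ ε * (h⁻¹ * ∫ x in A, χ j x) := by
    rw [← mul_sub, abs_mul, abs_of_pos (inv_pos.2 hh)]
    calc _ ≤ h⁻¹ * (ε * ∫ x in A, χ j x) := by gcongr
      _ = _ := by ring
  have c4 : h⁻¹ * (∫ x in A, χ j x) < Lχ + 1 := by linarith [(abs_lt.1 b1).2]
  have c5 : ε * (h⁻¹ * ∫ x in A, χ j x) < ε * (Lχ + 1) := by gcongr
  have c3' := abs_le.1 c3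
  have c2' := abs_le.1 c2
  have b2' := abs_lt.1 b2
  have e : ε * (Lχ + 1) + ε * Lχ = δ / 2 := by rw [← hε1]; ring
  rw [abs_lt]
  constructor <;> linarith [c3'.1, c3'.2, c2'.1, c2'.2, b2'.1, b2'.2]

/-! ### The visible system in `(z, w)` -/

section Visible

variable {Z H : Type*} [NormedAddCommGroup Z] [InnerProductSpace ℝ Z]
  [NormedAddCommGroup H] [InnerProductSpace ℝ H]

theorem continuous_Hzw {HA : Z → ℝ} (hHA : Continuous HA) (C : Z →L[ℝ] H) (W : Submodule ℝ H) :
    Continuous (Hzw HA C W) := by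
  unfold Hzw
  fun_prop

/-- Completing the square in the visible Hamiltonian. -/
theorem Hzw_eq (HA : Z → ℝ) (C : Z →L[ℝ] H) {W : Submodule ℝ H} (hC : ∀ z, C z ∈ W) (z : Z)
    (w : W) :
    Hzw HA C W (z, w) = (HA z - ‖C z‖ ^ 2 / 2) + ‖w + ⟨C z, hC z⟩‖ ^ 2 / 2 := by
  have h : ‖w + ⟨C z, hC z⟩‖ ^ 2 = ‖w‖ ^ 2 + 2 * ⟪C z, (w : H)⟫_ℝ + ‖C z‖ ^ 2 := by
    rw [norm_add_sq_real, real_inner_comm]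
    rfl
  rw [Hzw, h]
  ring

theorem integrable_exp_neg_norm_sq (V : Type*) [NormedAddCommGroup V] [InnerProductSpace ℝ V]
    [FiniteDimensional ℝ V] [MeasurableSpace V] [BorelSpace V] {b : ℝ} (hb : 0 < b) :
    Integrable fun v : V => Real.exp (-b * ‖v‖ ^ 2) := by
  have h := (GaussianFourier.integrable_cexp_neg_mul_sq_norm_add (V := V) (b := b)
    (by simpa using hb) 0 0).norm
  refine h.congr (Eventually.of_forall fun v => ?_)
  simp only [Complex.norm_exp]
  congr 1
  simp [← Complex.ofReal_pow]

variable [FiniteDimensional ℝ Z] [MeasurableSpace Z] [BorelSpace Z]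
  [MeasurableSpace H] [BorelSpace H] {W : Submodule ℝ H} [FiniteDimensional ℝ W]

/-- After completing the square, translation by `C z` turns the integral over `w` into a Gaussian
integral that does not depend on `z`. What remains is the assumed integral of `exp(-β(H_A - ½‖C
z‖²))`. -/
theorem lintegral_exp_neg_Hzw_ne_top {HA : Z → ℝ} (hHA : Continuous HA) {C : Z →L[ℝ] H}
    (hC : ∀ z, C z ∈ W) {β : ℝ} (hβ : 0 < β)
    (hHAi : Integrable fun z => Real.exp (-β * (HA z - ‖C z‖ ^ 2 / 2))) :
    ∫⁻ q, ENNReal.ofReal (Real.exp (-(β * Hzw HA C W q))) ≠ ⊤ := by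
  have hm : Measurable fun q => ENNReal.ofReal (Real.exp (-(β * Hzw HA C W q))) := by
    have := (continuous_Hzw hHA C W).measurable
    fun_prop
  rw [Measure.volume_eq_prod, lintegral_prod _ hm.aemeasurable]
  have h1 : ∀ z, ∫⁻ w, ENNReal.ofReal (Real.exp (-(β * Hzw HA C W (z, w)))) =
      ENNReal.ofReal (Real.exp (-β * (HA z - ‖C z‖ ^ 2 / 2))) *
        ∫⁻ w : W, ENNReal.ofReal (Real.exp (-(β / 2) * ‖w‖ ^ 2)) := fun z => by
    rw [← lintegral_add_right_eq_self (fun w : W =>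
      ENNReal.ofReal (Real.exp (-(β / 2) * ‖w‖ ^ 2))) ⟨C z, hC z⟩,
      ← lintegral_const_mul' _ _ ENNReal.ofReal_ne_top]
    refine lintegral_congr fun w => ?_
    rw [← ENNReal.ofReal_mul (Real.exp_pos _).le, ← Real.exp_add, Hzw_eq HA C hC]
    congr 2
    ring
  simp only [h1]
  rw [lintegral_mul_const' _ _ (integrable_exp_neg_norm_sq W (by positivity)).lintegral_lt_top.ne]
  exact ENNReal.mul_ne_top hHAi.lintegral_lt_top.ne
    (integrable_exp_neg_norm_sq W (by positivity)).lintegral_lt_top.ne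

/-- On the graph `e = E₀ - H_zw` the weight `exp(β e)` becomes a density in `(z, w)`. The limit is
thereby the image of a measure on the same parameters as the finite-dimensional shells. -/
theorem limitZWE_eq_map {HA : Z → ℝ} (hHA : Continuous HA) (C : Z →L[ℝ] H) (β E₀ : ℝ) :
    limitZWE HA C β E₀ W = ((volume : Measure (Z × W)).withDensity fun q =>
      ENNReal.ofReal (Real.exp (β * (E₀ - Hzw HA C W q)))).map
        fun q => (q, E₀ - Hzw HA C W q) := by
  have hf := (continuous_Hzw hHA C W).measurable
  refine Measure.ext_of_lintegral _ fun G hG => ?_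
  rw [limitZWE, pdeltaJoint, Measure.map_map (by fun_prop) (by fun_prop),
    lintegral_withDensity_eq_lintegral_mul _ (by fun_prop) hG, lintegral_map (by fun_prop)
    (by fun_prop), lintegral_map hG (by fun_prop),
    lintegral_withDensity_eq_lintegral_mul _ (by fun_prop) (by fun_prop)]
  rfl

theorem limitZWE_univ {HA : Z → ℝ} (hHA : Continuous HA) (C : Z →L[ℝ] H) (β E₀ : ℝ) :
    limitZWE HA C β E₀ W Set.univ =
      ∫⁻ q : Z × W, ENNReal.ofReal (Real.exp (β * (E₀ - Hzw HA C W q))) := by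
  have hf := (continuous_Hzw hHA C W).measurable
  rw [limitZWE_eq_map hHA, Measure.map_apply (by fun_prop) MeasurableSet.univ, Set.preimage_univ,
    withDensity_apply _ MeasurableSet.univ, Measure.restrict_univ]

theorem limitZWE_univ_pos {HA : Z → ℝ} (hHA : Continuous HA) (C : Z →L[ℝ] H) (β E₀ : ℝ) :
    0 < limitZWE HA C β E₀ W Set.univ := by
  have hf := (continuous_Hzw hHA C W).measurable
  rw [limitZWE_univ hHA, lintegral_pos_iff_support (by fun_prop)]
  have : Function.support (fun q : Z × W =>
      ENNReal.ofReal (Real.exp (β * (E₀ - Hzw HA C W q)))) = Set.univ := by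
    ext q
    simp [Real.exp_pos]
  rw [this]
  exact isOpen_univ.measure_pos _ Set.univ_nonempty

theorem limitZWE_univ_lt_top {HA : Z → ℝ} (hHA : Continuous HA) {C : Z →L[ℝ] H}
    (hC : ∀ z, C z ∈ W) {β : ℝ} (hβ : 0 < β) (E₀ : ℝ)
    (hHAi : Integrable fun z => Real.exp (-β * (HA z - ‖C z‖ ^ 2 / 2))) :
    limitZWE HA C β E₀ W Set.univ < ⊤ := by
  rw [limitZWE_univ hHA]
  have h : ∀ q : Z × W, ENNReal.ofReal (Real.exp (β * (E₀ - Hzw HA C W q))) =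
      ENNReal.ofReal (Real.exp (β * E₀)) * ENNReal.ofReal (Real.exp (-(β * Hzw HA C W q))) :=
    fun q => by
      rw [← ENNReal.ofReal_mul (Real.exp_pos _).le, ← Real.exp_add]
      congr 2
      ring
  simp only [h]
  rw [lintegral_const_mul' _ _ ENNReal.ofReal_ne_top]
  exact (ENNReal.mul_ne_top ENNReal.ofReal_ne_top
    (lintegral_exp_neg_Hzw_ne_top hHA hC hβ hHAi)).lt_top

/-- For fixed `z` the function is a constant plus half the squared norm of a translate of `w`, and
the squared norm on a nontrivial space has an absolutely continuous law. This is where `W ≠ 0` is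
needed. -/
theorem volume_Hzw_preimage_eq_zero {HA : Z → ℝ} (hHA : Continuous HA) {C : Z →L[ℝ] H}
    (hC : ∀ z, C z ∈ W) (hW : W ≠ ⊥) {N : Set ℝ} (hNm : MeasurableSet N) (hN : volume N = 0) :
    volume (Hzw HA C W ⁻¹' N) = 0 := by
  have : Nontrivial W := Submodule.nontrivial_iff_ne_bot.2 hW
  rw [Measure.volume_eq_prod,
    Measure.measure_prod_null ((continuous_Hzw hHA C W).measurable hNm)]
  refine Eventually.of_forall fun z => ?_
  set a := HA z - ‖C z‖ ^ 2 / 2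
  have e : Prod.mk z ⁻¹' (Hzw HA C W ⁻¹' N) = (fun w : W => w + ⟨C z, hC z⟩) ⁻¹'
      {u : W | ‖u‖ ^ 2 / 2 ∈ (fun r => a + r) ⁻¹' N} := by
    ext w
    simp only [Set.mem_preimage, Hzw_eq HA C hC, Set.mem_ofPred_eq, a]
  show volume (Prod.mk z ⁻¹' (Hzw HA C W ⁻¹' N)) = 0
  rw [e, measure_preimage_add_right]
  exact volume_norm_sq_div_two_mem (measurable_const_add a hNm)
    (by rw [measure_preimage_add]; exact hN)

/-- Disintegration of the visible Lebesgue measure into microcanonical measures. -/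
theorem limitZWE_disintegration {HA : Z → ℝ} (hHA : Continuous HA) {C : Z →L[ℝ] H}
    (hC : ∀ z, C z ∈ W) {β : ℝ} (hβ : 0 < β) (E₀ : ℝ)
    (hHAi : Integrable fun z => Real.exp (-β * (HA z - ‖C z‖ ^ 2 / 2))) (hW : W ≠ ⊥) :
    (∀ᵐ e : ℝ, IsPDelta (fun q : Z × W => Hzw HA C W q - E₀ + e)
        (pdelta fun q : Z × W => Hzw HA C W q - E₀ + e)) ∧
      limitZWE HA C β E₀ W =
        ((volume : Measure ℝ).withDensity fun e => ENNReal.ofReal (Real.exp (β * e))).bind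
          fun e => (pdelta fun q : Z × W => Hzw HA C W q - E₀ + e).map fun q => (q, e) := by
  have hf := (continuous_Hzw hHA C W).measurable
  have : CompleteSpace Z := FiniteDimensional.complete ℝ Z
  have : CompleteSpace W := FiniteDimensional.complete ℝ W
  have : ProperSpace Z := FiniteDimensional.proper ℝ Z
  have : ProperSpace W := FiniteDimensional.proper ℝ W
  obtain ⟨N, hNs, hJ, hN⟩ := exists_kernel_isPDelta (continuous_Hzw hHA C W)
    (lintegral_exp_neg_Hzw_ne_top hHA hC hβ hHAi)
    (fun S hS h0 => volume_Hzw_preimage_eq_zero hHA hC hW hS h0)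
  -- The level of `H_zw` is `s = E₀ - e`; this reflection carries the statements about almost every
  -- `s` to almost every `e`.
  have hmp : MeasurePreserving (fun e : ℝ => E₀ - e) volume volume :=
    Measure.measurePreserving_sub_left volume E₀
  have hN' : ∀ᵐ e : ℝ, IsPDelta (fun q : Z × W => Hzw HA C W q - E₀ + e) (N (E₀ - e)) := by
    filter_upwards [hmp.quasiMeasurePreserving.ae hN] with e he
    convert he using 2
    ring
  have hpd : ∀ᵐ e : ℝ, pdelta (fun q : Z × W => Hzw HA C W q - E₀ + e) = N (E₀ - e) := by
    filter_upwards [hN'] with e he using he.eq_pdelta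
  refine ⟨by filter_upwards [hN', hpd] with e h1 h2; rwa [h2], ?_⟩
  have hmeas : Measurable fun e : ℝ => (N (E₀ - e)).map fun q : Z × W => (q, e) := by
    refine Measure.measurable_of_measurable_coe _ fun A hA => ?_
    have h1 : ∀ e : ℝ, ((N (E₀ - e)).map fun q : Z × W => (q, e)) A =
        N.comap (fun e => E₀ - e) hmp.measurable e (Prod.mk e ⁻¹' (Prod.swap ⁻¹' A)) := fun e => by
      rw [Measure.map_apply (by fun_prop) hA, Kernel.comap_apply]
      rfl
    simp only [h1]
    exact Kernel.measurable_kernel_prodMk_left (measurable_swap hA)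
  have hae : (fun e : ℝ => (pdelta fun q : Z × W => Hzw HA C W q - E₀ + e).map fun q => (q, e))
      =ᵐ[(volume : Measure ℝ).withDensity fun e => ENNReal.ofReal (Real.exp (β * e))]
      fun e => (N (E₀ - e)).map fun q : Z × W => (q, e) := by
    refine (withDensity_absolutelyContinuous _ _).ae_le ?_
    filter_upwards [hpd] with e he
    rw [he]
  -- `pdelta` is defined by choice and known only for almost every `e`; replacing it by the kernel
  -- provides the measurability on which `bind` depends.
  rw [Measure.bind, Measure.map_congr hae, ← Measure.bind, limitZWE_eq_map hHA]
  refine Measure.ext_of_lintegral _ fun G hG => ?_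
  have hGm : Measurable fun e : ℝ => ∫⁻ x, G x ∂((N (E₀ - e)).map fun q : Z × W => (q, e)) :=
    (Measure.measurable_lintegral hG).comp hmeas
  rw [Measure.lintegral_bind hmeas.aemeasurable hG.aemeasurable, lintegral_map hG (by fun_prop),
    lintegral_withDensity_eq_lintegral_mul _ (by fun_prop) (by fun_prop),
    lintegral_withDensity_eq_lintegral_mul _ (by fun_prop) hGm]
  have hK : Measurable fun x : ℝ × (Z × W) => ENNReal.ofReal (Real.exp (β * (E₀ - x.1))) *
      G (x.2, E₀ - x.1) := by fun_prop
  have h2 : ∫⁻ q : Z × W, ENNReal.ofReal (Real.exp (β * (E₀ - Hzw HA C W q))) *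
      G (q, E₀ - Hzw HA C W q) = ∫⁻ s, ∫⁻ q, ENNReal.ofReal (Real.exp (β * (E₀ - s))) *
        G (q, E₀ - s) ∂N s := by
    rw [← Measure.lintegral_compProd hK, ← hJ, lintegral_map hK (by fun_prop)]
  simp only [Pi.mul_apply]
  rw [h2, ← hmp.lintegral_comp (Measurable.lintegral_kernel_prod_right' hK)]
  refine lintegral_congr fun e => ?_
  rw [lintegral_map hG (by fun_prop), ← lintegral_const_mul _ (by fun_prop)]
  simp only [sub_sub_cancel]

end Visible

/-! ### Gaussian measures and measurable linear maps -/

theorem IsCanonicalGaussian.isProbabilityMeasure {H X : Type*} [NormedAddCommGroup H]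
    [InnerProductSpace ℝ H] [CompleteSpace H] [NormedAddCommGroup X] [InnerProductSpace ℝ X]
    [CompleteSpace X] [SecondCountableTopology X] [MeasurableSpace X] [BorelSpace X]
    {β : ℝ} {ι : H →L[ℝ] X} {γ : Measure X} (hγ : IsCanonicalGaussian β ι γ) :
    IsProbabilityMeasure γ := by
  have hm : Measurable fun y : X => ⟪(0 : X), y⟫_ℝ := by fun_prop
  have h := congrArg (fun m : Measure ℝ => m Set.univ) (hγ 0)
  exact ⟨by simpa [Measure.map_apply hm MeasurableSet.univ] using h⟩

theorem IsCanonicalGaussian.charFun_eq {H X : Type*} [NormedAddCommGroup H]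
    [InnerProductSpace ℝ H] [CompleteSpace H] [NormedAddCommGroup X] [InnerProductSpace ℝ X]
    [CompleteSpace X] [SecondCountableTopology X] [MeasurableSpace X] [BorelSpace X]
    {β : ℝ} (hβ : 0 < β) {ι : H →L[ℝ] X} {γ : Measure X} (hγ : IsCanonicalGaussian β ι γ) (x : X) :
    charFun γ x = Complex.exp (-(β⁻¹ * ‖ContinuousLinearMap.adjoint ι x‖ ^ 2 / 2 : ℝ)) := by
  have hm : Measurable fun y : X => ⟪x, y⟫_ℝ := by fun_prop
  have h1 : charFun γ x = charFun (γ.map fun y => ⟪x, y⟫_ℝ) 1 := by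
    rw [charFun_apply, charFun_apply, integral_map hm.aemeasurable (by fun_prop)]
    refine integral_congr_ae (Eventually.of_forall fun y => ?_)
    simp [real_inner_comm]
  have h2 : ⟪(ι ∘L ContinuousLinearMap.adjoint ι) x, x⟫_ℝ =
      ‖ContinuousLinearMap.adjoint ι x‖ ^ 2 := by
    rw [← real_inner_self_eq_norm_sq, ContinuousLinearMap.comp_apply,
      ContinuousLinearMap.adjoint_inner_right]
  rw [h1, hγ x, charFun_gaussianReal, h2, Real.coe_toNNReal _ (by positivity)]
  congr 1
  push_cast
  simp

/-- A probability measure whose characteristic function is even and multiplicative is a Dirac mass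
at the origin. -/
theorem eq_dirac_zero_of_charFun_add {Y : Type*} [NormedAddCommGroup Y] [InnerProductSpace ℝ Y]
    [CompleteSpace Y] [SecondCountableTopology Y] [MeasurableSpace Y] [BorelSpace Y]
    {μ : Measure Y} [IsProbabilityMeasure μ]
    (hadd : ∀ s t, charFun μ (s + t) = charFun μ s * charFun μ t)
    (heven : ∀ t, charFun μ (-t) = charFun μ t) : μ = Measure.dirac 0 := by
  -- Evaluation at `t` and `-t` gives squares equal to one; writing `t` as twice its half then
  -- removes the sign.
  have h2 : ∀ t, charFun μ t * charFun μ t = 1 := fun t => by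
    have h := hadd t (-t)
    rw [add_neg_cancel, heven] at h
    rw [← h]
    simp
  refine Measure.ext_of_charFun (funext fun t => ?_)
  have h3 : t = (2⁻¹ : ℝ) • t + (2⁻¹ : ℝ) • t := by
    rw [← add_smul]
    norm_num
  rw [charFun_dirac, inner_zero_left, h3, hadd, h2]
  simp

/-- A measurable linear map that is trivial along the Cameron-Martin directions of a Gaussian
measure vanishes almost everywhere. -/
theorem ae_eq_zero_of_linear_of_charFun {H X Y : Type*} [NormedAddCommGroup H]
    [InnerProductSpace ℝ H] [NormedAddCommGroup X] [InnerProductSpace ℝ X] [CompleteSpace X]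
    [SecondCountableTopology X] [MeasurableSpace X] [BorelSpace X]
    [NormedAddCommGroup Y] [InnerProductSpace ℝ Y] [CompleteSpace Y] [SecondCountableTopology Y]
    [MeasurableSpace Y] [BorelSpace Y]
    {γ : Measure X} [IsProbabilityMeasure γ] {v : ℝ} {A : X →L[ℝ] H} {B : X → X}
    (hγ : ∀ x, charFun γ x = Complex.exp (-(v * ‖A x‖ ^ 2 / 2 : ℝ)))
    (hB : ∀ x x', ⟪B x, x'⟫_ℝ = ⟪A x, A x'⟫_ℝ)
    {f : X → Y} (hf : AEMeasurable f γ) {L : Submodule ℝ X} (hBL : ∀ x, B x ∈ L)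
    (hL : ∀ᵐ y ∂γ, y ∈ L) {g : L →ₗ[ℝ] Y} (hfg : ∀ y : L, f y = g y) (hfB : ∀ x, f (B x) = 0) :
    f =ᵐ[γ] 0 := by
  -- Linearity on `L` and `f ∘ B = 0` make `f` invariant under shifts along the vectors `B x`.
  have hadd : ∀ y ∈ L, ∀ (r : ℝ) (x : X), f (y + r • B x) = f y := fun y hy r x => by
    have h1 := hfg (⟨y, hy⟩ + r • ⟨B x, hBL x⟩)
    rw [map_add, map_smul, ← hfg, ← hfg, hfB, smul_zero, add_zero] at h1
    exact h1
  have hneg : ∀ y ∈ L, f (-y) = -f y := fun y hy => by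
    have h1 := hfg (-⟨y, hy⟩)
    rw [map_neg, ← hfg] at h1
    exact h1
  set f' : X → Y := hf.mk f with hf'
  have hf'm : Measurable f' := hf.measurable_mk
  have hae : ∀ᵐ y ∂γ, y ∈ L ∧ f y = f' y := hL.and hf.ae_eq_mk
  have hjoint : ∀ (x : X) (t : Y), ∫ y, Complex.exp (⟪f' y, t⟫_ℝ * Complex.I) *
      Complex.exp (⟪y, x⟫_ℝ * Complex.I) ∂γ =
      (∫ y, Complex.exp (⟪f' y, t⟫_ℝ * Complex.I) ∂γ) * charFun γ x := by
    intro x t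
    -- The regression coefficient: with it `η`, the part of `y` left after removing its component
    -- along `B x`, is uncorrelated with `ξ`. If `A x = 0`, the convention `0⁻¹ = 0` gives `η = y`,
    -- which is also correct.
    set c : ℝ := (‖A x‖ ^ 2)⁻¹ with hc
    let ξ : X → ℝ := fun y => ⟪y, x⟫_ℝ
    let η : X → X := fun y => y - (c * ⟪y, x⟫_ℝ) • B x
    have hξ : Measurable ξ := by fun_prop
    have hη : Measurable η := by fun_prop
    -- Uncorrelated jointly Gaussian variables are independent: the quadratic form splits by
    -- Pythagoras because `A x ⊥ A x''`.
    have hind : IndepFun ξ η γ := by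
      rw [indepFun_iff_charFun_prod hξ.aemeasurable hη.aemeasurable]
      intro p
      set a := p.ofLp.1
      set x' := p.ofLp.2
      set x'' : X := x' - (c * ⟪B x, x'⟫_ℝ) • x with hx''
      have e1 : charFun (γ.map fun ω => WithLp.toLp 2 (ξ ω, η ω)) p = charFun γ (a • x + x'') := by
        rw [charFun_apply, integral_map (by fun_prop) (by fun_prop), charFun_apply]
        congr 1
        funext y
        congr 3
        rw [WithLp.prod_inner_apply]
        simp only [ξ, η, inner_add_right, inner_sub_left, inner_sub_right, inner_smul_left,
          inner_smul_right, hx'', a, x', RCLike.inner_apply, conj_trivial]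
        ring
      have e2 : charFun (γ.map ξ) a = charFun γ (a • x) := by
        rw [charFun_apply, integral_map (by fun_prop) (by fun_prop), charFun_apply]
        congr 1
        funext y
        congr 3
        simp [ξ, inner_smul_right]
      have e3 : charFun (γ.map η) x' = charFun γ x'' := by
        rw [charFun_apply, integral_map (by fun_prop) (by fun_prop), charFun_apply]
        congr 1
        funext y
        congr 3
        simp only [η, inner_sub_left, inner_sub_right, inner_smul_left,
          inner_smul_right, hx'', conj_trivial]
        ring
      rw [e1, e2, e3, hγ, hγ, hγ, ← Complex.exp_add]
      congr 1
      have horth : ⟪A (a • x), A x''⟫_ℝ = 0 := by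
        have h0 : ⟪A x, A x''⟫_ℝ = 0 := by
          rw [hx'', map_sub, map_smul, inner_sub_right, inner_smul_right, hB,
            real_inner_self_eq_norm_sq, hc]
          by_cases hA : A x = 0
          · simp [hA]
          · have : ‖A x‖ ^ 2 ≠ 0 := by simpa using hA
            field_simp
            ring
        rw [map_smul, inner_smul_left, h0, mul_zero]
      have := norm_add_sq_eq_norm_sq_add_norm_sq_real horth
      rw [map_add, sq ‖A (a • x) + A x''‖, this]
      push_cast
      ring
    have hprod := hind.map_prod_eq_prod_map_map hξ.aemeasurable hη.aemeasurable
    have : IsProbabilityMeasure (γ.map ξ) := Measure.isProbabilityMeasure_map hξ.aemeasurable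
    have : IsProbabilityMeasure (γ.map η) := Measure.isProbabilityMeasure_map hη.aemeasurable
    have hrec : ∀ y, η y + (c * ξ y) • B x = y := fun y => sub_add_cancel _ _
    have hms : Measurable fun p : ℝ × X => p.2 + (c * p.1) • B x := by fun_prop
    have hmap : ((γ.map ξ).prod (γ.map η)).map (fun p : ℝ × X => p.2 + (c * p.1) • B x) = γ := by
      rw [← hprod, Measure.map_map hms (hξ.prodMk hη)]
      simp only [Function.comp_def, hrec, Measure.map_id']
    -- Recombining `y = η + c ξ • B x` leaves the value of `f` unchanged, so `f` is almost surely a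
    -- function of `η` alone.
    have hae2 : ∀ᵐ s ∂(γ.map ξ), ∀ᵐ y ∂(γ.map η),
        f' (y + (c * s) • B x) = f y := by
      rw [← hmap] at hae
      filter_upwards [Measure.ae_ae_of_ae_prod (ae_of_ae_map hms.aemeasurable hae)] with s hs
      filter_upwards [hs] with y hy
      have hyL : y ∈ L := by
        have := L.sub_mem hy.1 (L.smul_mem (c * s) (hBL x))
        simpa using this
      rw [← hy.2, hadd y hyL]
    set κ : ℂ := ∫ y, Complex.exp (⟪f y, t⟫_ℝ * Complex.I) ∂(γ.map η) with hκ
    -- The case `r = 0` identifies `κ` as the characteristic function of `f'`; the case `r = 1` is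
    -- then the factorisation.
    have hF : ∀ r : ℝ, ∫ y, Complex.exp (⟪f' y, t⟫_ℝ * Complex.I) *
        Complex.exp ((r * ξ y : ℝ) * Complex.I) ∂γ =
        κ * ∫ s, Complex.exp ((r * s : ℝ) * Complex.I) ∂(γ.map ξ) := by
      intro r
      let G : ℝ × X → ℂ := fun p => Complex.exp (⟪f' (p.2 + (c * p.1) • B x), t⟫_ℝ * Complex.I) *
        Complex.exp ((r * p.1 : ℝ) * Complex.I)
      have hG : Measurable G := by fun_prop
      have h1 : ∫ y, Complex.exp (⟪f' y, t⟫_ℝ * Complex.I) *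
          Complex.exp ((r * ξ y : ℝ) * Complex.I) ∂γ =
          ∫ p, G p ∂((γ.map ξ).prod (γ.map η)) := by
        rw [← hprod, integral_map (hξ.prodMk hη).aemeasurable hG.aestronglyMeasurable]
        simp only [G, hrec]
      have hGi : Integrable G ((γ.map ξ).prod (γ.map η)) := by
        refine Integrable.of_bound hG.aestronglyMeasurable 1 (Eventually.of_forall fun p => ?_)
        simp only [G, norm_mul, Complex.norm_exp_ofReal_mul_I, mul_one, le_refl]
      rw [h1, integral_prod _ hGi, ← integral_const_mul]
      refine integral_congr_ae ?_
      filter_upwards [hae2] with s hs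
      simp only [G]
      rw [integral_mul_const, hκ]
      congr 1
      refine integral_congr_ae ?_
      filter_upwards [hs] with y hy
      rw [hy]
    have h0 := hF 0
    have h1 := hF 1
    simp only [zero_mul, Complex.ofReal_zero, Complex.exp_zero, mul_one, integral_const,
      probReal_univ, one_smul] at h0
    simp only [one_mul] at h1
    rw [h0, h1, charFun_apply, integral_map (by fun_prop) (by fun_prop)]
  have : IsProbabilityMeasure (γ.map f') := Measure.isProbabilityMeasure_map hf'm.aemeasurable
  have hch : ∀ t, charFun (γ.map f') t = ∫ y, Complex.exp (⟪f' y, t⟫_ℝ * Complex.I) ∂γ := fun t => by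
    rw [charFun_apply, integral_map (by fun_prop) (by fun_prop)]
  have hind : IndepFun f' id γ := by
    rw [indepFun_iff_charFun_prod hf'm.aemeasurable measurable_id.aemeasurable]
    intro p
    rw [Measure.map_id, hch, ← hjoint, charFun_apply, integral_map (by fun_prop) (by fun_prop)]
    refine integral_congr_ae (Eventually.of_forall fun y => ?_)
    simp only
    rw [← Complex.exp_add, WithLp.prod_inner_apply]
    congr 1
    push_cast
    simp only [id]
    ring
  -- Being independent of the identity, `f'` is independent of every measurable function of it,
  -- itself included.
  have hself : IndepFun f' f' γ := hind.comp measurable_id hf'm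
  have hmul : ∀ s t, charFun (γ.map f') (s + t) = charFun (γ.map f') s * charFun (γ.map f') t := by
    intro s t
    rw [indepFun_iff_charFun_prod hf'm.aemeasurable hf'm.aemeasurable] at hself
    have h := hself (WithLp.toLp 2 (s, t))
    simp only at h
    rw [← h, hch, charFun_apply, integral_map (by fun_prop) (by fun_prop)]
    refine integral_congr_ae (Eventually.of_forall fun y => ?_)
    simp only [WithLp.prod_inner_apply, inner_add_right]
  have hsymm : γ.map (fun y => -y) = γ := by
    have : IsProbabilityMeasure (γ.map fun y => -y) :=
      Measure.isProbabilityMeasure_map (by fun_prop)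
    refine Measure.ext_of_charFun (funext fun x => ?_)
    have h1 : charFun (γ.map fun y => -y) x = charFun γ (-x) := by
      rw [charFun_apply, integral_map (by fun_prop) (by fun_prop), charFun_apply]
      simp
    rw [h1, hγ, hγ, map_neg, norm_neg]
  have hneg' : ∀ᵐ y ∂γ, f' (-y) = -f' y := by
    have hae' := hae
    rw [← hsymm] at hae'
    filter_upwards [hae, ae_of_ae_map (by fun_prop) hae'] with y h1 h2
    rw [← h1.2, ← h2.2, hneg y h1.1]
  have heven : ∀ t, charFun (γ.map f') (-t) = charFun (γ.map f') t := by
    intro t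
    rw [hch, hch]
    conv_rhs => rw [← hsymm, integral_map (by fun_prop) (by fun_prop)]
    refine integral_congr_ae ?_
    filter_upwards [hneg'] with y hy
    rw [hy, inner_neg_left, inner_neg_right]
  have hdirac := eq_dirac_zero_of_charFun_add hmul heven
  have h0 : ∀ᵐ y ∂(γ.map f'), y = 0 := by
    rw [hdirac, ae_dirac_eq]
    exact rfl
  filter_upwards [ae_of_ae_map hf'm.aemeasurable h0, hae] with y h1 h2
  rw [h2.2, h1]
  rfl

/-- The law of the complementary part `x - ι (Phat x)` of a canonical Gaussian variable. -/
theorem map_sub_linearExtension_eq {H X : Type*} [NormedAddCommGroup H]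
    [InnerProductSpace ℝ H] [CompleteSpace H] [MeasurableSpace H] [BorelSpace H]
    [NormedAddCommGroup X] [InnerProductSpace ℝ X] [CompleteSpace X] [SecondCountableTopology X]
    [MeasurableSpace X] [BorelSpace X]
    {β : ℝ} (hβ : 0 < β) {ι : H →L[ℝ] X} {γ γ' : Measure X} [IsProbabilityMeasure γ']
    (hγ : IsCanonicalGaussian β ι γ) (W : Submodule ℝ H) [FiniteDimensional ℝ W]
    (hγ' : ∀ x, charFun γ' x =
      Complex.exp (-(β⁻¹ * ‖Wᗮ.starProjection (ContinuousLinearMap.adjoint ι x)‖ ^ 2 / 2 : ℝ)))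
    {Phat : X → W}
    (hPhat : IsMeasurableLinearExtension γ ι (fun η => W.orthogonalProjectionOnto η) Phat) :
    γ.map (fun x => x - ι (Phat x)) = γ' := by
  obtain ⟨hPm, hPι, L, hιL, hL, g, hg⟩ := hPhat
  have hγp := hγ.isProbabilityMeasure
  have : CompleteSpace W := FiniteDimensional.complete ℝ W
  obtain ⟨γW, hγWp, hγW⟩ := gaussian_aux (β⁻¹).toNNReal (ContinuousLinearMap.id ℝ W)
    (stdOrthonormalBasis ℝ W).toHilbertBasis (Summable.of_finite)
  rw [Real.coe_toNNReal _ (by positivity)] at hγW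
  let φ : W × X → X := fun p => p.2 + ι p.1
  have hφ : Measurable φ := by fun_prop
  -- In characteristic functions this is Pythagoras: `‖ι* x‖² = ‖P ι* x‖² + ‖Q ι* x‖²`.
  have hφγ : (γW.prod γ').map φ = γ := by
    have : IsProbabilityMeasure ((γW.prod γ').map φ) :=
      Measure.isProbabilityMeasure_map hφ.aemeasurable
    refine Measure.ext_of_charFun (funext fun x => ?_)
    set h := ContinuousLinearMap.adjoint ι x with hh
    have h1 : charFun ((γW.prod γ').map φ) x =
        charFun γW (W.orthogonalProjectionOnto h) * charFun γ' x := by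
      rw [charFun_apply, integral_map hφ.aemeasurable (by fun_prop), charFun_apply, charFun_apply,
        ← integral_prod_mul]
      refine integral_congr_ae (Eventually.of_forall fun p => ?_)
      simp only [φ]
      rw [← Complex.exp_add, inner_add_left]
      have e : ⟪ι (p.1 : H), x⟫_ℝ = ⟪p.1, W.orthogonalProjectionOnto h⟫_ℝ := by
        rw [← ContinuousLinearMap.adjoint_inner_right, ← hh]
        exact (Submodule.inner_orthogonalProjectionOnto_eq_of_mem_left p.1 h).symm
      rw [e]
      congr 1
      push_cast
      ring
    rw [h1, hγW, hγ', hγ.charFun_eq hβ, ← Complex.exp_add]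
    congr 1
    have h2 := Submodule.norm_sq_eq_add_norm_sq_starProjection h W
    rw [← hh, h2]
    have h3 : ‖ContinuousLinearMap.adjoint (ContinuousLinearMap.id ℝ W)
        (W.orthogonalProjectionOnto h)‖ = ‖W.starProjection h‖ := by
      rw [ContinuousLinearMap.adjoint_id]
      rfl
    rw [h3]
    push_cast
    ring
  have hadd : ∀ y ∈ L, ∀ w : W, Phat (y + ι w) = Phat y + w := fun y hy w => by
    have h1 := hg (⟨y, hy⟩ + ⟨ι w, hιL w⟩)
    rw [map_add, ← hg, ← hg, hPι] at h1
    simpa using h1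
  have hmem : ∀ (y : X) (w : W), y + ι w ∈ L → y ∈ L := fun y w h => by
    simpa using L.sub_mem h (hιL w)
  obtain ⟨F, hFm, hF⟩ := id hPm
  have hae : ∀ᵐ x ∂γ, x ∈ L ∧ Phat x = F x := hL.and hF
  -- `L` and the measurability of `Phat` are known only up to `γ`-null sets, and `γ'` need not be
  -- absolutely continuous with respect to `γ`. Fubini gives one shift `ι w₀` along which both hold
  -- `γ'`-almost surely, and linearity undoes the shift.
  obtain ⟨w₀, hw₀⟩ : ∃ w₀ : W, ∀ᵐ y ∂γ', y + ι w₀ ∈ L ∧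
      Phat (y + ι w₀) = F (y + ι w₀) := by
    rw [← hφγ] at hae
    exact (Measure.ae_ae_of_ae_prod (ae_of_ae_map hφ.aemeasurable hae)).exists
  have hL' : ∀ᵐ y ∂γ', y ∈ L := by
    filter_upwards [hw₀] with y hy using hmem y w₀ hy.1
  have hPm' : AEMeasurable Phat γ' := by
    refine ⟨fun y => F (y + ι w₀) - w₀, ?_, ?_⟩
    · exact (hFm.comp (measurable_id.add_const _)).sub_const _
    · filter_upwards [hw₀] with y hy
      rw [← hy.2, hadd y (hmem y w₀ hy.1), add_sub_cancel_right]
  have hzero : Phat =ᵐ[γ'] 0 := by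
    refine ae_eq_zero_of_linear_of_charFun (v := β⁻¹)
      (A := Wᗮ.starProjection ∘L ContinuousLinearMap.adjoint ι)
      (B := fun x => ι (Wᗮ.starProjection (ContinuousLinearMap.adjoint ι x)))
      hγ' ?_ hPm' (fun x => hιL _) hL' hg ?_
    · intro x x'
      rw [← ContinuousLinearMap.adjoint_inner_right, ContinuousLinearMap.comp_apply,
        ContinuousLinearMap.comp_apply, Submodule.inner_starProjection_left_eq_right,
        Submodule.inner_starProjection_left_eq_right,
        Submodule.starProjection_eq_self_iff.2 (Submodule.starProjection_apply_mem _ _)]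
    · intro x
      rw [hPι]
      exact Submodule.orthogonalProjectionOnto_apply_of_mem_orthogonal
        (Submodule.starProjection_apply_mem _ _)
  have hsub : AEMeasurable (fun x => x - ι (Phat x)) γ := by
    have h1 : AEMeasurable (fun x => ι (Phat x : H)) γ := by fun_prop
    exact aemeasurable_id.sub h1
  rw [← hφγ] at hsub ⊢
  rw [AEMeasurable.map_map_of_aemeasurable hsub hφ.aemeasurable]
  -- On the product, `Phat (y + ι w) = Phat y + w = w`, so that exactly `y` is left.
  have h1 : ((fun x => x - ι (Phat x)) ∘ φ) =ᵐ[γW.prod γ'] Prod.snd := by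
    filter_upwards [Measure.quasiMeasurePreserving_snd.ae (hL'.and hzero)] with p hp
    simp only [Function.comp_apply, φ]
    rw [hadd _ hp.1, hp.2]
    simp
  rw [Measure.map_congr h1, measurePreserving_snd.map_eq]

/-! ### Adapted orthonormal sequences and Hilbert-Schmidt sums -/

/-- One Gram-Schmidt step per dimension: `e n` is a unit vector of `Ξ (n + 1)` orthogonal to `Ξ n`.
Indices start at `0`, so `e 0, …, e (n - 1)` lie in `Ξ n` and by dimension form a basis of it. -/
theorem exists_orthonormal_adapted {H : Type*} [NormedAddCommGroup H] [InnerProductSpace ℝ H]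
    {Ξ : ℕ → Submodule ℝ H} [∀ n, FiniteDimensional ℝ (Ξ n)] (hmono : Monotone Ξ)
    (hdim : ∀ n, Module.finrank ℝ (Ξ n) = n) :
    ∃ e : ℕ → H, Orthonormal ℝ e ∧ ∀ i n, i < n → e i ∈ Ξ n := by
  have h1 : ∀ n, ∃ x, ‖x‖ = 1 ∧ x ∈ Ξ (n + 1) ∧ x ∈ (Ξ n)ᗮ := by
    intro n
    obtain ⟨x, hx, hxn⟩ : ∃ x ∈ Ξ (n + 1), x ∉ Ξ n := by
      by_contra! hcon
      have h2 := Submodule.finrank_mono (show Ξ (n + 1) ≤ Ξ n from hcon)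
      rw [hdim, hdim] at h2
      omega
    have hy : x - (Ξ n).starProjection x ≠ 0 := fun h =>
      hxn (by rw [sub_eq_zero.1 h]; exact Submodule.starProjection_apply_mem _ _)
    refine ⟨‖x - (Ξ n).starProjection x‖⁻¹ • (x - (Ξ n).starProjection x), ?_, ?_, ?_⟩
    · rw [norm_smul, norm_inv, norm_norm, inv_mul_cancel₀ (norm_ne_zero_iff.2 hy)]
    · exact Submodule.smul_mem _ _ (Submodule.sub_mem _ hx
        (hmono (Nat.le_succ n) (Submodule.starProjection_apply_mem _ _)))
    · exact Submodule.smul_mem _ _ (Submodule.sub_starProjection_mem_orthogonal x)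
  choose e he1 he2 he3 using h1
  have hmem : ∀ i n, i < n → e i ∈ Ξ n := fun i n hin => hmono (Nat.succ_le_of_lt hin) (he2 i)
  refine ⟨e, ⟨he1, fun i j hij => ?_⟩, hmem⟩
  rcases lt_or_gt_of_ne hij with h | h
  · exact he3 j (e i) (hmem i j h)
  · rw [real_inner_comm]
    exact he3 i (e j) (hmem j i h)

/-- Parseval in `V`, since `n` orthonormal vectors in a space of dimension `n` form a basis. -/
theorem sum_inner_sq_eq_norm_starProjection_sq {H : Type*} [NormedAddCommGroup H]
    [InnerProductSpace ℝ H] {e : ℕ → H} (he : Orthonormal ℝ e) {n : ℕ} {V : Submodule ℝ H}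
    [FiniteDimensional ℝ V] (hdim : Module.finrank ℝ V = n) (heV : ∀ i < n, e i ∈ V) (h : H) :
    ∑ i ∈ Finset.range n, ⟪e i, h⟫_ℝ ^ 2 = ‖V.starProjection h‖ ^ 2 := by
  let b : Fin n → V := fun i => ⟨e i, heV i i.2⟩
  have hb : Orthonormal ℝ b := by
    refine ⟨fun i => he.1 i, fun i j hij => ?_⟩
    exact he.2 fun hij' => hij (Fin.ext hij')
  let B : OrthonormalBasis (Fin n) ℝ V :=
    OrthonormalBasis.mk hb (hb.linearIndependent.span_eq_top_of_card_eq_finrank'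
      (by rw [Fintype.card_fin, hdim])).ge
  have h1 := B.sum_sq_norm_inner_right (V.orthogonalProjectionOnto h)
  rw [Finset.sum_range]
  refine Eq.trans ?_ h1
  refine Finset.sum_congr rfl fun i _ => ?_
  have h2 : ⟪B i, V.orthogonalProjectionOnto h⟫_ℝ = ⟪e i, h⟫_ℝ := by
    rw [Submodule.inner_orthogonalProjectionOnto_eq_of_mem_left]
    simp [B, b]
  rw [h2, Real.norm_eq_abs, sq_abs]

theorem tsum_ofReal_inner_sq {K κ : Type*} [NormedAddCommGroup K] [InnerProductSpace ℝ K]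
    (c : HilbertBasis κ ℝ K) (y : K) :
    ∑' j, ENNReal.ofReal (⟪c j, y⟫_ℝ ^ 2) = ENNReal.ofReal (‖y‖ ^ 2) := by
  have h := c.hasSum_inner_mul_inner y y
  rw [real_inner_self_eq_norm_sq] at h
  have e : (fun j => ⟪c j, y⟫_ℝ ^ 2) = fun j => ⟪y, c j⟫_ℝ * ⟪c j, y⟫_ℝ := by
    funext j
    rw [real_inner_comm (c j) y, sq]
  rw [← e] at h
  rw [← h.tsum_eq, ENNReal.ofReal_tsum_of_nonneg (fun j => sq_nonneg _) h.summable]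

/-- The image of an orthonormal sequence under a Hilbert-Schmidt operator is square summable. -/
theorem IsHilbertSchmidt.summable_norm_sq {H X : Type*} [NormedAddCommGroup H]
    [InnerProductSpace ℝ H] [CompleteSpace H] [NormedAddCommGroup X] [InnerProductSpace ℝ X]
    [CompleteSpace X] {T : H →L[ℝ] X} (hT : IsHilbertSchmidt T) {e : ℕ → H}
    (he : Orthonormal ℝ e) : Summable fun i => ‖T (e i)‖ ^ 2 := by
  obtain ⟨s, b, hb⟩ := hT
  obtain ⟨w, x, -⟩ := exists_hilbertBasis ℝ X
  have hbessel : ∀ y : H, ∑' i, ENNReal.ofReal (⟪e i, y⟫_ℝ ^ 2) ≤ ENNReal.ofReal (‖y‖ ^ 2) := by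
    intro y
    rw [← ENNReal.ofReal_tsum_of_nonneg (fun j => sq_nonneg _)]
    · have := he.tsum_inner_products_le (x := y)
      simp only [Real.norm_eq_abs, sq_abs] at this
      exact ENNReal.ofReal_le_ofReal this
    · have := he.inner_products_summable (x := y)
      simpa only [Real.norm_eq_abs, sq_abs] using this
  -- Both sums are expanded in a Hilbert basis `x` of the target and exchanged: Bessel for `e` gives
  -- at most `∑ ‖T* x_j‖²`, and Parseval for `b` gives equality. In `ENNReal` the exchange needs no
  -- summability.
  have key : ∑' i, ENNReal.ofReal (‖T (e i)‖ ^ 2) ≤ ∑' i, ENNReal.ofReal (‖T (b i)‖ ^ 2) := by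
    have e1 : ∀ y, ENNReal.ofReal (‖T y‖ ^ 2) =
        ∑' j, ENNReal.ofReal (⟪y, ContinuousLinearMap.adjoint T (x j)⟫_ℝ ^ 2) := fun y => by
      rw [← tsum_ofReal_inner_sq x]
      refine tsum_congr fun j => ?_
      rw [ContinuousLinearMap.adjoint_inner_right, real_inner_comm]
    simp only [e1]
    rw [ENNReal.tsum_comm, ENNReal.tsum_comm (α := s)]
    refine ENNReal.tsum_le_tsum fun j => ?_
    rw [tsum_ofReal_inner_sq b]
    exact hbessel _
  have hfin : ∑' i, ENNReal.ofReal (‖T (e i)‖ ^ 2) ≠ ⊤ :=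
    ne_top_of_le_ne_top hb.tsum_ofReal_ne_top key
  have := ENNReal.summable_toReal hfin
  simpa only [ENNReal.toReal_ofReal (sq_nonneg _)] using this

/-! ### White noise and Gaussian series -/

/-- A sequence of independent centred Gaussian variables of variance `v`. -/
def whiteNoise (v : NNReal) : Measure (ℕ → ℝ) := Measure.infinitePi fun _ => gaussianReal 0 v

instance (v : NNReal) : IsProbabilityMeasure (whiteNoise v) := by
  unfold whiteNoise
  infer_instance

theorem whiteNoise_map_eval (v : NNReal) (i : ℕ) :
    (whiteNoise v).map (fun ω => ω i) = gaussianReal 0 v :=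
  Measure.infinitePi_map_eval (fun _ => gaussianReal 0 v) i

theorem iIndepFun_whiteNoise (v : NNReal) :
    iIndepFun (fun i (ω : ℕ → ℝ) => ω i) (whiteNoise v) :=
  iIndepFun_infinitePi (P := fun _ => gaussianReal 0 v) (X := fun _ => id) fun _ => measurable_id

theorem memLp_whiteNoise (v : NNReal) (i : ℕ) : MemLp (fun ω : ℕ → ℝ => ω i) 2 (whiteNoise v) := by
  have h : MemLp id 2 (gaussianReal 0 v) := memLp_id_gaussianReal' 2 (by simp)
  rw [← whiteNoise_map_eval v i] at h
  exact h.comp_of_map (measurable_pi_apply i).aemeasurable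

theorem integral_whiteNoise (v : NNReal) (i : ℕ) : ∫ ω, ω i ∂(whiteNoise v) = 0 := by
  have := integral_map (μ := whiteNoise v) (φ := fun ω => ω i)
    (measurable_pi_apply i).aemeasurable (f := fun x : ℝ => x) (by fun_prop)
  rw [whiteNoise_map_eval] at this
  rw [← this, integral_id_gaussianReal]

theorem integral_sq_whiteNoise (v : NNReal) (i : ℕ) : ∫ ω, ω i ^ 2 ∂(whiteNoise v) = v := by
  have := integral_map (μ := whiteNoise v) (φ := fun ω => ω i)
    (measurable_pi_apply i).aemeasurable (f := fun x : ℝ => x ^ 2) (by fun_prop)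
  rw [whiteNoise_map_eval] at this
  rw [← this]
  have h := variance_fun_id_gaussianReal (μ := 0) (v := v)
  rw [variance_eq_integral (by fun_prop)] at h
  simpa using h

theorem charFun_map_sum_whiteNoise {K : Type*} [NormedAddCommGroup K] [InnerProductSpace ℝ K]
    [SecondCountableTopology K] [MeasurableSpace K] [BorelSpace K] (v : NNReal) (x : ℕ → K)
    (t : Finset ℕ) (y : K) :
    charFun ((whiteNoise v).map fun ω => ∑ i ∈ t, ω i • x i) y =
      Complex.exp (-(v * (∑ i ∈ t, ⟪x i, y⟫_ℝ ^ 2) / 2 : ℝ)) := by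
  have hm : ∀ i, Measurable fun ω : ℕ → ℝ => ω i • x i := fun i => by fun_prop
  have hind : iIndepFun (fun i (ω : ℕ → ℝ) => ω i • x i) (whiteNoise v) :=
    (iIndepFun_whiteNoise v).comp (fun i r => r • x i) (fun i => by fun_prop)
  rw [(hind.restrict t).charFun_map_fun_finsetSum_eq_prod (fun i _ => (hm i).aemeasurable),
    Finset.prod_apply]
  have h3 : ∀ i, charFun ((whiteNoise v).map fun ω => ω i • x i) y =
      Complex.exp (-(v * ⟪x i, y⟫_ℝ ^ 2 / 2 : ℝ)) := fun i => by
    have h4 := charFun_gaussianReal (μ := 0) (v := v) ⟪x i, y⟫_ℝ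
    rw [← whiteNoise_map_eval v i, charFun_apply,
      integral_map (measurable_pi_apply i).aemeasurable (by fun_prop)] at h4
    rw [charFun_apply, integral_map (hm i).aemeasurable (by fun_prop)]
    convert h4 using 1
    · refine integral_congr_ae (Eventually.of_forall fun ω => ?_)
      simp [inner_smul_left, mul_comm]
    · push_cast
      ring_nf
  rw [Finset.prod_congr rfl fun i _ => h3 i, ← Complex.exp_sum]
  congr 1
  push_cast
  rw [Finset.mul_sum, Finset.sum_div, Finset.sum_neg_distrib]

/-- The strong law of large numbers for the squared norm of white noise. -/
theorem tendsto_sum_sq_whiteNoise (v : NNReal) :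
    ∀ᵐ ω ∂(whiteNoise v), Tendsto (fun n : ℕ => (∑ i ∈ Finset.range n, ω i ^ 2) / (n : ℝ)) atTop
      (𝓝 (v : ℝ)) := by
  have h := strong_law_ae_real (μ := whiteNoise v) (fun i (ω : ℕ → ℝ) => ω i ^ 2)
    (memLp_whiteNoise v 0).integrable_sq
    (fun i j hij => ((iIndepFun_whiteNoise v).indepFun hij).comp
      (measurable_id.pow_const 2) (measurable_id.pow_const 2))
    (fun i => by
      have h1 : IdentDistrib (fun ω : ℕ → ℝ => ω i) (fun ω => ω 0) (whiteNoise v) (whiteNoise v) :=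
        ⟨(measurable_pi_apply i).aemeasurable, (measurable_pi_apply 0).aemeasurable, by
          rw [whiteNoise_map_eval, whiteNoise_map_eval]⟩
      exact h1.comp (measurable_id.pow_const 2))
  simpa only [integral_sq_whiteNoise] using h

/-- A Gaussian measure with scalar covariance has a radial density. -/
theorem exists_radial_density_of_charFun {U : Type*} [NormedAddCommGroup U] [InnerProductSpace ℝ U]
    [FiniteDimensional ℝ U] [MeasurableSpace U] [BorelSpace U] {μ : Measure U}
    [IsProbabilityMeasure μ] {v : ℝ} (hv : 0 < v)
    (hμ : ∀ t, charFun μ t = Complex.exp (-(v * ‖t‖ ^ 2 / 2 : ℝ))) :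
    ∃ ρ : ℝ → ENNReal, Measurable ρ ∧ μ = (volume : Measure U).withDensity fun u => ρ ‖u‖ := by
  have : CompleteSpace U := FiniteDimensional.complete ℝ U
  -- With `b = 1/(2v)` the function `exp(-b‖u‖²)` has the prescribed characteristic function up to a
  -- constant, which the value at `0` identifies as the total mass.
  set b : ℝ := (2 * v)⁻¹ with hb
  have hb0 : 0 < b := by positivity
  set ν : Measure U := (volume : Measure U).withDensity fun u =>
    ENNReal.ofReal (Real.exp (-b * ‖u‖ ^ 2)) with hν
  have hint := integrable_exp_neg_norm_sq U hb0
  have hνfin : IsFiniteMeasure ν := isFiniteMeasure_withDensity_ofReal hint.2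
  have hch : ∀ t, charFun ν t = (Real.pi / b : ℂ) ^ ((Module.finrank ℝ U : ℂ) / 2) *
      Complex.exp (-(v * ‖t‖ ^ 2 / 2 : ℝ)) := by
    intro t
    rw [charFun_apply, hν, integral_withDensity_eq_integral_toReal_smul (by fun_prop) (by simp)]
    have h := GaussianFourier.integral_cexp_neg_mul_sq_norm_add (V := U) (b := b)
      (by simpa using hb0) Complex.I t
    have e : Complex.exp (-(v * ‖t‖ ^ 2 / 2 : ℝ)) =
        Complex.exp (Complex.I ^ 2 * ‖t‖ ^ 2 / (4 * b)) := by
      congr 1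
      rw [Complex.I_sq, hb]
      push_cast
      have : (v : ℂ) ≠ 0 := by exact_mod_cast hv.ne'
      field_simp
      norm_num
    rw [e, ← h]
    refine integral_congr_ae (Eventually.of_forall fun u => ?_)
    simp only
    rw [ENNReal.toReal_ofReal (Real.exp_pos _).le, Complex.real_smul, Complex.ofReal_exp,
      ← Complex.exp_add, real_inner_comm]
    congr 1
    push_cast
    ring
  have hM : (Real.pi / b : ℂ) ^ ((Module.finrank ℝ U : ℂ) / 2) = ν.real Set.univ := by
    have h := hch 0
    rw [charFun_zero] at h
    simpa using h.symm
  have hν0 : ν Set.univ ≠ 0 := by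
    rw [hν, withDensity_apply _ MeasurableSet.univ, Measure.restrict_univ]
    refine ((lintegral_pos_iff_support (by fun_prop)).2 ?_).ne'
    have : Function.support (fun u : U => ENNReal.ofReal (Real.exp (-b * ‖u‖ ^ 2))) = Set.univ := by
      ext q
      simp [Real.exp_pos]
    rw [this]
    exact isOpen_univ.measure_pos _ Set.univ_nonempty
  have heq : ν = ν Set.univ • μ := by
    have : IsFiniteMeasure (ν Set.univ • μ) := Measure.smul_finite _ (measure_ne_top _ _)
    refine Measure.ext_of_charFun (funext fun t => ?_)
    rw [hch, hM, ← hμ, charFun_apply, charFun_apply, integral_smul_measure]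
    simp [Measure.real]
  refine ⟨fun r => (ν Set.univ)⁻¹ * ENNReal.ofReal (Real.exp (-b * r ^ 2)), by fun_prop, ?_⟩
  have h2 : μ = (ν Set.univ)⁻¹ • ν := by
    rw [heq, smul_smul]
    simp only [Measure.smul_apply, measure_univ, smul_eq_mul, mul_one]
    rw [ENNReal.inv_mul_cancel hν0 (measure_ne_top _ _), one_smul]
  rw [h2]
  conv_lhs => rw [hν]
  rw [← withDensity_smul _ (by fun_prop)]
  rfl

section WhiteNoiseSeries

variable {H X : Type*} [NormedAddCommGroup H] [InnerProductSpace ℝ H] [CompleteSpace H]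
  [NormedAddCommGroup X] [InnerProductSpace ℝ X] [CompleteSpace X]
  [MeasurableSpace X] [BorelSpace X]

/-- Convergence of the Gaussian series in `X`. -/
theorem exists_tendstoInMeasure_whiteNoise (v : NNReal) {x : ℕ → X}
    (hx : Summable fun i => ‖x i‖ ^ 2) :
    ∃ T : (ℕ → ℝ) → X, Measurable T ∧ TendstoInMeasure (whiteNoise v)
      (fun n ω => ∑ i ∈ Finset.range n, ω i • x i) atTop T := by
  have hmemX : ∀ i, MemLp (fun ω : ℕ → ℝ => ω i • x i) 2 (whiteNoise v) := fun i =>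
    (ContinuousLinearMap.toSpanSingleton ℝ (x i)).comp_memLp' (memLp_whiteNoise v i)
  let a : ℕ → Lp X 2 (whiteNoise v) := fun i => (hmemX i).toLp _
  have hortho : Pairwise fun i j => ⟪a i, a j⟫_ℝ = 0 := fun i j hij => by
    show ⟪a i, a j⟫_ℝ = 0
    rw [L2.inner_def]
    have h1 : (fun ω => ⟪(a i) ω, (a j) ω⟫_ℝ) =ᵐ[whiteNoise v]
        fun ω => (ω i * ω j) * ⟪x i, x j⟫_ℝ := by
      filter_upwards [(hmemX i).coeFn_toLp, (hmemX j).coeFn_toLp] with ω h1 h2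
      simp only [a, h1, h2, inner_smul_left, inner_smul_right]
      simp; ring
    rw [integral_congr_ae h1, integral_mul_const,
      ((iIndepFun_whiteNoise v).indepFun hij).integral_fun_mul_eq_mul_integral
        (measurable_pi_apply i).aestronglyMeasurable (measurable_pi_apply j).aestronglyMeasurable,
      integral_whiteNoise]
    simp
  have hnorm : ∀ i, ‖a i‖ ^ 2 = v * ‖x i‖ ^ 2 := fun i => by
    rw [← real_inner_self_eq_norm_sq, L2.inner_def]
    have h1 : (fun ω => ⟪(a i) ω, (a i) ω⟫_ℝ) =ᵐ[whiteNoise v]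
        fun ω => ω i ^ 2 * ‖x i‖ ^ 2 := by
      filter_upwards [(hmemX i).coeFn_toLp] with ω h1
      simp only [a, h1, inner_smul_left, inner_smul_right, real_inner_self_eq_norm_sq]
      simp; ring
    rw [integral_congr_ae h1, integral_mul_const, integral_sq_whiteNoise]
  -- The terms are orthogonal in `L²`, so summability amounts to that of the squared norms `v ‖x
  -- i‖²`.
  have hsum : Summable a := by
    let G : ℕ → Submodule ℝ (Lp X 2 (whiteNoise v)) := fun i => Submodule.span ℝ {a i}
    have hG : OrthogonalFamily ℝ (fun i => G i) fun i => (G i).subtypeₗᵢ := by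
      intro i j hij y z
      obtain ⟨r, hr⟩ := Submodule.mem_span_singleton.1 y.2
      obtain ⟨s, hs⟩ := Submodule.mem_span_singleton.1 z.2
      show ⟪(y : Lp X 2 (whiteNoise v)), (z : Lp X 2 (whiteNoise v))⟫_ℝ = 0
      rw [← hr, ← hs, inner_smul_left, inner_smul_right, hortho hij]
      simp
    have := (hG.summable_iff_norm_sq_summable
      (fun i => ⟨a i, Submodule.mem_span_singleton_self (a i)⟩)).2 (by
        simp only [Submodule.coe_norm, hnorm]
        exact hx.mul_left _)
    exact this
  obtain ⟨T, hT⟩ := hsum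
  have hTm := tendstoInMeasure_of_tendsto_Lp hT.tendsto_sum_nat
  have hTae := (Lp.aestronglyMeasurable T).aemeasurable
  refine ⟨hTae.mk _, hTae.measurable_mk, hTm.congr (fun n => ?_) hTae.ae_eq_mk⟩
  refine (Lp.coeFn_fun_finsetSum (Finset.range n) a).trans ?_
  have : ∀ᵐ ω ∂(whiteNoise v), ∀ i, (a i : (ℕ → ℝ) → X) ω = ω i • x i :=
    ae_all_iff.2 fun i => (hmemX i).coeFn_toLp
  filter_upwards [this] with ω h
  exact Finset.sum_congr rfl fun i _ => h i

/-- The characteristic function of the limit of a Gaussian series adapted to an exhausting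
sequence of subspaces. -/
theorem charFun_map_whiteNoise_limit [SecondCountableTopology X] {Ξ : ℕ → Submodule ℝ H} [∀ n, FiniteDimensional ℝ (Ξ n)]
    (hmono : Monotone Ξ) (hdim : ∀ n, Module.finrank ℝ (Ξ n) = n) {K : Submodule ℝ H}
    [K.HasOrthogonalProjection] (hK : (⨆ n, Ξ n).topologicalClosure = K) {e : ℕ → H}
    (he : Orthonormal ℝ e) (heΞ : ∀ i n, i < n → e i ∈ Ξ n) (ι : H →L[ℝ] X) (v : NNReal)
    {T : (ℕ → ℝ) → X} (hTm : Measurable T)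
    (hT : TendstoInMeasure (whiteNoise v)
      (fun n ω => ∑ i ∈ Finset.range n, ω i • ι (e i)) atTop T) (x : X) :
    charFun ((whiteNoise v).map T) x = Complex.exp
      (-(v * ‖K.starProjection (ContinuousLinearMap.adjoint ι x)‖ ^ 2 / 2 : ℝ)) := by
  obtain ⟨ns, hns, hae⟩ := hT.exists_seq_tendsto_ae
  have hm : ∀ n, Measurable fun ω : ℕ → ℝ => ∑ i ∈ Finset.range n, ω i • ι (e i) := fun n => by
    fun_prop
  have hlim : Tendsto (fun k => charFun ((whiteNoise v).map
      fun ω => ∑ i ∈ Finset.range (ns k), ω i • ι (e i)) x) atTop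
      (𝓝 (charFun ((whiteNoise v).map T) x)) := by
    simp only [charFun_apply]
    rw [integral_map hTm.aemeasurable (by fun_prop)]
    simp_rw [integral_map (hm _).aemeasurable
      (by fun_prop : AEStronglyMeasurable (fun y : X => Complex.exp (⟪y, x⟫_ℝ * Complex.I)) _)]
    refine tendsto_integral_of_dominated_convergence (fun _ => (1 : ℝ)) ?_ (integrable_const _) ?_ ?_
    · intro n
      refine Measurable.aestronglyMeasurable ?_
      fun_prop
    · intro n
      exact Eventually.of_forall fun ω => (Complex.norm_exp_ofReal_mul_I _).le
    · filter_upwards [hae] with ω h1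
      have hcont : Continuous fun y : X => Complex.exp (⟪y, x⟫_ℝ * Complex.I) := by fun_prop
      exact (hcont.tendsto _).comp h1
  refine tendsto_nhds_unique hlim ?_
  subst hK
  have hval : ∀ n, ∑ i ∈ Finset.range n, ⟪ι (e i), x⟫_ℝ ^ 2 =
      ‖(Ξ n).starProjection (ContinuousLinearMap.adjoint ι x)‖ ^ 2 := fun n => by
    rw [← sum_inner_sq_eq_norm_starProjection_sq he (hdim n) (fun i hi => heΞ i n hi)]
    exact Finset.sum_congr rfl fun i _ => by rw [ContinuousLinearMap.adjoint_inner_right]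
  simp only [charFun_map_sum_whiteNoise, hval]
  -- By Parseval the variances of the partial sums are `‖P_{Ξ n} ι* x‖²`, and the projections onto
  -- an increasing sequence converge strongly to the projection onto the closure of its union.
  have h1 := ((Submodule.starProjection_tendsto_closure_iSup Ξ hmono
    (ContinuousLinearMap.adjoint ι x)).comp hns.tendsto_atTop).norm
  have hcont : Continuous fun r : ℝ => Complex.exp (-(v * r ^ 2 / 2 : ℝ)) := by fun_prop
  exact (hcont.tendsto _).comp h1

end WhiteNoiseSeries

section GaussianSum

variable {H : Type*} [NormedAddCommGroup H] [InnerProductSpace ℝ H]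

/-- The partial sums of the Gaussian series, as variables with values in `Ξ n`. -/
def gaussianSum (Ξ : ℕ → Submodule ℝ H) [∀ n, FiniteDimensional ℝ (Ξ n)] (e : ℕ → H) (n : ℕ)
    (ω : ℕ → ℝ) : Ξ n :=
  ∑ i ∈ Finset.range n, ω i • (Ξ n).orthogonalProjectionOnto (e i)

variable {Ξ : ℕ → Submodule ℝ H} [∀ n, FiniteDimensional ℝ (Ξ n)] {e : ℕ → H}

/-- The projections in `gaussianSum` only make `e i` an element of `Ξ n` without a membership proof;
for `i < n` they do nothing. -/
theorem coe_gaussianSum (heΞ : ∀ i n, i < n → e i ∈ Ξ n) (n : ℕ) (ω : ℕ → ℝ) :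
    (gaussianSum Ξ e n ω : H) = ∑ i ∈ Finset.range n, ω i • e i := by
  rw [gaussianSum, Submodule.coe_sum]
  refine Finset.sum_congr rfl fun i hi => ?_
  rw [Submodule.coe_smul]
  congr 1
  exact congrArg Subtype.val ((Ξ n).orthogonalProjectionOnto_mem_subspace_eq_self
    ⟨e i, heΞ i n (Finset.mem_range.1 hi)⟩)

theorem norm_gaussianSum_sq (he : Orthonormal ℝ e) (heΞ : ∀ i n, i < n → e i ∈ Ξ n) (n : ℕ)
    (ω : ℕ → ℝ) : ‖gaussianSum Ξ e n ω‖ ^ 2 = ∑ i ∈ Finset.range n, ω i ^ 2 := by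
  rw [Submodule.coe_norm, coe_gaussianSum heΞ, ← real_inner_self_eq_norm_sq,
    he.inner_sum]
  simp [sq]

variable [MeasurableSpace H] [BorelSpace H]

theorem measurable_gaussianSum (n : ℕ) : Measurable (gaussianSum Ξ e n) := by
  unfold gaussianSum
  fun_prop

/-- The variance in the direction `t` is `∑ ⟪e i, t⟫² = ‖t‖²` times `v`, so the law is isotropic and
its direction can serve as angular variable in polar coordinates. -/
theorem exists_radial_density_gaussianSum (hdim : ∀ n, Module.finrank ℝ (Ξ n) = n)
    (he : Orthonormal ℝ e) (heΞ : ∀ i n, i < n → e i ∈ Ξ n) {v : NNReal} (hv : 0 < v) (n : ℕ) :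
    ∃ ρ : ℝ → ENNReal, Measurable ρ ∧ (whiteNoise v).map (gaussianSum Ξ e n) =
      (volume : Measure (Ξ n)).withDensity fun u => ρ ‖u‖ := by
  have : IsProbabilityMeasure ((whiteNoise v).map (gaussianSum Ξ e n)) :=
    Measure.isProbabilityMeasure_map (measurable_gaussianSum n).aemeasurable
  refine exists_radial_density_of_charFun (v := v) (by exact_mod_cast hv) fun t => ?_
  have h := charFun_map_sum_whiteNoise v (fun i => (Ξ n).orthogonalProjectionOnto (e i))
    (Finset.range n) t
  rw [show gaussianSum Ξ e n = fun ω => ∑ i ∈ Finset.range n,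
    ω i • (Ξ n).orthogonalProjectionOnto (e i) from rfl, h]
  have h1 : ∑ i ∈ Finset.range n, ⟪(Ξ n).orthogonalProjectionOnto (e i), t⟫_ℝ ^ 2 = ‖t‖ ^ 2 := by
    have h2 := sum_inner_sq_eq_norm_starProjection_sq he (hdim n) (fun i hi => heΞ i n hi) (t : H)
    rw [Submodule.starProjection_eq_self_iff.2 t.2, ← Submodule.coe_norm] at h2
    rw [← h2]
    refine Finset.sum_congr rfl fun i _ => ?_
    rw [Submodule.inner_orthogonalProjectionOnto_eq_of_mem_right]
  rw [h1]

end GaussianSum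

/-! ### Lebesgue measure on `Z × (W + V)` -/

section OrthogonalSum

variable {H : Type*} [NormedAddCommGroup H] [InnerProductSpace ℝ H]

/-- The sum map from `W × V` to `W + V`. -/
def supMap (W V : Submodule ℝ H) (p : W × V) : ↥(W ⊔ V) :=
  ⟨p.1 + p.2, Submodule.add_mem_sup p.1.2 p.2.2⟩

theorem continuous_supMap (W V : Submodule ℝ H) : Continuous (supMap W V) := by
  unfold supMap
  fun_prop

theorem inner_eq_zero_of_le_orthogonal {W V : Submodule ℝ H} (hV : V ≤ Wᗮ) (w : W) (v : V) :
    ⟪(w : H), (v : H)⟫_ℝ = 0 :=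
  hV v.2 w w.2

theorem norm_supMap_sq {W V : Submodule ℝ H} (hV : V ≤ Wᗮ) (p : W × V) :
    ‖supMap W V p‖ ^ 2 = ‖p.1‖ ^ 2 + ‖p.2‖ ^ 2 := by
  have h := norm_add_sq_real (p.1 : H) p.2
  rw [inner_eq_zero_of_le_orthogonal hV, mul_zero, add_zero] at h
  exact h

/-- Orthogonality makes the sum map a linear isometry. The product `W × V` carries the sup norm, so
the isometry starts from `WithLp 2 (W × V)`, which has the same volume. -/
theorem measurePreserving_supMap [MeasurableSpace H] [BorelSpace H] {W V : Submodule ℝ H}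
    [FiniteDimensional ℝ W] [FiniteDimensional ℝ V] (hV : V ≤ Wᗮ) :
    MeasurePreserving (supMap W V) volume volume := by
  let l : WithLp 2 (W × V) →ₗᵢ[ℝ] ↥(W ⊔ V) :=
    { toFun := fun p => supMap W V p.ofLp
      map_add' := fun p q => Subtype.ext (by simp [supMap]; abel)
      map_smul' := fun r p => Subtype.ext (by simp [supMap])
      norm_map' := fun p => by
        have h1 := WithLp.prod_norm_sq_eq_of_L2 p
        have h2 := norm_supMap_sq hV p.ofLp
        exact (pow_left_inj₀ (norm_nonneg _) (norm_nonneg _) two_ne_zero).1 (h2.trans h1.symm) }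
  have hl : Function.Surjective l := fun x => by
    obtain ⟨w, hw, v, hv, h⟩ := Submodule.mem_sup.1 x.2
    exact ⟨WithLp.toLp 2 (⟨w, hw⟩, ⟨v, hv⟩), Subtype.ext h⟩
  exact (LinearIsometryEquiv.ofSurjective l hl).measurePreserving.comp
    (WithLp.volume_preserving_toLp W V)

variable {Z : Type*} [MeasurableSpace Z]

/-- The point `(z, w + √(2t) u / ‖u‖)` of `Z × (W + V)`. -/
def polarPoint (W V : Submodule ℝ H) (q : Z × W) (u : V) (t : ℝ) : Z × ↥(W ⊔ V) :=
  (q.1, supMap W V (q.2, √(2 * t) • (‖u‖⁻¹ • u)))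

theorem measurable_polarPoint [MeasurableSpace H] [BorelSpace H] (W V : Submodule ℝ H)
    [FiniteDimensional ℝ W] [FiniteDimensional ℝ V] :
    Measurable fun x : ((Z × W) × V) × ℝ => polarPoint W V x.1.1 x.1.2 x.2 := by
  have : ProperSpace W := FiniteDimensional.proper ℝ W
  have : ProperSpace V := FiniteDimensional.proper ℝ V
  have hs := (continuous_supMap W V).measurable
  unfold polarPoint
  refine Measurable.prodMk (by fun_prop) (hs.comp ?_)
  fun_prop

/-- Lebesgue measure on `Z × (W + V)` in coordinates `(z, w)` and polar coordinates on `V`. -/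
theorem volume_eq_map_polarPoint {Z : Type*} [NormedAddCommGroup Z] [InnerProductSpace ℝ Z]
    [FiniteDimensional ℝ Z] [MeasurableSpace Z] [BorelSpace Z] [MeasurableSpace H] [BorelSpace H] {W V : Submodule ℝ H}
    [FiniteDimensional ℝ W] [FiniteDimensional ℝ V] (hV : V ≤ Wᗮ)
    (hn : 2 < Module.finrank ℝ V) {Ω : Type*} [MeasurableSpace Ω] {P : Measure Ω}
    [IsProbabilityMeasure P] {S : Ω → V} (hS : Measurable S)
    {ρ : ℝ → ENNReal} (hρ : Measurable ρ)
    (hSρ : P.map S = (volume : Measure V).withDensity fun u => ρ ‖u‖) :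
    ∃ c : ENNReal, c ≠ 0 ∧ c ≠ ⊤ ∧ (volume : Measure (Z × ↥(W ⊔ V))) =
      c • ((((volume : Measure (Z × W)).prod P).prod (volume : Measure ℝ)).withDensity fun p =>
        ENNReal.ofReal (max p.2 0 ^ ((Module.finrank ℝ V : ℝ) / 2 - 1))).map
          fun p => polarPoint W V p.1.1 (S p.1.2) p.2 := by
  have : Nontrivial V := Module.nontrivial_of_finrank_pos (R := ℝ) (by omega)
  have : IsProbabilityMeasure (P.map S) := Measure.isProbabilityMeasure_map hS.aemeasurable
  obtain ⟨c, hc0, hct, hc⟩ := volume_eq_map_radial hρ hSρ hn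
  refine ⟨c, hc0, hct, ?_⟩
  have hmp : MeasurePreserving (fun p : Z × (W × V) => (p.1, supMap W V p.2)) volume volume :=
    (MeasurePreserving.id (volume : Measure Z)).prod (measurePreserving_supMap hV)
  have hmp2 : MeasurePreserving (fun p : (Z × W) × V => (p.1.1, supMap W V (p.1.2, p.2)))
      volume volume := hmp.comp (measurePreserving_prodAssoc volume volume volume)
  refine Measure.ext_of_lintegral _ fun f hf => ?_
  have hpp := measurable_polarPoint (Z := Z) W V
  have hpp2 : Measurable fun p : ((Z × W) × Ω) × ℝ => polarPoint W V p.1.1 (S p.1.2) p.2 :=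
    hpp.comp (by fun_prop : Measurable fun p : ((Z × W) × Ω) × ℝ => ((p.1.1, S p.1.2), p.2))
  have hfp := hf.comp hpp2
  have hfpp := hf.comp hpp
  have hf2 := hf.comp hmp2.measurable
  simp only [Function.comp_def] at hfp hfpp hf2
  have hw2 : Measurable fun p : ((Z × W) × Ω) × ℝ =>
      ENNReal.ofReal (max p.2 0 ^ ((Module.finrank ℝ V : ℝ) / 2 - 1)) := by fun_prop
  have hw3 : Measurable fun p : V × ℝ =>
      ENNReal.ofReal (max p.2 0 ^ ((Module.finrank ℝ V : ℝ) / 2 - 1)) := by fun_prop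
  rw [lintegral_smul_measure, lintegral_map hf hpp2,
    lintegral_withDensity_eq_lintegral_mul _ hw2 hfp,
    lintegral_prod _ (hw2.mul hfp).aemeasurable,
    lintegral_prod _ (hw2.mul hfp).lintegral_prod_right'.aemeasurable,
    ← hmp2.lintegral_comp hf, Measure.volume_eq_prod (Z × W) V,
    lintegral_prod _ hf2.aemeasurable, smul_eq_mul,
    ← lintegral_const_mul' _ _ hct]
  refine lintegral_congr fun q => ?_
  have hfq : Measurable fun ξ : V => f (q.1, supMap W V (q.2, ξ)) :=
    (hf.comp hmp2.measurable).comp measurable_prodMk_left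
  have hm : Measurable fun p : V × ℝ => √(2 * p.2) • (‖p.1‖⁻¹ • p.1) := by fun_prop
  have hfqm : Measurable fun p : V × ℝ => f (q.1, supMap W V (q.2, √(2 * p.2) • (‖p.1‖⁻¹ • p.1))) :=
    hfq.comp hm
  have h1 : ∫⁻ ξ, f (q.1, supMap W V (q.2, ξ)) = c * ∫⁻ u, (∫⁻ t,
      ENNReal.ofReal (max t 0 ^ ((Module.finrank ℝ V : ℝ) / 2 - 1)) *
        f (polarPoint W V q u t)) ∂(P.map S) := by
    conv_lhs => rw [hc]
    rw [lintegral_smul_measure, lintegral_map hfq hm,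
      lintegral_withDensity_eq_lintegral_mul _ hw3 hfqm,
      lintegral_prod _ (hw3.mul hfqm).aemeasurable]
    rfl
  refine h1.trans ?_
  rw [lintegral_map ?_ hS]
  · rfl
  · exact Measurable.lintegral_prod_right' (f := fun p : V × ℝ =>
      ENNReal.ofReal (max p.2 0 ^ ((Module.finrank ℝ V : ℝ) / 2 - 1)) *
        f (polarPoint W V q p.1 p.2)) (hw3.mul hfqm)

end OrthogonalSum

/-! ### The shell density and its exponential limit -/

/-- The density `(1 - 2x/n)₊ ^ (n/2 - 1)`, which tends to `exp (-x)`. -/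
def shellDensity (n : ℕ) (x : ℝ) : ℝ :=
  max (1 - x / (n / 2)) 0 ^ ((n : ℝ) / 2 - 1)

theorem shellDensity_nonneg (n : ℕ) (x : ℝ) : 0 ≤ shellDensity n x :=
  Real.rpow_nonneg (le_max_right _ _) _

theorem measurable_shellDensity (n : ℕ) : Measurable (shellDensity n) := by
  unfold shellDensity
  fun_prop

theorem half_sub_one_pos {n : ℕ} (hn : 2 < n) : 0 < (n : ℝ) / 2 - 1 := by
  have : (2 : ℝ) < n := by exact_mod_cast hn
  linarith

theorem shellDensity_eq_zero {n : ℕ} (hn : 2 < n) {x : ℝ} (hx : 1 - x / (n / 2) ≤ 0) :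
    shellDensity n x = 0 := by
  rw [shellDensity, max_eq_right hx, Real.zero_rpow (half_sub_one_pos hn).ne']

/-- With `y = x / (n/2) < 1`, the inequality `log (1 - y) ≤ -y` bounds the exponent by `-(n/2 - 1) y
= y - x ≤ 1 - x`. The bound is uniform in `n` and dominates all the limits below. -/
theorem shellDensity_le {n : ℕ} (hn : 2 < n) (x : ℝ) :
    shellDensity n x ≤ Real.exp 1 * Real.exp (-x) := by
  rcases le_or_gt (1 - x / (n / 2)) 0 with h | h
  · rw [shellDensity_eq_zero hn h]
    positivity
  · have hk := half_sub_one_pos hn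
    have hm : 0 < (n : ℝ) / 2 := by linarith
    have h1 : Real.log (1 - x / (n / 2)) ≤ -(x / (n / 2)) := by
      have := Real.log_le_sub_one_of_pos h
      linarith
    have h2 : ((n : ℝ) / 2) * (x / (n / 2)) = x := mul_div_cancel₀ x hm.ne'
    rw [shellDensity, max_eq_left h.le, Real.rpow_def_of_pos h, ← Real.exp_add]
    refine Real.exp_le_exp.2 ?_
    calc _ ≤ -(x / (n / 2)) * ((n : ℝ) / 2 - 1) := mul_le_mul_of_nonneg_right h1 hk.le
      _ = x / (n / 2) - (n / 2) * (x / (n / 2)) := by ring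
      _ ≤ 1 + -x := by rw [h2]; linarith

/-- The function is `(1 - x/m)^m / (1 - x/m)` with `m = n/2`, and the denominator tends to `1`. -/
theorem tendsto_shellDensity (x : ℝ) :
    Tendsto (fun n => shellDensity n x) atTop (𝓝 (Real.exp (-x))) := by
  have hm : Tendsto (fun n : ℕ => (n : ℝ) / 2) atTop atTop :=
    tendsto_natCast_atTop_atTop.atTop_div_const two_pos
  have h0 : Tendsto (fun n : ℕ => 1 - x / ((n : ℝ) / 2)) atTop (𝓝 1) := by
    simpa using (hm.const_div_atTop x).const_sub 1
  have h1 := ((Real.tendsto_one_add_div_rpow_exp (-x)).comp hm).div h0 one_ne_zero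
  rw [div_one] at h1
  refine h1.congr' ?_
  filter_upwards [h0.eventually (lt_mem_nhds one_pos)] with n hn
  simp only [Function.comp_apply, Pi.div_apply]
  rw [shellDensity, max_eq_left hn.le, Real.rpow_sub_one hn.ne', neg_div, ← sub_eq_add_neg]

/-- The factor `n / (2β)` taken out of the power diverges with `n` but does not depend on `x`, so
normalisation removes it. -/
theorem max_rpow_eq_mul_shellDensity {β : ℝ} (hβ : 0 < β) {n : ℕ} (hn : 2 < n) (x : ℝ) :
    max (n / (2 * β) - x) 0 ^ ((n : ℝ) / 2 - 1) =
      (n / (2 * β)) ^ ((n : ℝ) / 2 - 1) * shellDensity n (β * x) := by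
  have hn0 : (0 : ℝ) < n := by exact_mod_cast (by omega : 0 < n)
  rw [shellDensity, ← Real.mul_rpow (by positivity) (le_max_right _ _),
    mul_max_of_nonneg _ _ (by positivity), mul_zero]
  congr 2
  field_simp

/-- Because of this invariance the constants of the polar coordinates never have to be computed. -/
theorem normalized_smul {E : Type*} [MeasurableSpace E] {c : ENNReal} (hc0 : c ≠ 0) (hct : c ≠ ⊤)
    (μ : Measure E) : normalized (c • μ) = normalized μ := by
  rw [normalized, normalized, smul_smul, Measure.smul_apply, smul_eq_mul,
    ENNReal.mul_inv (Or.inl hc0) (Or.inl hct), mul_right_comm, ENNReal.inv_mul_cancel hc0 hct,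
    one_mul]

theorem isProbabilityMeasure_normalized {E : Type*} [MeasurableSpace E] {μ : Measure E}
    (h0 : μ Set.univ ≠ 0) (ht : μ Set.univ ≠ ⊤) : IsProbabilityMeasure (normalized μ) :=
  ⟨by rw [normalized, Measure.smul_apply, smul_eq_mul, ENNReal.inv_mul_cancel h0 ht]⟩

theorem normalized_map {E F : Type*} [MeasurableSpace E] [MeasurableSpace F] (μ : Measure E)
    {f : E → F} (hf : Measurable f) : normalized (μ.map f) = (normalized μ).map f := by
  rw [normalized, normalized, Measure.map_smul, Measure.map_apply hf MeasurableSet.univ,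
    Set.preimage_univ]

/-! ### The microcanonical measure of the total system -/

section EnergyShell

variable {Z H : Type*} [NormedAddCommGroup Z] [InnerProductSpace ℝ Z]
  [NormedAddCommGroup H] [InnerProductSpace ℝ H] {HA : Z → ℝ} {C : Z →L[ℝ] H}
  {W V : Submodule ℝ H}

theorem norm_sqrt_smul_normalized_sq {u : V} (hu : u ≠ 0) {t : ℝ} (ht : 0 ≤ t) :
    ‖√(2 * t) • (‖u‖⁻¹ • u)‖ ^ 2 = 2 * t := by
  have hu' : ‖u‖ ≠ 0 := norm_ne_zero_iff.2 hu
  rw [norm_smul, norm_smul, norm_inv, norm_norm, inv_mul_cancel₀ hu', mul_one, Real.norm_eq_abs,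
    sq_abs, Real.sq_sqrt (by positivity)]

/-- Both `w` and `C z` lie in `W`, so the cross terms with the component in `V` vanish and that
component contributes exactly its energy `t`. -/
theorem Htotal_polarPoint (hC : ∀ z, C z ∈ W) (hV : V ≤ Wᗮ) (q : Z × W) {u : V} (hu : u ≠ 0)
    {t : ℝ} (ht : 0 ≤ t) :
    Htotal HA C (polarPoint W V q u t).1 ((polarPoint W V q u t).2 : H) = Hzw HA C W q + t := by
  have h1 := norm_supMap_sq hV (q.2, √(2 * t) • (‖u‖⁻¹ • u))
  rw [norm_sqrt_smul_normalized_sq hu ht] at h1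
  have h2 : ⟪C q.1, ((√(2 * t) • (‖u‖⁻¹ • u) : V) : H)⟫_ℝ = 0 :=
    inner_eq_zero_of_le_orthogonal hV ⟨C q.1, hC q.1⟩ _
  show HA q.1 + ‖supMap W V (q.2, √(2 * t) • (‖u‖⁻¹ • u))‖ ^ 2 / 2 +
    ⟪C q.1, (q.2 : H) + ((√(2 * t) • (‖u‖⁻¹ • u) : V) : H)⟫_ℝ = _
  rw [h1, inner_add_right, h2, Hzw]
  ring

theorem continuous_polarPoint {Z : Type*} [TopologicalSpace Z] (q : Z × W) (u : V) : Continuous fun t => polarPoint W V q u t := by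
  have := continuous_supMap W V
  unfold polarPoint
  fun_prop

/-- The microcanonical measure of the total Hamiltonian in polar coordinates on `V`. -/
theorem isPDelta_Htotal [FiniteDimensional ℝ Z] [MeasurableSpace Z] [BorelSpace Z]
    [MeasurableSpace H] [BorelSpace H] [FiniteDimensional ℝ W]
    [FiniteDimensional ℝ V] (hHA : Continuous HA) (hC : ∀ z, C z ∈ W) (hV : V ≤ Wᗮ)
    (hn : 2 < Module.finrank ℝ V) {Ω : Type*} [MeasurableSpace Ω] {P : Measure Ω}
    [IsProbabilityMeasure P] {S : Ω → V} (hS : Measurable S)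
    {ρ : ℝ → ENNReal} (hρ : Measurable ρ)
    (hSρ : P.map S = (volume : Measure V).withDensity fun u => ρ ‖u‖) (κ : ℝ)
    (hfin : ∫⁻ y, ENNReal.ofReal (max (κ - Hzw HA C W y.1) 0 ^
      ((Module.finrank ℝ V : ℝ) / 2 - 1)) ∂((volume : Measure (Z × W)).prod P) ≠ ⊤) :
    ∃ c : ENNReal, c ≠ 0 ∧ c ≠ ⊤ ∧
      IsPDelta (fun p : Z × ↥(W ⊔ V) => Htotal HA C p.1 (p.2 : H) - κ)
        (c • (((volume : Measure (Z × W)).prod P).withDensity fun y =>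
          ENNReal.ofReal (max (κ - Hzw HA C W y.1) 0 ^ ((Module.finrank ℝ V : ℝ) / 2 - 1))).map
            fun y => polarPoint W V y.1 (S y.2) (κ - Hzw HA C W y.1)) := by
  have hk := half_sub_one_pos hn
  have : Nontrivial V := Module.nontrivial_of_finrank_pos (R := ℝ) (by omega)
  have : ProperSpace W := FiniteDimensional.proper ℝ W
  have : ProperSpace V := FiniteDimensional.proper ℝ V
  have : FiniteDimensional ℝ ↥(W ⊔ V) := inferInstance
  have : ProperSpace ↥(W ⊔ V) := FiniteDimensional.proper ℝ _
  obtain ⟨c, hc0, hct, hc⟩ := volume_eq_map_polarPoint (Z := Z) hV hn hS hρ hSρ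
  refine ⟨c, hc0, hct, ?_⟩
  -- At `S ω = 0` the direction degenerates to `0`; the density of the law of `S` excludes this
  -- almost surely.
  have hS0 : ∀ᵐ ω ∂P, S ω ≠ 0 := by
    have h1 : ∀ᵐ u ∂(P.map S), u ≠ 0 := by
      rw [hSρ]
      exact (withDensity_absolutelyContinuous _ _).ae_le (Measure.ae_ne volume 0)
    exact ae_of_ae_map hS.aemeasurable h1
  have hS0' : ∀ᵐ y ∂((volume : Measure (Z × W)).prod P), S y.2 ≠ 0 :=
    Measure.quasiMeasurePreserving_snd.ae hS0
  have hH := continuous_Hzw hHA C W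
  have hs : Measurable fun y : (Z × W) × Ω => κ - Hzw HA C W y.1 :=
    measurable_const.sub (hH.measurable.comp measurable_fst)
  have hpos : ∀ t : ℝ, max t 0 ^ ((Module.finrank ℝ V : ℝ) / 2 - 1) ≠ 0 → 0 < t := fun t ht => by
    by_contra h
    exact ht (by rw [max_eq_right (not_lt.1 h), Real.zero_rpow hk.ne'])
  refine isPDelta_of_coarea (m := (volume : Measure (Z × W)).prod P)
    (Θ := fun p => polarPoint W V p.1.1 (S p.1.2) p.2)
    (a := fun t => max t 0 ^ ((Module.finrank ℝ V : ℝ) / 2 - 1))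
    (s := fun y => κ - Hzw HA C W y.1) ?_ ?_ ?_ hs hc ?_ ?_ ?_ ?_ ?_
  · exact (measurable_polarPoint W V).comp
      (by fun_prop : Measurable fun p : ((Z × W) × Ω) × ℝ => ((p.1.1, S p.1.2), p.2))
  · exact (continuous_id.max continuous_const).rpow_const fun x => Or.inr hk.le
  · exact fun t => Real.rpow_nonneg (le_max_right _ _) _
  · have : Continuous fun p : Z × ↥(W ⊔ V) => Htotal HA C p.1 (p.2 : H) - κ := by
      unfold Htotal
      fun_prop
    exact this.measurable
  · filter_upwards [hS0'] with y hy t ht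
    rw [Htotal_polarPoint hC hV _ hy (hpos t ht).le]
    ring
  · exact fun y => continuous_polarPoint y.1 (S y.2)
  · intro φ hφ hφc
    obtain ⟨M, hM⟩ := hφ.bounded_above_of_compact_support hφc
    obtain ⟨R, hR⟩ := hφc.isBounded.subset_closedBall 0
    have hM0 : 0 ≤ M := (norm_nonneg _).trans (hM 0)
    -- If `φ` is supported in the ball of radius `R`, then `‖w‖² + 2t ≤ R²` on the support. Hence `t
    -- ≤ R²` bounds the weight, and `(z, w)` stays in the ball, uniformly in `t`.
    refine ⟨fun y => (Metric.closedBall (0 : Z × W) R).indicator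
      (fun _ => (R ^ 2) ^ ((Module.finrank ℝ V : ℝ) / 2 - 1) * M) y.1, ?_, ?_⟩
    · have h1 : Integrable ((Metric.closedBall (0 : Z × W) R).indicator
          (fun _ => (R ^ 2) ^ ((Module.finrank ℝ V : ℝ) / 2 - 1) * M)) volume :=
        (integrable_indicator_iff Metric.isClosed_closedBall.measurableSet).2
          (integrableOn_const (isCompact_closedBall _ _).measure_lt_top.ne)
      exact h1.comp_fst P
    · filter_upwards [hS0'] with y hy t
      have hb0 : 0 ≤ (Metric.closedBall (0 : Z × W) R).indicator
          (fun _ => (R ^ 2) ^ ((Module.finrank ℝ V : ℝ) / 2 - 1) * M) y.1 :=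
        Set.indicator_nonneg (fun _ _ => by positivity) _
      by_cases ht : max t 0 ^ ((Module.finrank ℝ V : ℝ) / 2 - 1) = 0
      · rw [ht, zero_mul, norm_zero]
        exact hb0
      by_cases hφ0 : φ (polarPoint W V y.1 (S y.2) t) = 0
      · rw [hφ0, mul_zero, norm_zero]
        exact hb0
      have ht0 := hpos t ht
      have h1 : polarPoint W V y.1 (S y.2) t ∈ Metric.closedBall 0 R :=
        hR (subset_tsupport _ hφ0)
      rw [mem_closedBall_zero_iff, Prod.norm_def] at h1
      have hz : ‖y.1.1‖ ≤ R := (le_max_left _ _).trans h1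
      have hR0 : 0 ≤ R := (norm_nonneg _).trans hz
      have hw : ‖supMap W V (y.1.2, √(2 * t) • (‖S y.2‖⁻¹ • S y.2))‖ ≤ R :=
        (le_max_right _ _).trans h1
      have h2 := norm_supMap_sq hV (y.1.2, √(2 * t) • (‖S y.2‖⁻¹ • S y.2))
      rw [norm_sqrt_smul_normalized_sq hy ht0.le] at h2
      have h3 : ‖y.1.2‖ ^ 2 + 2 * t ≤ R ^ 2 := h2 ▸ pow_le_pow_left₀ (norm_nonneg _) hw 2
      have h4 : y.1 ∈ Metric.closedBall (0 : Z × W) R := by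
        rw [mem_closedBall_zero_iff, Prod.norm_def]
        exact max_le hz ((pow_le_pow_iff_left₀ (norm_nonneg _) hR0 two_ne_zero).1 (by linarith))
      rw [Set.indicator_of_mem h4, norm_mul,
        Real.norm_of_nonneg (Real.rpow_nonneg (le_max_right _ _) _)]
      refine mul_le_mul (Real.rpow_le_rpow (le_max_right _ _) (max_le ?_ (sq_nonneg _)) hk.le)
        (hM _) (norm_nonneg _) (by positivity)
      linarith [sq_nonneg ‖y.1.2‖]
  · have h1 := isFiniteMeasure_withDensity hfin
    have h2 := Measure.smul_finite ((((volume : Measure (Z × W)).prod P).withDensity fun y =>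
      ENNReal.ofReal (max (κ - Hzw HA C W y.1) 0 ^ ((Module.finrank ℝ V : ℝ) / 2 - 1))).map
        fun y => polarPoint W V y.1 (S y.2) (κ - Hzw HA C W y.1)) hct
    infer_instance

end EnergyShell

/-! ### Convergence of normalised images -/

section NormalizedDensity

variable {Y : Type*} [MeasurableSpace Y] {m : Measure Y} {d : Y → ℝ}

theorem lintegral_withDensity_univ_eq_ofReal (hd0 : ∀ y, 0 ≤ d y) (hdi : Integrable d m) :
    (m.withDensity fun y => ENNReal.ofReal (d y)) Set.univ = ENNReal.ofReal (∫ y, d y ∂m) := by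
  rw [withDensity_apply _ MeasurableSet.univ, Measure.restrict_univ,
    ofReal_integral_eq_lintegral_ofReal hdi (Eventually.of_forall hd0)]

variable {E : Type*} [TopologicalSpace E] [MeasurableSpace E] [OpensMeasurableSpace E]

theorem integral_normalized_map (hdm : Measurable d) (hd0 : ∀ y, 0 ≤ d y) (hdi : Integrable d m)
    {ψ : Y → E} (hψ : Measurable ψ) (φ : E →ᵇ ℝ) :
    ∫ x, φ x ∂(normalized ((m.withDensity fun y => ENNReal.ofReal (d y)).map ψ)) =
      (∫ y, d y ∂m)⁻¹ * ∫ y, d y * φ (ψ y) ∂m := by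
  rw [normalized, integral_smul_measure, Measure.map_apply hψ MeasurableSet.univ, Set.preimage_univ,
    lintegral_withDensity_univ_eq_ofReal hd0 hdi, ENNReal.toReal_inv,
    ENNReal.toReal_ofReal (integral_nonneg hd0),
    integral_map hψ.aemeasurable φ.continuous.measurable.aestronglyMeasurable,
    integral_withDensity_eq_integral_toReal_smul (by fun_prop) (by simp), smul_eq_mul]
  simp only [ENNReal.toReal_ofReal (hd0 _), smul_eq_mul]

/-- Dominated convergence is applied to the total mass and to the integral of `φ`, and the quotient
converges as the limiting mass is positive. Since the points `ψn` need to converge only along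
subsequences, the second limit uses the subsequence criterion; the limit being prescribed makes this
sufficient. -/
theorem tendsto_integral_normalized_map {dn : ℕ → Y → ℝ} (hdm : Measurable d)
    (hd0 : ∀ y, 0 ≤ d y) (hdi : Integrable d m) (hpos : 0 < ∫ y, d y ∂m)
    (hdnm : ∀ n, Measurable (dn n)) (hdn0 : ∀ n y, 0 ≤ dn n y) {b : Y → ℝ} (hb : Integrable b m)
    (hdnb : ∀ᶠ n in atTop, ∀ y, dn n y ≤ b y)
    (hlim : ∀ᵐ y ∂m, Tendsto (fun n => dn n y) atTop (𝓝 (d y)))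
    {ψn : ℕ → Y → E} (hψn : ∀ n, Measurable (ψn n)) {ψ : Y → E} (hψ : Measurable ψ) (φ : E →ᵇ ℝ)
    (hlimφ : ∀ ns : ℕ → ℕ, Tendsto ns atTop atTop → ∃ ms : ℕ → ℕ, Tendsto ms atTop atTop ∧
      ∀ᵐ y ∂m, Tendsto (fun k => dn (ns (ms k)) y * φ (ψn (ns (ms k)) y)) atTop
        (𝓝 (d y * φ (ψ y)))) :
    Tendsto (fun n => ∫ x, φ x ∂(normalized ((m.withDensity fun y =>
      ENNReal.ofReal (dn n y)).map (ψn n)))) atTop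
      (𝓝 (∫ x, φ x ∂(normalized ((m.withDensity fun y => ENNReal.ofReal (d y)).map ψ)))) := by
  have hφm : Measurable φ := φ.continuous.measurable
  have hdni : ∀ᶠ n in atTop, Integrable (dn n) m := hdnb.mono fun n hn =>
    hb.mono' (hdnm n).aestronglyMeasurable (Eventually.of_forall fun y => by
      rw [Real.norm_of_nonneg (hdn0 n y)]
      exact hn y)
  have h1 : Tendsto (fun n => ∫ y, dn n y ∂m) atTop (𝓝 (∫ y, d y ∂m)) := by
    refine tendsto_integral_filter_of_dominated_convergence b
      (Eventually.of_forall fun n => (hdnm n).aestronglyMeasurable) ?_ hb hlim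
    filter_upwards [hdnb] with n hn
    refine Eventually.of_forall fun y => ?_
    rw [Real.norm_of_nonneg (hdn0 n y)]
    exact hn y
  have h2 : Tendsto (fun n => ∫ y, dn n y * φ (ψn n y) ∂m) atTop
      (𝓝 (∫ y, d y * φ (ψ y) ∂m)) := by
    refine tendsto_of_subseq_tendsto fun ns hns => ?_
    obtain ⟨ms, hms, h⟩ := hlimφ ns hns
    refine ⟨ms, tendsto_integral_filter_of_dominated_convergence (fun y => b y * ‖φ‖)
      (Eventually.of_forall fun k =>
        ((hdnm _).mul (hφm.comp (hψn _))).aestronglyMeasurable) ?_ (hb.mul_const _) h⟩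
    filter_upwards [(hns.comp hms).eventually hdnb] with k hk
    refine Eventually.of_forall fun y => ?_
    rw [norm_mul, Real.norm_of_nonneg (hdn0 _ y)]
    exact mul_le_mul (hk y) (φ.norm_coe_le_norm _) (norm_nonneg _) ((hdn0 _ y).trans (hk y))
  rw [integral_normalized_map hdm hd0 hdi hψ]
  refine ((h1.inv₀ hpos.ne').mul h2).congr' ?_
  filter_upwards [hdni] with n hn
  rw [integral_normalized_map (hdnm n) (hdn0 n) hn (hψn n)]

end NormalizedDensity

/-! ### The energy shell at level `n / (2β) + E₀` -/

section Shell

variable {Z H : Type*} [NormedAddCommGroup Z] [InnerProductSpace ℝ Z] [FiniteDimensional ℝ Z]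
  [MeasurableSpace Z] [BorelSpace Z]
  [NormedAddCommGroup H] [InnerProductSpace ℝ H] [MeasurableSpace H] [BorelSpace H]
  {HA : Z → ℝ} {C : Z →L[ℝ] H} {W : Submodule ℝ H} [FiniteDimensional ℝ W]

theorem integrable_exp_sub_Hzw (hHA : Continuous HA) (hC : ∀ z, C z ∈ W) {β : ℝ} (hβ : 0 < β)
    (E₀ : ℝ) (hHAi : Integrable fun z => Real.exp (-β * (HA z - ‖C z‖ ^ 2 / 2))) :
    Integrable fun q : Z × W => Real.exp (β * (E₀ - Hzw HA C W q)) := by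
  have h := (limitZWE_univ_lt_top hHA hC hβ E₀ hHAi).ne
  have hm := (continuous_Hzw hHA C W).measurable
  rw [limitZWE_univ hHA] at h
  exact (lintegral_ofReal_ne_top_iff_integrable (by fun_prop)
    (Eventually.of_forall fun q => (Real.exp_pos _).le)).1 h

variable {Ω : Type*} [MeasurableSpace Ω] (P : Measure Ω) [IsProbabilityMeasure P]

theorem integral_exp_sub_Hzw_pos (hHA : Continuous HA) (hC : ∀ z, C z ∈ W) {β : ℝ} (hβ : 0 < β)
    (E₀ : ℝ) (hHAi : Integrable fun z => Real.exp (-β * (HA z - ‖C z‖ ^ 2 / 2))) :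
    0 < ∫ y, Real.exp (β * (E₀ - Hzw HA C W y.1)) ∂((volume : Measure (Z × W)).prod P) := by
  have hi := (integrable_exp_sub_Hzw hHA hC hβ E₀ hHAi).comp_fst P
  have : NeZero ((volume : Measure (Z × W)).prod P) := ⟨fun h => by
    have h1 := congrArg (fun μ : Measure ((Z × W) × Ω) => μ.map Prod.fst) h
    simp only [Measure.map_fst_prod, measure_univ, one_smul, Measure.map_zero] at h1
    exact NeZero.ne (volume : Measure (Z × W)) h1⟩
  exact integral_exp_pos hi

theorem integrable_shellDensity (hHA : Continuous HA) (hC : ∀ z, C z ∈ W) {β : ℝ} (hβ : 0 < β)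
    (E₀ : ℝ) (hHAi : Integrable fun z => Real.exp (-β * (HA z - ‖C z‖ ^ 2 / 2))) {n : ℕ}
    (hn : 2 < n) :
    Integrable (fun y => shellDensity n (β * (Hzw HA C W y.1 - E₀)))
      ((volume : Measure (Z × W)).prod P) := by
  have hm := (continuous_Hzw hHA C W).measurable
  have hs := measurable_shellDensity n
  refine (((integrable_exp_sub_Hzw hHA hC hβ E₀ hHAi).comp_fst P).const_mul (Real.exp 1)).mono'
    (by fun_prop : Measurable fun y : (Z × W) × Ω =>
      shellDensity n (β * (Hzw HA C W y.1 - E₀))).aestronglyMeasurable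
    (Eventually.of_forall fun y => ?_)
  rw [Real.norm_of_nonneg (shellDensity_nonneg _ _)]
  refine (shellDensity_le hn _).trans_eq ?_
  congr 2
  ring

variable {P} {Ξ : ℕ → Submodule ℝ H} [∀ n, FiniteDimensional ℝ (Ξ n)]

/-- At this level the weight is a positive constant times `shellDensity`, whose exponential bound
supplies the finite total mass. The constant is absorbed into `c`. -/
theorem exists_isPDelta_shellDensity (hHA : Continuous HA) (hC : ∀ z, C z ∈ W) {β : ℝ}
    (hβ : 0 < β) (E₀ : ℝ)
    (hHAi : Integrable fun z => Real.exp (-β * (HA z - ‖C z‖ ^ 2 / 2)))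
    (hΞW : ∀ n, Ξ n ≤ Wᗮ) (hdim : ∀ n, Module.finrank ℝ (Ξ n) = n) {n : ℕ} (hn : 2 < n)
    {S : Ω → Ξ n} (hS : Measurable S) {ρ : ℝ → ENNReal} (hρ : Measurable ρ)
    (hSρ : P.map S = (volume : Measure (Ξ n)).withDensity fun u => ρ ‖u‖) :
    ∃ c : ENNReal, c ≠ 0 ∧ c ≠ ⊤ ∧
      IsPDelta (fun p : Z × ↥(W ⊔ Ξ n) => Htotal HA C p.1 (p.2 : H) - n / (2 * β) - E₀)
        (c • (((volume : Measure (Z × W)).prod P).withDensity fun y =>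
          ENNReal.ofReal (shellDensity n (β * (Hzw HA C W y.1 - E₀)))).map
            fun y => polarPoint W (Ξ n) y.1 (S y.2) (n / (2 * β) + E₀ - Hzw HA C W y.1)) := by
  have hm := (continuous_Hzw hHA C W).measurable
  have hn0 : (0 : ℝ) < n := by exact_mod_cast (by omega : 0 < n)
  have hK : 0 < ((n : ℝ) / (2 * β)) ^ ((n : ℝ) / 2 - 1) := by positivity
  have hd : ∀ y : (Z × W) × Ω, ENNReal.ofReal (max (n / (2 * β) + E₀ - Hzw HA C W y.1) 0 ^
      ((n : ℝ) / 2 - 1)) = ENNReal.ofReal ((n / (2 * β)) ^ ((n : ℝ) / 2 - 1)) *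
        ENNReal.ofReal (shellDensity n (β * (Hzw HA C W y.1 - E₀))) := fun y => by
    rw [← ENNReal.ofReal_mul hK.le, ← max_rpow_eq_mul_shellDensity hβ hn]
    congr 3
    ring
  have hs := measurable_shellDensity n
  have hsd : Measurable fun y : (Z × W) × Ω =>
    ENNReal.ofReal (shellDensity n (β * (Hzw HA C W y.1 - E₀))) := by fun_prop
  have h := isPDelta_Htotal hHA hC (hΞW n) (by rwa [hdim]) hS hρ hSρ (n / (2 * β) + E₀)
  simp only [hdim, hd] at h
  obtain ⟨c, hc0, hct, hc⟩ := h (by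
    rw [lintegral_const_mul _ hsd]
    exact ENNReal.mul_ne_top ENNReal.ofReal_ne_top
      ((lintegral_ofReal_ne_top_iff_integrable
        (by fun_prop : Measurable fun y : (Z × W) × Ω =>
      shellDensity n (β * (Hzw HA C W y.1 - E₀))).aestronglyMeasurable
        (Eventually.of_forall fun y => shellDensity_nonneg _ _)).2
        (integrable_shellDensity P hHA hC hβ E₀ hHAi hn)))
  refine ⟨c * ENNReal.ofReal ((n / (2 * β)) ^ ((n : ℝ) / 2 - 1)),
    mul_ne_zero hc0 (ENNReal.ofReal_pos.2 hK).ne', ENNReal.mul_ne_top hct ENNReal.ofReal_ne_top, ?_⟩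
  have h1 := withDensity_smul (μ := (volume : Measure (Z × W)).prod P)
    (ENNReal.ofReal ((n / (2 * β)) ^ ((n : ℝ) / 2 - 1))) hsd
  rw [show (fun y : (Z × W) × Ω => ENNReal.ofReal ((n / (2 * β)) ^ ((n : ℝ) / 2 - 1)) *
    ENNReal.ofReal (shellDensity n (β * (Hzw HA C W y.1 - E₀)))) =
    ENNReal.ofReal ((n / (2 * β)) ^ ((n : ℝ) / 2 - 1)) • fun y : (Z × W) × Ω =>
    ENNReal.ofReal (shellDensity n (β * (Hzw HA C W y.1 - E₀))) from rfl, h1,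
    Measure.map_smul, smul_smul] at hc
  simpa only [sub_sub] using hc

end Shell

/-! ### The decomposition map and the Gaussian limit -/

section Decomposition

variable {Z H X : Type*} [NormedAddCommGroup H] [InnerProductSpace ℝ H]
  [NormedAddCommGroup X] [InnerProductSpace ℝ X] {β : ℝ} {ι : H →L[ℝ] X}
  {W : Submodule ℝ H} [W.HasOrthogonalProjection] {Ξ : ℕ → Submodule ℝ H}

theorem continuous_decomposition [NormedAddCommGroup Z] (hΞ : ∀ n, Ξ n ≤ Wᗮ) (n : ℕ) :
    Continuous fun p : Z × ↥(W ⊔ Ξ n) => decomposition β ι W Ξ hΞ n p := by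
  unfold decomposition
  fun_prop

/-- The bath coordinate is a scalar multiple of `ι u`, so its convergence separates into that of the
scalar and that of the Gaussian series. The conditions `u ≠ 0` and `0 ≤ t` make the squared norm
equal to `2t`. -/
theorem decomposition_polarPoint (hΞ : ∀ n, Ξ n ≤ Wᗮ) {n : ℕ} (q : Z × W) {u : Ξ n} (hu : u ≠ 0)
    {t : ℝ} (ht : 0 ≤ t) :
    decomposition β ι W Ξ hΞ n (polarPoint W (Ξ n) q u t) =
      (q.1, q.2, ⟨(√(2 * t) / ‖u‖) • ι u, subset_closure (Set.mem_iUnion.2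
        ⟨n, (√(2 * t) / ‖u‖) • (u : H), (Ξ n).smul_mem _ u.2, map_smul _ _ _⟩)⟩,
        t - n / (2 * β)) := by
  have h1 : W.orthogonalProjectionOnto ((polarPoint W (Ξ n) q u t).2 : H) = q.2 := by
    show W.orthogonalProjectionOnto ((q.2 : H) + ((√(2 * t) • (‖u‖⁻¹ • u) : Ξ n) : H)) = q.2
    rw [map_add, Submodule.orthogonalProjectionOnto_apply_of_mem_orthogonal (hΞ n (Subtype.mem _)),
      add_zero]
    exact W.orthogonalProjectionOnto_mem_subspace_eq_self q.2
  have h2 : ((polarPoint W (Ξ n) q u t).2 : H) - (q.2 : H) =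
      ((√(2 * t) • (‖u‖⁻¹ • u) : Ξ n) : H) := by
    show (q.2 : H) + ((√(2 * t) • (‖u‖⁻¹ • u) : Ξ n) : H) - q.2 = _
    rw [add_sub_cancel_left]
  have h3 : ‖((√(2 * t) • (‖u‖⁻¹ • u) : Ξ n) : H)‖ ^ 2 = 2 * t :=
    norm_sqrt_smul_normalized_sq hu ht
  unfold decomposition
  simp only [h1, h2, h3]
  refine Prod.ext rfl (Prod.ext rfl (Prod.ext (Subtype.ext ?_) (by simp)))
  simp [smul_smul, div_eq_mul_inv]

end Decomposition

section GaussianLimit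

variable {H X : Type*} [NormedAddCommGroup H] [InnerProductSpace ℝ H]
  [NormedAddCommGroup X] [InnerProductSpace ℝ X]

theorem zero_mem_XiX (ι : H →L[ℝ] X) (Ξ : ℕ → Submodule ℝ H) : (0 : X) ∈ XiX ι Ξ :=
  subset_closure (Set.mem_iUnion.2 ⟨0, 0, (Ξ 0).zero_mem, map_zero ι⟩)

variable [CompleteSpace X] [MeasurableSpace X] [BorelSpace X]

/-- The limit of the Gaussian series, as a variable with values in the closed subset `XiX`. -/
theorem exists_tendstoInMeasure_XiX [CompleteSpace H] {ι : H →L[ℝ] X} (hι : IsHilbertSchmidt ι)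
    (v : NNReal) {Ξ : ℕ → Submodule ℝ H} {e : ℕ → H} (he : Orthonormal ℝ e)
    (heΞ : ∀ i n, i < n → e i ∈ Ξ n) :
    ∃ G : (ℕ → ℝ) → XiX ι Ξ, Measurable G ∧ TendstoInMeasure (whiteNoise v)
      (fun n ω => ∑ i ∈ Finset.range n, ω i • ι (e i)) atTop fun ω => (G ω : X) := by
  classical
  obtain ⟨T, hTm, hT⟩ := exists_tendstoInMeasure_whiteNoise v (hι.summable_norm_sq he)
  have hcl : IsClosed (XiX ι Ξ) := isClosed_closure
  have hmem : ∀ᵐ ω ∂(whiteNoise v), T ω ∈ XiX ι Ξ := by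
    obtain ⟨ns, -, h⟩ := hT.exists_seq_tendsto_ae
    filter_upwards [h] with ω hω
    refine hcl.mem_of_tendsto hω (Eventually.of_forall fun k => subset_closure
      (Set.mem_iUnion.2 ⟨ns k, ∑ i ∈ Finset.range (ns k), ω i • e i,
        (Ξ (ns k)).sum_mem fun i hi => (Ξ (ns k)).smul_mem _ (heΞ i _ (Finset.mem_range.1 hi)), ?_⟩))
    simp
  -- Resetting `T` to `0` on a null set makes every value lie in the closed set, so that the limit
  -- becomes a map into the subtype.
  let T' : (ℕ → ℝ) → X := (T ⁻¹' XiX ι Ξ).indicator T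
  have hT'm : Measurable T' := hTm.indicator (hTm hcl.measurableSet)
  have hT' : ∀ ω, T' ω ∈ XiX ι Ξ := fun ω => by
    by_cases h : T ω ∈ XiX ι Ξ
    · simp [T', h]
    · simp [T', h, zero_mem_XiX ι Ξ]
  refine ⟨fun ω => ⟨T' ω, hT' ω⟩, hT'm.subtype_mk, hT.congr (fun n => ae_eq_refl _) ?_⟩
  filter_upwards [hmem] with ω hω
  simp [T', hω]

end GaussianLimit

section LimitMeasure

variable {Z H X : Type*} [NormedAddCommGroup Z] [InnerProductSpace ℝ Z] [FiniteDimensional ℝ Z]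
  [MeasurableSpace Z] [BorelSpace Z]
  [NormedAddCommGroup H] [InnerProductSpace ℝ H] [MeasurableSpace H] [BorelSpace H]
  [NormedAddCommGroup X] [InnerProductSpace ℝ X] [MeasurableSpace X] [BorelSpace X]
  {HA : Z → ℝ} {C : Z →L[ℝ] H} {W : Submodule ℝ H} [FiniteDimensional ℝ W]

/-- The limit measure as a normalised image of a product measure. -/
theorem limitMeasure_eq_normalized_map (hHA : Continuous HA) (β E₀ : ℝ) {ι : H →L[ℝ] X}
    {Ξ : ℕ → Submodule ℝ H} {Ω : Type*} [MeasurableSpace Ω] {P : Measure Ω} [IsProbabilityMeasure P]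
    {G : Ω → XiX ι Ξ} (hG : Measurable G) {ν : Measure X} (hν : P.map (fun ω => (G ω : X)) = ν) :
    limitMeasure HA C β E₀ ι W Ξ ν =
      normalized ((((volume : Measure (Z × W)).prod P).withDensity fun y =>
        ENNReal.ofReal (Real.exp (β * (E₀ - Hzw HA C W y.1)))).map
          fun y => (y.1.1, y.1.2, G y.2, E₀ - Hzw HA C W y.1)) := by
  have hm := (continuous_Hzw hHA C W).measurable
  have hcl : MeasurableSet (XiX ι Ξ) := isClosed_closure.measurableSet
  -- `ν` is the image of a law on the closed subset, so pulling it back along the measurable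
  -- embedding recovers that law.
  have hcomap : ν.comap (Subtype.val : XiX ι Ξ → X) = P.map G := by
    rw [← hν, show (fun ω => (G ω : X)) = Subtype.val ∘ G from rfl,
      ← Measure.map_map measurable_subtype_coe hG,
      (MeasurableEmbedding.subtype_coe hcl).comap_map]
  have : IsProbabilityMeasure (P.map G) := Measure.isProbabilityMeasure_map hG.aemeasurable
  have hprod : ((volume : Measure (Z × W)).withDensity fun q =>
      ENNReal.ofReal (Real.exp (β * (E₀ - Hzw HA C W q)))).prod P =
      ((volume : Measure (Z × W)).prod P).withDensity fun y =>
        ENNReal.ofReal (Real.exp (β * (E₀ - Hzw HA C W y.1))) := by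
    rw [prod_withDensity_left (by fun_prop)]
  have hmap : ((limitZWE HA C β E₀ W).prod (P.map G)).map
      (fun p => (p.1.1.1, p.1.1.2, p.2, p.1.2)) =
      (((volume : Measure (Z × W)).prod P).withDensity fun y =>
        ENNReal.ofReal (Real.exp (β * (E₀ - Hzw HA C W y.1)))).map
          fun y => (y.1.1, y.1.2, G y.2, E₀ - Hzw HA C W y.1) := by
    rw [limitZWE_eq_map hHA, Measure.map_prod_map _ _ (by fun_prop) hG, hprod,
      Measure.map_map (by fun_prop) (by fun_prop)]
    rfl
  have hmass : (((volume : Measure (Z × W)).prod P).withDensity fun y =>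
      ENNReal.ofReal (Real.exp (β * (E₀ - Hzw HA C W y.1)))) Set.univ =
      limitZWE HA C β E₀ W Set.univ := by
    rw [← hprod, ← Set.univ_prod_univ, Measure.prod_prod, measure_univ (μ := P), mul_one,
      withDensity_apply _ MeasurableSet.univ, Measure.restrict_univ, limitZWE_univ hHA]
  rw [limitMeasure, hcomap, hmap, normalized, Measure.map_apply (by fun_prop) MeasurableSet.univ,
    Set.preimage_univ, hmass]

end LimitMeasure

/-! ### Almost sure convergence along subsequences -/

section Limit

variable {Z H X : Type*} [NormedAddCommGroup Z] [InnerProductSpace ℝ Z]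
  [NormedAddCommGroup H] [InnerProductSpace ℝ H]
  [NormedAddCommGroup X] [InnerProductSpace ℝ X]

/-- Divided by `n`, the squared numerator is `β⁻¹ + 2x/n` and the squared denominator tends to
`β⁻¹`: the radius fixed by the energy and the Gaussian radius agree to leading order. -/
theorem tendsto_sqrt_div {β : ℝ} (hβ : 0 < β) (x : ℝ) {r : ℕ → ℝ} (hr0 : ∀ n, 0 ≤ r n)
    (hr : Tendsto (fun n : ℕ => r n ^ 2 / n) atTop (𝓝 β⁻¹)) :
    Tendsto (fun n : ℕ => √(2 * (n / (2 * β) + x)) / r n) atTop (𝓝 1) := by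
  have h1 : Tendsto (fun n : ℕ => β⁻¹ + 2 * x / n) atTop (𝓝 β⁻¹) := by
    simpa using (tendsto_const_div_atTop_nhds_zero_nat (2 * x)).const_add β⁻¹
  have h2 := (h1.div hr (inv_pos.2 hβ).ne').sqrt
  rw [div_self (inv_pos.2 hβ).ne', Real.sqrt_one] at h2
  refine h2.congr' ?_
  filter_upwards [eventually_gt_atTop 0] with n hn
  have hn' : (n : ℝ) ≠ 0 := by exact_mod_cast hn.ne'
  rw [Pi.div_apply, ← Real.sqrt_sq (hr0 n), ← Real.sqrt_div' _ (sq_nonneg _),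
    Real.sqrt_sq (hr0 n)]
  congr 1
  field_simp

variable {HA : Z → ℝ} {C : Z →L[ℝ] H} {W : Submodule ℝ H} [FiniteDimensional ℝ W]
  {Ξ : ℕ → Submodule ℝ H}

/-- Convergence of the decomposed polar points when the radii obey the law of large numbers. -/
theorem tendsto_decomposition_polarPoint {β : ℝ} (hβ : 0 < β) (E₀ : ℝ) {ι : H →L[ℝ] X}
    (hΞW : ∀ n, Ξ n ≤ Wᗮ) (q : Z × W) {u : ∀ n, Ξ n}
    (hu : Tendsto (fun n : ℕ => ‖u n‖ ^ 2 / n) atTop (𝓝 β⁻¹)) {N : ℕ → ℕ}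
    (hN : Tendsto N atTop atTop) {ξ : XiX ι Ξ}
    (hξ : Tendsto (fun k => ι (u (N k))) atTop (𝓝 (ξ : X))) :
    Tendsto (fun k => decomposition β ι W Ξ hΞW (N k) (polarPoint W (Ξ (N k)) q (u (N k))
      ((N k : ℕ) / (2 * β) + E₀ - Hzw HA C W q))) atTop
      (𝓝 (q.1, q.2, ξ, E₀ - Hzw HA C W q)) := by
  have hr := (tendsto_sqrt_div hβ (E₀ - Hzw HA C W q) (fun n => norm_nonneg (u n)) hu).comp hN
  have hlim : Tendsto (fun k => (√(2 * ((N k : ℕ) / (2 * β) + E₀ - Hzw HA C W q)) / ‖u (N k)‖) •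
      ι (u (N k))) atTop (𝓝 (ξ : X)) := by
    have := hr.smul hξ
    rw [one_smul] at this
    refine this.congr fun k => ?_
    simp only [Function.comp_apply, add_sub_assoc]
  have hs : ∀ᶠ k in atTop, (0 : ℝ) ≤ (N k : ℕ) / (2 * β) + E₀ - Hzw HA C W q := by
    have h1 : Tendsto (fun n : ℕ => (n : ℝ) / (2 * β)) atTop atTop :=
      tendsto_natCast_atTop_atTop.atTop_div_const (by positivity)
    filter_upwards [(h1.comp hN).eventually_ge_atTop (Hzw HA C W q - E₀)] with k hk
    simp only [Function.comp_apply] at hk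
    linarith
  -- The positive limit `β⁻¹` of `‖u n‖² / n` rules out `u n = 0` for large `n`.
  have hu0 : ∀ᶠ k in atTop, u (N k) ≠ 0 := by
    filter_upwards [hN.eventually (hu.eventually (lt_mem_nhds (inv_pos.2 hβ)))] with k hk h0
    rw [h0] at hk
    simp at hk
  have hpt : ∀ᶠ k in atTop, decomposition β ι W Ξ hΞW (N k) (polarPoint W (Ξ (N k)) q (u (N k))
      ((N k : ℕ) / (2 * β) + E₀ - Hzw HA C W q)) = (q.1, q.2,
        ⟨(√(2 * ((N k : ℕ) / (2 * β) + E₀ - Hzw HA C W q)) / ‖u (N k)‖) • ι (u (N k)),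
          subset_closure (Set.mem_iUnion.2 ⟨N k, (√(2 * ((N k : ℕ) / (2 * β) + E₀ - Hzw HA C W q)) /
            ‖u (N k)‖) • (u (N k) : H), (Ξ (N k)).smul_mem _ (u (N k)).2, map_smul _ _ _⟩)⟩,
        E₀ - Hzw HA C W q) := by
    filter_upwards [hs, hu0] with k hk1 hk2
    rw [decomposition_polarPoint hΞW q hk2 hk1]
    refine Prod.ext rfl (Prod.ext rfl (Prod.ext rfl ?_))
    show (N k : ℝ) / (2 * β) + E₀ - Hzw HA C W q - N k / (2 * β) = E₀ - Hzw HA C W q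
    ring
  refine Tendsto.congr' (hpt.mono fun k hk => hk.symm) ?_
  exact tendsto_const_nhds.prodMk_nhds (tendsto_const_nhds.prodMk_nhds
    ((tendsto_subtype_rng.2 hlim).prodMk_nhds tendsto_const_nhds))

/-- Every sequence of indices has a subsequence along which the decomposed polar points of the
Gaussian sums converge almost surely. -/
theorem exists_subseq_tendsto_decomposition [MeasurableSpace Z] [MeasurableSpace H]
    [∀ n, FiniteDimensional ℝ (Ξ n)] {β : ℝ} (hβ : 0 < β) (E₀ : ℝ) {ι : H →L[ℝ] X}
    (hΞW : ∀ n, Ξ n ≤ Wᗮ) {e : ℕ → H} (he : Orthonormal ℝ e) (heΞ : ∀ i n, i < n → e i ∈ Ξ n)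
    {v : NNReal} (hv : (v : ℝ) = β⁻¹) {G : (ℕ → ℝ) → XiX ι Ξ}
    (hG : TendstoInMeasure (whiteNoise v)
      (fun n ω => ∑ i ∈ Finset.range n, ω i • ι (e i)) atTop fun ω => (G ω : X))
    (μ : Measure (Z × W)) {ns : ℕ → ℕ} (hns : Tendsto ns atTop atTop) :
    ∃ ms : ℕ → ℕ, Tendsto ms atTop atTop ∧ ∀ᵐ y ∂(μ.prod (whiteNoise v)),
      Tendsto (fun k => decomposition β ι W Ξ hΞW (ns (ms k)) (polarPoint W (Ξ (ns (ms k))) y.1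
        (gaussianSum Ξ e (ns (ms k)) y.2) ((ns (ms k) : ℕ) / (2 * β) + E₀ - Hzw HA C W y.1)))
        atTop (𝓝 (y.1.1, y.1.2, G y.2, E₀ - Hzw HA C W y.1)) := by
  have hG' : TendstoInMeasure (whiteNoise v)
      (fun k ω => ∑ i ∈ Finset.range (ns k), ω i • ι (e i)) atTop fun ω => (G ω : X) :=
    fun ε hε => (hG ε hε).comp hns
  -- Only the series in `X` needs a subsequence; the law of large numbers holds along the full
  -- sequence.
  obtain ⟨ms, hms, hae⟩ := hG'.exists_seq_tendsto_ae
  refine ⟨ms, hms.tendsto_atTop, ?_⟩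
  have hae' : ∀ᵐ ω ∂(whiteNoise v), Tendsto (fun n : ℕ => ‖gaussianSum Ξ e n ω‖ ^ 2 / n) atTop
      (𝓝 β⁻¹) := by
    filter_upwards [tendsto_sum_sq_whiteNoise v] with ω hω
    simpa only [norm_gaussianSum_sq he heΞ, hv] using hω
  have hsnd := Measure.quasiMeasurePreserving_snd (μ := μ) (ν := whiteNoise v)
  filter_upwards [hsnd.ae hae, hsnd.ae hae'] with y hy hy'
  refine tendsto_decomposition_polarPoint hβ E₀ hΞW y.1 hy' (hns.comp hms.tendsto_atTop) ?_
  refine hy.congr fun k => ?_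
  simp [coe_gaussianSum heΞ, map_sum]

end Limit

end

/-! ### The theorem -/

theorem lemmal {Z H X : Type*}
    [NormedAddCommGroup Z] [InnerProductSpace ℝ Z] [FiniteDimensional ℝ Z]
    [MeasurableSpace Z] [BorelSpace Z]
    [NormedAddCommGroup H] [InnerProductSpace ℝ H] [CompleteSpace H]
    [SecondCountableTopology H] [MeasurableSpace H] [BorelSpace H]
    [NormedAddCommGroup X] [InnerProductSpace ℝ X] [CompleteSpace X]
    [SecondCountableTopology X] [MeasurableSpace X] [BorelSpace X]
    (ι : H →L[ℝ] X) (hι : Function.Injective ι) (hιd : DenseRange ι)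
    (hιHS : IsHilbertSchmidt ι)
    (W : Submodule ℝ H) [FiniteDimensional ℝ W]
    (C : Z →L[ℝ] H) (hC : ∀ z, C z ∈ W)
    (β : ℝ) (hβ : 0 < β) (E₀ : ℝ)
    (HA : Z → ℝ) (hHA : ContDiff ℝ 2 HA) (hHAL : ∃ K, LipschitzWith K (fderiv ℝ HA))
    (hHAi : Integrable fun z => Real.exp (-β * (HA z - ‖C z‖ ^ 2 / 2)))
    (Ξ : ℕ → Submodule ℝ H) [∀ n, FiniteDimensional ℝ (Ξ n)]
    (hΞmono : Monotone Ξ) (hΞdim : ∀ n, Module.finrank ℝ (Ξ n) = n)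
    (hΞW : ∀ n, Ξ n ≤ Wᗮ) (hΞdense : (⨆ n, Ξ n).topologicalClosure = Wᗮ)
    (Phat : X → W)
    (hPhat : IsMeasurableLinearExtension (canonicalGaussian β ι) ι
      (fun η => W.orthogonalProjectionOnto η) Phat) :
    (∀ᶠ n in atTop,
      IsPDelta (fun p : Z × ↥(W ⊔ Ξ n) => Htotal HA C p.1 (p.2 : H) - n / (2 * β) - E₀)
        (energyShell HA C β E₀ W Ξ n) ∧
      IsProbabilityMeasure (microcanonical HA C β E₀ W Ξ n)) ∧
    (0 < limitZWE HA C β E₀ W Set.univ ∧ limitZWE HA C β E₀ W Set.univ < ⊤) ∧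
    (W ≠ ⊥ →
      (∀ᵐ e : ℝ, IsPDelta (fun q : Z × W => Hzw HA C W q - E₀ + e)
        (pdelta fun q : Z × W => Hzw HA C W q - E₀ + e)) ∧
      limitZWE HA C β E₀ W =
        ((volume : Measure ℝ).withDensity fun e => ENNReal.ofReal (Real.exp (β * e))).bind
          fun e => (pdelta fun q : Z × W => Hzw HA C W q - E₀ + e).map fun q => (q, e)) ∧
    IsProbabilityMeasure (limitMeasure HA C β E₀ ι W Ξ
      ((canonicalGaussian β ι).map fun x => x - ι (Phat x))) ∧
    ∀ φ : (Z × W × XiX ι Ξ × ℝ) →ᵇ ℝ,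
      Tendsto (fun n => ∫ y, φ y ∂(microcanonicalE HA C β E₀ ι W Ξ hΞW n)) atTop
        (𝓝 (∫ y, φ y ∂(limitMeasure HA C β E₀ ι W Ξ
          ((canonicalGaussian β ι).map fun x => x - ι (Phat x))))) := by
  have hHAc : Continuous HA := hHA.continuous
  have hm := (continuous_Hzw hHAc C W).measurable
  obtain ⟨e, he, heΞ⟩ := exists_orthonormal_adapted hΞmono hΞdim
  obtain ⟨v, hv⟩ : ∃ v : NNReal, (v : ℝ) = β⁻¹ := ⟨⟨β⁻¹, (inv_pos.2 hβ).le⟩, rfl⟩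
  have hv0 : 0 < v := by
    rw [← NNReal.coe_pos, hv]
    exact inv_pos.2 hβ
  obtain ⟨G, hGm, hG⟩ := exists_tendstoInMeasure_XiX hιHS v he heΞ
  have hGX : Measurable fun ω => (G ω : X) := measurable_subtype_coe.comp hGm
  have hprob : IsProbabilityMeasure ((whiteNoise v).map fun ω => (G ω : X)) :=
    Measure.isProbabilityMeasure_map hGX.aemeasurable
  -- Both laws are determined by the variance `β⁻¹ ‖Q ι* x‖²`; density of the union of the `Ξ n` in
  -- `Wᗮ` enters here.
  have hν : (whiteNoise v).map (fun ω => (G ω : X)) =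
      (canonicalGaussian β ι).map fun x => x - ι (Phat x) := by
    refine (map_sub_linearExtension_eq hβ (isCanonicalGaussian_canonicalGaussian hβ hιHS) W
      (fun x => ?_) hPhat).symm
    rw [charFun_map_whiteNoise_limit hΞmono hΞdim hΞdense he heΞ ι v hGX hG x, hv]
  choose ρ hρ hSρ using fun n => exists_radial_density_gaussianSum hΞdim he heΞ hv0 n
  have hSm : ∀ n, Measurable (gaussianSum Ξ e n) := fun n => measurable_gaussianSum n
  -- the weights on the parameter space
  let m : Measure ((Z × W) × (ℕ → ℝ)) := (volume : Measure (Z × W)).prod (whiteNoise v)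
  let dn : ℕ → (Z × W) × (ℕ → ℝ) → ℝ := fun n y => shellDensity n (β * (Hzw HA C W y.1 - E₀))
  let d : (Z × W) × (ℕ → ℝ) → ℝ := fun y => Real.exp (β * (E₀ - Hzw HA C W y.1))
  let ϑ : ∀ n, (Z × W) × (ℕ → ℝ) → Z × ↥(W ⊔ Ξ n) := fun n y =>
    polarPoint W (Ξ n) y.1 (gaussianSum Ξ e n y.2) (n / (2 * β) + E₀ - Hzw HA C W y.1)
  have hdm : Measurable d := by fun_prop
  have hd0 : ∀ y, 0 ≤ d y := fun y => (Real.exp_pos _).le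
  have hdi : Integrable d m := (integrable_exp_sub_Hzw hHAc hC hβ E₀ hHAi).comp_fst _
  have hdpos : 0 < ∫ y, d y ∂m := integral_exp_sub_Hzw_pos (whiteNoise v) hHAc hC hβ E₀ hHAi
  have hdnm : ∀ n, Measurable (dn n) := fun n => (measurable_shellDensity n).comp (by fun_prop)
  have hdn0 : ∀ n y, 0 ≤ dn n y := fun n y => shellDensity_nonneg _ _
  have hdni : ∀ n, 2 < n → Integrable (dn n) m := fun n hn =>
    integrable_shellDensity (whiteNoise v) hHAc hC hβ E₀ hHAi hn
  have hdnb : ∀ᶠ n in atTop, ∀ y, dn n y ≤ Real.exp 1 * d y := by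
    filter_upwards [eventually_gt_atTop 2] with n hn y
    refine (shellDensity_le hn _).trans_eq ?_
    simp only [d]
    congr 2
    ring
  have hdlim : ∀ y, Tendsto (fun n => dn n y) atTop (𝓝 (d y)) := fun y => by
    have := tendsto_shellDensity (β * (Hzw HA C W y.1 - E₀))
    rwa [show -(β * (Hzw HA C W y.1 - E₀)) = β * (E₀ - Hzw HA C W y.1) by ring] at this
  have hϑ : ∀ n, Measurable (ϑ n) := fun n => (measurable_polarPoint W (Ξ n)).comp
    (by fun_prop : Measurable fun y : (Z × W) × (ℕ → ℝ) =>
      ((y.1, gaussianSum Ξ e n y.2), (n : ℝ) / (2 * β) + E₀ - Hzw HA C W y.1))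
  have hint : Tendsto (fun n => ∫ y, dn n y ∂m) atTop (𝓝 (∫ y, d y ∂m)) :=
    tendsto_integral_filter_of_dominated_convergence (fun y => Real.exp 1 * d y)
      (Eventually.of_forall fun n => (hdnm n).aestronglyMeasurable)
      (hdnb.mono fun n hn => Eventually.of_forall fun y => by
        rw [Real.norm_of_nonneg (hdn0 n y)]
        exact hn y) (hdi.const_mul _) (Eventually.of_forall hdlim)
  have hshell : ∀ n, 2 < n → IsPDelta
      (fun p : Z × ↥(W ⊔ Ξ n) => Htotal HA C p.1 (p.2 : H) - n / (2 * β) - E₀)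
        (energyShell HA C β E₀ W Ξ n) ∧ microcanonical HA C β E₀ W Ξ n =
          normalized ((m.withDensity fun y => ENNReal.ofReal (dn n y)).map (ϑ n)) := by
    intro n hn
    obtain ⟨c, hc0, hct, hc⟩ := exists_isPDelta_shellDensity hHAc hC hβ E₀ hHAi hΞW hΞdim hn
      (hSm n) (hρ n) (hSρ n)
    have : ProperSpace ↥(W ⊔ Ξ n) := FiniteDimensional.proper ℝ _
    have heq := hc.eq_pdelta
    refine ⟨?_, ?_⟩
    · rw [energyShell, heq]
      exact hc
    · rw [microcanonical, energyShell, heq, normalized_smul hc0 hct]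
  have hlimit := limitMeasure_eq_normalized_map (C := C) (W := W) hHAc β E₀ hGm hν
  refine ⟨?_, ⟨limitZWE_univ_pos hHAc C β E₀, limitZWE_univ_lt_top hHAc hC hβ E₀ hHAi⟩,
    limitZWE_disintegration hHAc hC hβ E₀ hHAi, ?_, fun φ => ?_⟩
  -- The shell density may vanish identically for small `n`; its integral is positive eventually
  -- because it converges to a positive limit.
  · filter_upwards [eventually_gt_atTop 2, hint.eventually (lt_mem_nhds hdpos)] with n hn hpos
    refine ⟨(hshell n hn).1, ?_⟩
    rw [(hshell n hn).2]
    have hmass : ((m.withDensity fun y => ENNReal.ofReal (dn n y)).map (ϑ n)) Set.univ =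
        ENNReal.ofReal (∫ y, dn n y ∂m) := by
      rw [Measure.map_apply (hϑ n) MeasurableSet.univ, Set.preimage_univ,
        lintegral_withDensity_univ_eq_ofReal (hdn0 n) (hdni n hn)]
    refine isProbabilityMeasure_normalized ?_ ?_
    · rw [hmass]
      exact (ENNReal.ofReal_pos.2 hpos).ne'
    · rw [hmass]
      exact ENNReal.ofReal_ne_top
  · rw [hlimit]
    have hmass : ((m.withDensity fun y => ENNReal.ofReal (d y)).map
        fun y => (y.1.1, y.1.2, G y.2, E₀ - Hzw HA C W y.1)) Set.univ =
        ENNReal.ofReal (∫ y, d y ∂m) := by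
      rw [Measure.map_apply (by fun_prop) MeasurableSet.univ, Set.preimage_univ,
        lintegral_withDensity_univ_eq_ofReal hd0 hdi]
    refine isProbabilityMeasure_normalized ?_ ?_
    · rw [hmass]
      exact (ENNReal.ofReal_pos.2 hdpos).ne'
    · rw [hmass]
      exact ENNReal.ofReal_ne_top
  · rw [hlimit]
    have hdec : ∀ n, Measurable (decomposition (Z := Z) β ι W Ξ hΞW n) := fun n =>
      (continuous_decomposition hΞW n).measurable
    -- Normalisation commutes with the push-forward, so for `2 < n` the measure is the normalised
    -- image of the weighted parameter space under the composed map.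
    refine (tendsto_integral_normalized_map hdm hd0 hdi hdpos hdnm hdn0 (hdi.const_mul _) hdnb
      (Eventually.of_forall hdlim) (ψn := fun n y => decomposition β ι W Ξ hΞW n (ϑ n y))
      (fun n => (hdec n).comp (hϑ n)) (by fun_prop) φ fun ns hns => ?_).congr' ?_
    · obtain ⟨ms, hms, hae⟩ := exists_subseq_tendsto_decomposition (HA := HA) (C := C) hβ E₀ hΞW
        he heΞ hv hG (volume : Measure (Z × W)) hns
      refine ⟨ms, hms, ?_⟩
      filter_upwards [hae] with y hy
      exact ((hdlim y).comp (hns.comp hms)).mul ((φ.continuous.tendsto _).comp hy)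
    · filter_upwards [eventually_gt_atTop 2] with n hn
      rw [microcanonicalE, (hshell n hn).2, ← normalized_map _ (hdec n),
        Measure.map_map (hdec n) (hϑ n)]
      rfl
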